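/- Let $K$ be a field with $\operatorname{char}K\neq 2$; all tensor products are over $K$. **Braided bialgebras.** A *braided vector space* is a pair $(V,\mathfrak c)$ with $\mathfrak c:V\otimes V\to V\otimes V$ a $K$-linear map satisfying $\mathfrak c_1\mathfrak c_2\mathfrak c_1=\mathfrak c_2\mathfrak c_1\mathfrak c_2$ on $V^{\otimes 3}$, where $\mathfrak c_1=\mathfrak c\otimes \mathrm{Id}$ and $\mathfrak c_2=\mathrm{Id}\otimes\mathfrak c$ ($\mathfrak c$ is not assumed invertible). It is *of Hecke type of mark* $\lambda\in K$ if $(\mathfrak c+\mathrm{Id})(\mathfrak c-\lambda\,\mathrm{Id})=0$. A *braided bialgebra* $(A,\nabla,1,\Delta,\varepsilon,\mathfrak c)$ is a braided vector space $(A,\mathfrak c)$ with an associative unital algebra structure and a coassociative counital coalgebra structure such that * $\mathfrak c(\nabla\otimes A)=(A\otimes\nabla)\mathfrak c_1\mathfrak c_2$, $\ \mathfrak c(A\otimes\nabla)=(\nabla\otimes A)\mathfrak c_2\mathfrak c_1$, $\ \mathfrak c(1\otimes a)=a\otimes 1$, $\ \mathfrak c(a\otimes 1)=1\otimes a$; *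 $(A\otimes\Delta)\mathfrak c=\mathfrak c_1\mathfrak c_2(\Delta\otimes A)$, $\ (\Delta\otimes A)\mathfrak c=\mathfrak c_2\mathfrak c_1(A\otimes\Delta)$, $\ (\varepsilon\otimes A)\mathfrak c(a\otimes b)=\varepsilon(b)a=(A\otimes\varepsilon)\mathfrak c(b\otimes a)$; * $\Delta$ and $\varepsilon$ are morphisms of unital algebras, where $A\otimes A$ has the product $(\nabla\otimes\nabla)(A\otimes\mathfrak c\otimes A)$. An isomorphism of braided bialgebras is an isomorphism of algebras and of coalgebras that commutes with the braidings. $A$ is *connected* if its coradical $A_0$ (the sum of its simple subcoalgebras) is one-dimensional; then $A_0=K1$. Let $A_0\subseteq A_1\subseteq A_2\subseteq\cdots$ be the coradical filtration, $A_{n+1}=\Delta^{-1}(A_0\otimes A+A\otimes A_n)$, and $P=P(A)=\{a\in A:\Delta(a)=a\otimes1+1\otimes a\}$. **Infinitesimal data.** Let $A$ be a connected braided bialgebra. Then $\mathfrak c$ restricts to a braiding $\mathfrak c_P$ of $P\otimes P$, the *infinitesimal braiding* of $A$, and $P\to A_1/A_0$ is an isomorphism. The *infinitesimal comultiplication* is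 the map $\Delta^{1,1}:A_2/A_1\to A_1/A_0\otimes A_1/A_0= P\otimes P$ induced by $\Delta$ (the degree $(1,1)$ component of the comultiplication of the graded coalgebra associated with the coradical filtration). For $\lambda\in K\setminus\{0\}$ it is *$\lambda$-cocommutative* if $\mathfrak c_P\circ\Delta^{1,1}=\lambda\,\Delta^{1,1}$. The element $\lambda\neq0$ is *regular* if $1+\lambda+\cdots+\lambda^{n-1}\neq0$ for all $n\ge1$. **Braided symmetric algebra.** For a braided vector space $(V,\mathfrak c)$, the tensor algebra $T=T(V)$ is a braided bialgebra $T(V,\mathfrak c)$: its braiding $\mathfrak c_T$ is the unique extension of $\mathfrak c$ compatible with the product and the unit of $T$ as in the first item above, $\Delta_T$ is the unique algebra morphism into $T\otimes T$ with product $(\nabla\otimes\nabla)(T\otimes\mathfrak c_T\otimes T)$ such that $\Delta_T(v)=v\otimes1+1\otimes v$ for $v\in V$, and $\varepsilon_T$ is the algebra morphism vanishing on $V$. If $(V,\mathfrak c)$ is of Hecke type of mark $\lambda$, then $S(V,\mathfrak c)$ is the quotient of $T(V,\mathfrak c)$ by the two-sided ideal generated by $\{\mathfrak c(z)-\lambda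 z: z\in V\otimes V\}$, with the induced braided bialgebra structure. **Theorem.** Let $A$ be a connected braided bialgebra over $K$ whose infinitesimal comultiplication is $\lambda$-cocommutative for some regular $\lambda\neq0$ in $K$. Then 1. the infinitesimal braiding $\mathfrak c_{P}$ of $A$ is of Hecke type of mark $\lambda$; 2. if $\lambda\neq1$, then $A$ is isomorphic as a braided bialgebra to the braided symmetric algebra $S(P(A),\mathfrak c_{P})$. -/

import Mathlib

open TensorProduct

namespace Braided

noncomputable section

universe u v w

/-! ### Braided vector spaces -/

/-- `𝔠₁ = 𝔠 ⊗ V`, on `V ⊗ V ⊗ V`. -/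
def left {K : Type u} [Field K] {V : Type v} [AddCommGroup V] [Module K V]
    (c : V ⊗[K] V →ₗ[K] V ⊗[K] V) : (V ⊗[K] V) ⊗[K] V →ₗ[K] (V ⊗[K] V) ⊗[K] V :=
  c.rTensor V

/-- `𝔠₂ = V ⊗ 𝔠`, on `V ⊗ V ⊗ V`. -/
def right {K : Type u} [Field K] {V : Type v} [AddCommGroup V] [Module K V]
    (c : V ⊗[K] V →ₗ[K] V ⊗[K] V) : (V ⊗[K] V) ⊗[K] V →ₗ[K] (V ⊗[K] V) ⊗[K] V :=
  (TensorProduct.assoc K V V V).symm.toLinearMap ∘ₗ c.lTensor V ∘ₗ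
    (TensorProduct.assoc K V V V).toLinearMap

/-- `V ⊗ 𝔠 ⊗ V`, on `V ⊗ V ⊗ V ⊗ V`. -/
def middle {K : Type u} [Field K] {V : Type v} [AddCommGroup V] [Module K V]
    (c : V ⊗[K] V →ₗ[K] V ⊗[K] V) :
    (V ⊗[K] V) ⊗[K] (V ⊗[K] V) →ₗ[K] (V ⊗[K] V) ⊗[K] (V ⊗[K] V) :=
  (TensorProduct.assoc K V V (V ⊗[K] V)).symm.toLinearMap ∘ₗ
    ((TensorProduct.assoc K V V V).toLinearMap ∘ₗ c.rTensor V ∘ₗ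
      (TensorProduct.assoc K V V V).symm.toLinearMap).lTensor V ∘ₗ
    (TensorProduct.assoc K V V (V ⊗[K] V)).toLinearMap

/-- The braid equation: `(V, 𝔠)` is a braided vector space. -/
def IsBraiding {K : Type u} [Field K] {V : Type v} [AddCommGroup V] [Module K V]
    (c : V ⊗[K] V →ₗ[K] V ⊗[K] V) : Prop :=
  left c ∘ₗ right c ∘ₗ left c = right c ∘ₗ left c ∘ₗ right c

/-- `𝔠` is of Hecke type of mark `q`. -/
def IsHecke {K : Type u} [Field K] {V : Type v} [AddCommGroup V] [Module K V]
    (c : V ⊗[K] V →ₗ[K] V ⊗[K] V) (q : K) : Prop :=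
  (c + LinearMap.id) ∘ₗ (c - q • LinearMap.id) = 0

/-- `q ≠ 0` is regular: `(n)_q = 1 + q + ⋯ + q ^ (n - 1) ≠ 0` for every `n ≥ 1`. -/
def IsRegularMark {K : Type u} [Field K] (q : K) : Prop :=
  q ≠ 0 ∧ ∀ n : ℕ, 1 ≤ n → ∑ i ∈ Finset.range n, q ^ i ≠ 0

/-! ### Braided algebras, coalgebras and bialgebras -/

/-- The unital associative algebra `A` with `c` is a braided algebra. -/
structure IsBraidedAlgebra (K : Type u) [Field K] {A : Type v} [Ring A] [Algebra K A]
    (c : A ⊗[K] A →ₗ[K] A ⊗[K] A) : Prop where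
  braid : IsBraiding c
  mul_left : c ∘ₗ (LinearMap.mul' K A).rTensor A =
    (LinearMap.mul' K A).lTensor A ∘ₗ (TensorProduct.assoc K A A A).toLinearMap ∘ₗ
      left c ∘ₗ right c
  mul_right : c ∘ₗ (LinearMap.mul' K A).lTensor A ∘ₗ (TensorProduct.assoc K A A A).toLinearMap =
    (LinearMap.mul' K A).rTensor A ∘ₗ right c ∘ₗ left c
  one_left : ∀ a : A, c (1 ⊗ₜ[K] a) = a ⊗ₜ[K] 1
  one_right : ∀ a : A, c (a ⊗ₜ[K] 1) = 1 ⊗ₜ[K] a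

/-- The coassociative counital coalgebra `C` with `c` is a braided coalgebra. -/
structure IsBraidedCoalgebra (K : Type u) [Field K] {C : Type v} [AddCommGroup C] [Module K C]
    [Coalgebra K C] (c : C ⊗[K] C →ₗ[K] C ⊗[K] C) : Prop where
  braid : IsBraiding c
  comul_left : (TensorProduct.assoc K C C C).symm.toLinearMap ∘ₗ
      (Coalgebra.comul (R := K) (A := C)).lTensor C ∘ₗ c =
    left c ∘ₗ right c ∘ₗ (Coalgebra.comul (R := K) (A := C)).rTensor C
  comul_right : (Coalgebra.comul (R := K) (A := C)).rTensor C ∘ₗ c =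
    right c ∘ₗ left c ∘ₗ (TensorProduct.assoc K C C C).symm.toLinearMap ∘ₗ
      (Coalgebra.comul (R := K) (A := C)).lTensor C
  counit_left : ∀ x y : C, TensorProduct.lid K C
      ((Coalgebra.counit (R := K) (A := C)).rTensor C (c (x ⊗ₜ[K] y))) =
    Coalgebra.counit (R := K) y • x
  counit_right : ∀ x y : C, TensorProduct.rid K C
      ((Coalgebra.counit (R := K) (A := C)).lTensor C (c (y ⊗ₜ[K] x))) =
    Coalgebra.counit (R := K) y • x

/-- The algebra and coalgebra `A` with `c` is a braided bialgebra: `Δ` and `ε` are morphisms of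
unital algebras, where `A ⊗ A` carries the product `(∇ ⊗ ∇)(A ⊗ c ⊗ A)`. -/
structure IsBraidedBialgebra (K : Type u) [Field K] {A : Type v} [Ring A] [Algebra K A]
    [Coalgebra K A] (c : A ⊗[K] A →ₗ[K] A ⊗[K] A) : Prop where
  alg : IsBraidedAlgebra K c
  coalg : IsBraidedCoalgebra K c
  comul_mul : Coalgebra.comul (R := K) (A := A) ∘ₗ LinearMap.mul' K A =
    TensorProduct.map (LinearMap.mul' K A) (LinearMap.mul' K A) ∘ₗ middle c ∘ₗ
      TensorProduct.map Coalgebra.comul Coalgebra.comul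
  comul_one : Coalgebra.comul (R := K) (1 : A) = 1 ⊗ₜ[K] 1
  counit_mul : ∀ a b : A, Coalgebra.counit (R := K) (a * b) =
    Coalgebra.counit (R := K) a * Coalgebra.counit (R := K) b
  counit_one : Coalgebra.counit (R := K) (1 : A) = 1

/-! ### Coradical filtration and connectedness -/

/-- `D` is a subcoalgebra of `C`: `Δ(D) ⊆ D ⊗ D`. -/
def IsSubcoalgebra (K : Type u) [Field K] {C : Type v} [AddCommGroup C] [Module K C]
    [Coalgebra K C] (D : Submodule K C) : Prop :=
  D.map (Coalgebra.comul (R := K) (A := C)) ≤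
    LinearMap.range (TensorProduct.map D.subtype D.subtype)

/-- `D` is a simple subcoalgebra of `C`. -/
def IsSimpleSubcoalgebra (K : Type u) [Field K] {C : Type v} [AddCommGroup C] [Module K C]
    [Coalgebra K C] (D : Submodule K C) : Prop :=
  IsSubcoalgebra K D ∧ D ≠ ⊥ ∧ ∀ E : Submodule K C, IsSubcoalgebra K E → E ≤ D → E = ⊥ ∨ E = D

/-- The coradical: the sum of all simple subcoalgebras. -/
def coradical (K : Type u) [Field K] (C : Type v) [AddCommGroup C] [Module K C]
    [Coalgebra K C] : Submodule K C :=
  sSup {D | IsSimpleSubcoalgebra K D}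

/-- The map `C → C ⊗ C → C/X ⊗ C/Y`. -/
def comulMod (K : Type u) [Field K] {C : Type v} [AddCommGroup C] [Module K C]
    [Coalgebra K C] (X Y : Submodule K C) : C →ₗ[K] (C ⧸ X) ⊗[K] (C ⧸ Y) :=
  TensorProduct.map X.mkQ Y.mkQ ∘ₗ Coalgebra.comul

/-- The wedge `X ∧ Y = Δ⁻¹(X ⊗ C + C ⊗ Y)`, as the kernel of `C → C/X ⊗ C/Y`. -/
def wedge (K : Type u) [Field K] {C : Type v} [AddCommGroup C] [Module K C]
    [Coalgebra K C] (X Y : Submodule K C) : Submodule K C :=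
  LinearMap.ker (comulMod K X Y)

/-- The coradical filtration `C₀ ⊆ C₁ ⊆ ⋯`, with `C₍ₙ₊₁₎ = C₀ ∧ Cₙ`. -/
def corad (K : Type u) [Field K] (C : Type v) [AddCommGroup C] [Module K C]
    [Coalgebra K C] : ℕ → Submodule K C
  | 0 => coradical K C
  | n + 1 => wedge K (coradical K C) (corad K C n)

/-- `C` is connected: its coradical is one-dimensional. In a braided bialgebra the group-like
element spanning the coradical is then `1`, and the compatibility of `c` with it is part of the
axioms of a braided algebra. -/
def IsConnectedCoalgebra (K : Type u) [Field K] (C : Type v) [AddCommGroup C] [Module K C]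
    [Coalgebra K C] : Prop :=
  Module.finrank K (coradical K C) = 1

/-- The graded component `gr¹ C = C₁/C₀`. -/
abbrev GrOne (K : Type u) [Field K] (C : Type v) [AddCommGroup C] [Module K C]
    [Coalgebra K C] : Type v :=
  corad K C 1 ⧸ (corad K C 0).comap (corad K C 1).subtype

/-- The graded component `gr² C = C₂/C₁`. -/
abbrev GrTwo (K : Type u) [Field K] (C : Type v) [AddCommGroup C] [Module K C]
    [Coalgebra K C] : Type v :=
  corad K C 2 ⧸ (corad K C 1).comap (corad K C 2).subtype

/-- The inclusion `C₁/C₀ → C/C₀`. -/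
def grOneIncl (K : Type u) [Field K] (C : Type v) [AddCommGroup C] [Module K C]
    [Coalgebra K C] : GrOne K C →ₗ[K] C ⧸ corad K C 0 :=
  Submodule.mapQ _ _ (corad K C 1).subtype le_rfl


theorem grOneIncl_injective (K : Type u) [Field K] (C : Type v) [AddCommGroup C] [Module K C]
    [Coalgebra K C] : Function.Injective (grOneIncl K C) := by
  rw [← LinearMap.ker_eq_bot, grOneIncl, Submodule.ker_mapQ]
  exact Submodule.mkQ_map_self _

theorem mem_range_map_of_mem {K : Type u} [Field K] {M M' N N' : Type*}
    [AddCommGroup M] [Module K M] [AddCommGroup M'] [Module K M'] [AddCommGroup N] [Module K N]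
    [AddCommGroup N'] [Module K N'] {j : M' →ₗ[K] M} {k : N' →ₗ[K] N}
    (hj : Function.Injective j) (hk : Function.Injective k) {z : M ⊗[K] N}
    (h₁ : z ∈ LinearMap.range (j.rTensor N)) (h₂ : z ∈ LinearMap.range (k.lTensor M)) :
    z ∈ LinearMap.range (TensorProduct.map j k) := by
  obtain ⟨s, hs⟩ := j.exists_leftInverse_of_injective (LinearMap.ker_eq_bot.2 hj)
  obtain ⟨t, ht⟩ := k.exists_leftInverse_of_injective (LinearMap.ker_eq_bot.2 hk)
  obtain ⟨y, rfl⟩ := h₁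
  obtain ⟨y', hy'⟩ := h₂
  have e₁ : (j ∘ₗ s).rTensor N (j.rTensor N y) = j.rTensor N y := by
    rw [← LinearMap.rTensor_comp_apply, LinearMap.comp_assoc, hs, LinearMap.comp_id]
  have e₂ : (k ∘ₗ t).lTensor M (j.rTensor N y) = j.rTensor N y := by
    rw [← hy', ← LinearMap.lTensor_comp_apply, LinearMap.comp_assoc, ht, LinearMap.comp_id]
  refine ⟨TensorProduct.map s t (j.rTensor N y), ?_⟩
  rw [← LinearMap.comp_apply, ← TensorProduct.map_comp]
  conv_rhs => rw [← e₁]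
  conv_rhs => rw [← e₂]
  rw [← LinearMap.comp_apply ((j ∘ₗ s).rTensor N), LinearMap.rTensor_comp_lTensor]

theorem coradical_isSubcoalgebra (K : Type u) [Field K] (C : Type v) [AddCommGroup C]
    [Module K C] [Coalgebra K C] : IsSubcoalgebra K (coradical K C) := by
  rw [IsSubcoalgebra, Submodule.map_le_iff_le_comap]
  refine sSup_le fun D hD => ?_
  have hle : D ≤ coradical K C := le_sSup hD
  rw [← Submodule.map_le_iff_le_comap]
  refine hD.1.trans ?_
  rintro _ ⟨z, rfl⟩
  refine ⟨TensorProduct.map (Submodule.inclusion hle) (Submodule.inclusion hle) z, ?_⟩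
  rw [← LinearMap.comp_apply, ← TensorProduct.map_comp]
  rfl

theorem corad_zero_le_one (K : Type u) [Field K] (C : Type v) [AddCommGroup C] [Module K C]
    [Coalgebra K C] : corad K C 0 ≤ corad K C 1 := by
  intro x hx
  obtain ⟨z, hz⟩ := coradical_isSubcoalgebra K C ⟨x, hx, rfl⟩
  change TensorProduct.map _ _ (Coalgebra.comul x) = 0
  rw [← hz, ← LinearMap.comp_apply, ← TensorProduct.map_comp]
  have h : (coradical K C).mkQ ∘ₗ (coradical K C).subtype = 0 := by
    ext y; simp
  have h' : (corad K C 0).mkQ ∘ₗ (coradical K C).subtype = 0 := h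
  rw [h, h']
  simp

/-- `C/C₀ → C/C₀ ⊗ C/C₀` induced by the comultiplication. -/
def comulModDesc (K : Type u) [Field K] (C : Type v) [AddCommGroup C] [Module K C]
    [Coalgebra K C] : (C ⧸ corad K C 0) →ₗ[K] (C ⧸ corad K C 0) ⊗[K] (C ⧸ corad K C 0) :=
  (corad K C 0).liftQ (comulMod K (corad K C 0) (corad K C 0))
    (show _ ≤ LinearMap.ker _ from corad_zero_le_one K C)

theorem exact_grOneIncl_desc (K : Type u) [Field K] (C : Type v) [AddCommGroup C] [Module K C]
    [Coalgebra K C] : Function.Exact (grOneIncl K C) (comulModDesc K C) := by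
  rw [LinearMap.exact_iff, comulModDesc, Submodule.ker_liftQ, grOneIncl, Submodule.range_mapQ,
    Submodule.range_subtype]
  rfl

theorem exact_grOneIncl_factor (K : Type u) [Field K] (C : Type v) [AddCommGroup C] [Module K C]
    [Coalgebra K C] :
    Function.Exact (grOneIncl K C) (Submodule.factor (corad_zero_le_one K C)) := by
  rw [LinearMap.exact_iff, Submodule.factor, Submodule.mapQ, Submodule.ker_liftQ, grOneIncl,
    Submodule.range_mapQ, Submodule.range_subtype, LinearMap.comp_id, Submodule.ker_mkQ]

theorem comulMod_mem_range (K : Type u) [Field K] (C : Type v) [AddCommGroup C] [Module K C]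
    [Coalgebra K C] (x : corad K C 2) :
    comulMod K (corad K C 0) (corad K C 0) x ∈
      LinearMap.range (TensorProduct.map (grOneIncl K C) (grOneIncl K C)) := by
  obtain ⟨x, hx⟩ := x
  have hx' : TensorProduct.map (corad K C 0).mkQ (corad K C 1).mkQ
      (Coalgebra.comul (R := K) x) = 0 := hx
  set Q := C ⧸ corad K C 0
  have h₂ : comulMod K (corad K C 0) (corad K C 0) x ∈
      LinearMap.range ((grOneIncl K C).lTensor Q) := by
    refine (Module.Flat.lTensor_exact Q (exact_grOneIncl_factor K C) _).1 ?_
    rw [comulMod, LinearMap.comp_apply, ← LinearMap.comp_apply, LinearMap.lTensor_comp_map]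
    exact hx'
  refine mem_range_map_of_mem (grOneIncl_injective K C) (grOneIncl_injective K C) ?_ h₂
  refine (Module.Flat.rTensor_exact Q (exact_grOneIncl_desc K C) _).1 ?_
  have h₃ : (comulModDesc K C).lTensor Q (comulMod K (corad K C 0) (corad K C 0) x) = 0 :=
    (Module.Flat.lTensor_exact Q (exact_grOneIncl_desc K C) _).2 h₂
  have hd : comulModDesc K C ∘ₗ (corad K C 0).mkQ = comulMod K (corad K C 0) (corad K C 0) :=
    Submodule.liftQ_mkQ _ _ _
  rw [comulMod, LinearMap.comp_apply, ← LinearMap.comp_apply] at h₃ ⊢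
  rw [LinearMap.lTensor_comp_map, hd] at h₃
  rw [LinearMap.rTensor_comp_map, hd]
  have key : (TensorProduct.assoc K Q Q Q).toLinearMap ∘ₗ
      TensorProduct.map (comulMod K (corad K C 0) (corad K C 0)) (corad K C 0).mkQ ∘ₗ
        Coalgebra.comul =
      TensorProduct.map (corad K C 0).mkQ (comulMod K (corad K C 0) (corad K C 0)) ∘ₗ
        Coalgebra.comul := by
    have e₁ : TensorProduct.map (comulMod K (corad K C 0) (corad K C 0)) (corad K C 0).mkQ =
        TensorProduct.map (TensorProduct.map (corad K C 0).mkQ (corad K C 0).mkQ)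
          (corad K C 0).mkQ ∘ₗ (Coalgebra.comul (R := K) (A := C)).rTensor C := by
      rw [LinearMap.map_comp_rTensor]; rfl
    have e₂ : TensorProduct.map (corad K C 0).mkQ (comulMod K (corad K C 0) (corad K C 0)) =
        TensorProduct.map (corad K C 0).mkQ
          (TensorProduct.map (corad K C 0).mkQ (corad K C 0).mkQ) ∘ₗ
          (Coalgebra.comul (R := K) (A := C)).lTensor C := by
      rw [LinearMap.map_comp_lTensor]; rfl
    rw [e₁, e₂, LinearMap.comp_assoc, LinearMap.comp_assoc, ← Coalgebra.coassoc,
      ← LinearMap.comp_assoc, ← TensorProduct.map_map_comp_assoc_eq]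
    rfl
  have := LinearMap.congr_fun key x
  apply (TensorProduct.assoc K Q Q Q).injective
  rw [map_zero]
  exact this.trans h₃

/-- The infinitesimal comultiplication `C₂/C₁ → C₁/C₀ ⊗ C₁/C₀`, that is, the component of degree
`(1, 1)` of the comultiplication of the graded coalgebra associated with the coradical filtration:
the class of `x ∈ C₂` is sent to the element of `C₁/C₀ ⊗ C₁/C₀ ⊆ C/C₀ ⊗ C/C₀` represented by
`Δ(x)`. -/
def infComul (K : Type u) [Field K] (C : Type v) [AddCommGroup C] [Module K C]
    [Coalgebra K C] : GrTwo K C →ₗ[K] GrOne K C ⊗[K] GrOne K C :=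
  ((corad K C 1).comap (corad K C 2).subtype).liftQ
    ((LinearEquiv.ofInjective (TensorProduct.map (grOneIncl K C) (grOneIncl K C))
        (TensorProduct.map_injective_of_flat_flat _ _ (grOneIncl_injective K C)
          (grOneIncl_injective K C))).symm.toLinearMap ∘ₗ
      LinearMap.codRestrict _
        (comulMod K (corad K C 0) (corad K C 0) ∘ₗ (corad K C 2).subtype)
        (comulMod_mem_range K C))
    (by
      intro x hx
      have hx' : comulMod K (corad K C 0) (corad K C 0) x = 0 := hx
      rw [LinearMap.mem_ker, LinearMap.comp_apply]
      refine (LinearEquiv.map_eq_zero_iff _).2 (Subtype.ext ?_)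
      exact hx')

/-- The defining property of the infinitesimal comultiplication. -/
theorem infComul_spec (K : Type u) [Field K] (C : Type v) [AddCommGroup C] [Module K C]
    [Coalgebra K C] (x : corad K C 2) :
    TensorProduct.map (grOneIncl K C) (grOneIncl K C) (infComul K C (Submodule.Quotient.mk x)) =
      TensorProduct.map (corad K C 0).mkQ (corad K C 0).mkQ (Coalgebra.comul (R := K) (x : C)) :=
  congrArg Subtype.val (LinearEquiv.apply_symm_apply (LinearEquiv.ofInjective
    (TensorProduct.map (grOneIncl K C) (grOneIncl K C)) (TensorProduct.map_injective_of_flat_flat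
      _ _ (grOneIncl_injective K C) (grOneIncl_injective K C))) _)

/-! ### Primitive elements and the infinitesimal braiding -/

/-- `a ↦ Δ(a) - a ⊗ 1 - 1 ⊗ a`. -/
def primDefect (K : Type u) [Field K] (A : Type v) [Ring A] [Algebra K A] [Coalgebra K A] :
    A →ₗ[K] A ⊗[K] A :=
  Coalgebra.comul - (TensorProduct.mk K A A).flip 1 - TensorProduct.mk K A A 1

/-- The space `P(A)` of primitive elements, `Δ(a) = a ⊗ 1 + 1 ⊗ a`. -/
def prim (K : Type u) [Field K] (A : Type v) [Ring A] [Algebra K A] [Coalgebra K A] :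
    Submodule K A :=
  LinearMap.ker (primDefect K A)

theorem mem_prim_iff {K : Type u} [Field K] {A : Type v} [Ring A] [Algebra K A]
    [Coalgebra K A] {a : A} :
    a ∈ prim K A ↔ Coalgebra.comul (R := K) a = a ⊗ₜ[K] 1 + 1 ⊗ₜ[K] a := by
  rw [prim, LinearMap.mem_ker, primDefect, LinearMap.sub_apply, LinearMap.sub_apply, sub_sub,
    sub_eq_zero]
  rfl

theorem exact_prim (K : Type u) [Field K] (A : Type v) [Ring A] [Algebra K A]
    [Coalgebra K A] : Function.Exact (prim K A).subtype (primDefect K A) := by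
  rw [LinearMap.exact_iff, Submodule.range_subtype, prim]

/-- The inclusion `P(A) ⊗ P(A) → A ⊗ A`. -/
abbrev primIncl (K : Type u) [Field K] (A : Type v) [Ring A] [Algebra K A] [Coalgebra K A] :
    prim K A ⊗[K] prim K A →ₗ[K] A ⊗[K] A :=
  TensorProduct.map (prim K A).subtype (prim K A).subtype

theorem primIncl_injective (K : Type u) [Field K] (A : Type v) [Ring A] [Algebra K A]
    [Coalgebra K A] : Function.Injective (primIncl K A) :=
  TensorProduct.map_injective_of_flat_flat _ _ (prim K A).subtype_injective
    (prim K A).subtype_injective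

theorem braiding_primIncl_mem_range {K : Type u} [Field K] {A : Type v} [Ring A] [Algebra K A]
    [Coalgebra K A] {c : A ⊗[K] A →ₗ[K] A ⊗[K] A} (hA : IsBraidedBialgebra K c)
    (z : prim K A ⊗[K] prim K A) :
    (c ∘ₗ primIncl K A) z ∈ LinearMap.range (primIncl K A) := by
  induction z using TensorProduct.induction_on with
  | zero => rw [map_zero]; exact zero_mem _
  | add z w hz hw => rw [map_add]; exact add_mem hz hw
  | tmul x y =>
    obtain ⟨x, hx⟩ := x
    obtain ⟨y, hy⟩ := y
    rw [mem_prim_iff] at hx hy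
    change c (x ⊗ₜ[K] y) ∈ _
    refine mem_range_map_of_mem (prim K A).subtype_injective (prim K A).subtype_injective ?_ ?_
    · refine (Module.Flat.rTensor_exact A (exact_prim K A) _).1 ?_
      have h := LinearMap.congr_fun hA.coalg.comul_right (x ⊗ₜ[K] y)
      simp only [LinearMap.comp_apply, LinearMap.lTensor_tmul, hy, TensorProduct.tmul_add,
        map_add, LinearEquiv.coe_coe, TensorProduct.assoc_symm_tmul, left, right,
        LinearMap.rTensor_tmul, hA.alg.one_right, TensorProduct.assoc_tmul] at h
      rw [primDefect, LinearMap.rTensor_sub, LinearMap.rTensor_sub, LinearMap.sub_apply,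
        LinearMap.sub_apply, h, sub_sub, sub_eq_zero]
      have h₁ : ∀ w : A ⊗[K] A, (TensorProduct.assoc K A A A).symm
          (c.lTensor A (TensorProduct.assoc K A A A (w ⊗ₜ[K] 1))) =
          ((TensorProduct.mk K A A).flip 1).rTensor A w := fun w => by
        induction w using TensorProduct.induction_on with
        | zero => simp
        | add u v hu hv => simp only [TensorProduct.add_tmul, map_add, hu, hv]
        | tmul a b => simp [hA.alg.one_right]
      have h₂ : ∀ w : A ⊗[K] A, (TensorProduct.assoc K A A A).symm (1 ⊗ₜ[K] w) =
          (TensorProduct.mk K A A 1).rTensor A w := fun w => by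
        induction w using TensorProduct.induction_on with
        | zero => simp
        | add u v hu hv => simp only [TensorProduct.tmul_add, map_add, hu, hv]
        | tmul a b => simp
      rw [h₁, h₂]
    · refine (Module.Flat.lTensor_exact A (exact_prim K A) _).1 ?_
      have h := LinearMap.congr_fun hA.coalg.comul_left (x ⊗ₜ[K] y)
      simp only [LinearMap.comp_apply, LinearMap.rTensor_tmul, hx, TensorProduct.add_tmul,
        map_add, LinearEquiv.coe_coe, left, right, TensorProduct.assoc_tmul,
        LinearMap.lTensor_tmul, hA.alg.one_left, TensorProduct.assoc_symm_tmul] at h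
      rw [LinearEquiv.symm_apply_eq] at h
      rw [primDefect, LinearMap.lTensor_sub, LinearMap.lTensor_sub, LinearMap.sub_apply,
        LinearMap.sub_apply, h, sub_sub, sub_eq_zero, map_add]
      have h₁ : ∀ w : A ⊗[K] A, TensorProduct.assoc K A A A
          (c.rTensor A ((TensorProduct.assoc K A A A).symm (1 ⊗ₜ[K] w))) =
          (TensorProduct.mk K A A 1).lTensor A w := fun w => by
        induction w using TensorProduct.induction_on with
        | zero => simp
        | add u v hu hv => simp only [TensorProduct.tmul_add, map_add, hu, hv]
        | tmul a b => simp [hA.alg.one_left]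
      have h₂ : ∀ w : A ⊗[K] A, TensorProduct.assoc K A A A (w ⊗ₜ[K] 1) =
          ((TensorProduct.mk K A A).flip 1).lTensor A w := fun w => by
        induction w using TensorProduct.induction_on with
        | zero => simp
        | add u v hu hv => simp only [TensorProduct.add_tmul, map_add, hu, hv]
        | tmul a b => simp
      rw [h₁, h₂]

/-- The infinitesimal braiding `𝔠_P` of `A`: the restriction of `𝔠` to `P(A) ⊗ P(A)`. -/
def infBraiding {K : Type u} [Field K] {A : Type v} [Ring A] [Algebra K A]
    [Coalgebra K A] {c : A ⊗[K] A →ₗ[K] A ⊗[K] A} (hA : IsBraidedBialgebra K c) :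
    prim K A ⊗[K] prim K A →ₗ[K] prim K A ⊗[K] prim K A :=
  (LinearEquiv.ofInjective (primIncl K A) (primIncl_injective K A)).symm.toLinearMap ∘ₗ
    LinearMap.codRestrict _ (c ∘ₗ primIncl K A) (braiding_primIncl_mem_range hA)

/-- The defining property of the infinitesimal braiding. -/
theorem primIncl_infBraiding {K : Type u} [Field K] {A : Type v} [Ring A] [Algebra K A]
    [Coalgebra K A] {c : A ⊗[K] A →ₗ[K] A ⊗[K] A} (hA : IsBraidedBialgebra K c)
    (z : prim K A ⊗[K] prim K A) :
    primIncl K A (infBraiding hA z) = c (primIncl K A z) :=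
  congrArg Subtype.val (LinearEquiv.apply_symm_apply
    (LinearEquiv.ofInjective (primIncl K A) (primIncl_injective K A)) _)

theorem infBraiding_isBraiding {K : Type u} [Field K] {A : Type v} [Ring A] [Algebra K A]
    [Coalgebra K A] {c : A ⊗[K] A →ₗ[K] A ⊗[K] A} (hA : IsBraidedBialgebra K c) :
    IsBraiding (infBraiding hA) := by
  set J := TensorProduct.map (primIncl K A) (prim K A).subtype
  have hJ : Function.Injective J := TensorProduct.map_injective_of_flat_flat _ _
    (primIncl_injective K A) (prim K A).subtype_injective
  have hl : ∀ z, J (left (infBraiding hA) z) = left c (J z) := fun z => by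
    induction z using TensorProduct.induction_on with
    | zero => simp
    | add u v hu hv => simp only [map_add, hu, hv]
    | tmul u x =>
      simp only [J, left, LinearMap.rTensor_tmul, TensorProduct.map_tmul, primIncl_infBraiding]
  have hr : ∀ z, J (right (infBraiding hA) z) = right c (J z) := fun z => by
    induction z using TensorProduct.induction_on with
    | zero => simp
    | add u v hu hv => simp only [map_add, hu, hv]
    | tmul u z =>
      induction u using TensorProduct.induction_on with
      | zero => simp
      | add u v hu hv => simp only [TensorProduct.add_tmul, map_add, hu, hv]
      | tmul x y =>
        have e : ∀ w : prim K A ⊗[K] prim K A,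
            J ((TensorProduct.assoc K _ _ _).symm (x ⊗ₜ[K] w)) =
            (TensorProduct.assoc K A A A).symm ((x : A) ⊗ₜ[K] primIncl K A w) := fun w => by
          induction w using TensorProduct.induction_on with
          | zero => simp
          | add u v hu hv => simp only [TensorProduct.tmul_add, map_add, hu, hv]
          | tmul a b => rfl
        simp only [right, LinearMap.comp_apply, LinearEquiv.coe_coe, TensorProduct.assoc_tmul,
          LinearMap.lTensor_tmul, e, primIncl_infBraiding]
        rfl
  refine LinearMap.ext fun z => hJ ?_
  simp only [LinearMap.comp_apply, hl, hr]
  exact LinearMap.congr_fun hA.alg.braid (J z)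

/-! ### The identification `P(A) = C₁/C₀` and cocommutativity -/

theorem coradical_eq_span_one {K : Type u} [Field K] {A : Type v} [Ring A] [Algebra K A]
    [Coalgebra K A] {c : A ⊗[K] A →ₗ[K] A ⊗[K] A} (hA : IsBraidedBialgebra K c)
    (hconn : IsConnectedCoalgebra K A) : coradical K A = K ∙ (1 : A) := by
  have h1 : (1 : A) ≠ 0 := fun h => by
    have := hA.counit_one
    rw [h, map_zero] at this
    exact zero_ne_one this
  have hfd : FiniteDimensional K (coradical K A) :=
    Module.finite_of_finrank_pos (by rw [hconn]; exact one_pos)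
  have hle : K ∙ (1 : A) ≤ coradical K A := by
    refine le_sSup ⟨?_, ?_, ?_⟩
    · rw [IsSubcoalgebra, Submodule.map_span_le]
      rintro _ rfl
      rw [hA.comul_one]
      exact ⟨⟨1, Submodule.mem_span_singleton_self 1⟩ ⊗ₜ ⟨1, Submodule.mem_span_singleton_self 1⟩,
        rfl⟩
    · rwa [Ne, Submodule.span_singleton_eq_bot]
    · intro E _ hE
      exact (nonzero_span_atom (1 : A) h1).le_iff.1 hE
  refine (Submodule.eq_of_le_of_finrank_eq hle ?_).symm
  rw [finrank_span_singleton h1, hconn]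

theorem mkQ_one_eq_zero {K : Type u} [Field K] {A : Type v} [Ring A] [Algebra K A]
    [Coalgebra K A] {c : A ⊗[K] A →ₗ[K] A ⊗[K] A} (hA : IsBraidedBialgebra K c)
    (hconn : IsConnectedCoalgebra K A) : (corad K A 0).mkQ (1 : A) = 0 := by
  rw [Submodule.mkQ_apply, Submodule.Quotient.mk_eq_zero]
  change (1 : A) ∈ coradical K A
  rw [coradical_eq_span_one hA hconn]
  exact Submodule.mem_span_singleton_self 1

theorem prim_le_corad_one {K : Type u} [Field K] {A : Type v} [Ring A] [Algebra K A]
    [Coalgebra K A] {c : A ⊗[K] A →ₗ[K] A ⊗[K] A} (hA : IsBraidedBialgebra K c)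
    (hconn : IsConnectedCoalgebra K A) : prim K A ≤ corad K A 1 := by
  intro x hx
  rw [mem_prim_iff] at hx
  change TensorProduct.map (corad K A 0).mkQ (corad K A 0).mkQ (Coalgebra.comul x) = 0
  rw [hx, map_add, TensorProduct.map_tmul, TensorProduct.map_tmul, mkQ_one_eq_zero hA hconn]
  simp

/-- The canonical map `P(A) → C₁/C₀`. -/
def primToGr {K : Type u} [Field K] {A : Type v} [Ring A] [Algebra K A]
    [Coalgebra K A] {c : A ⊗[K] A →ₗ[K] A ⊗[K] A} (hA : IsBraidedBialgebra K c)
    (hconn : IsConnectedCoalgebra K A) : prim K A →ₗ[K] GrOne K A :=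
  Submodule.mkQ _ ∘ₗ Submodule.inclusion (prim_le_corad_one hA hconn)

theorem counit_eq_zero_of_mem_prim {K : Type u} [Field K] {A : Type v} [Ring A] [Algebra K A]
    [Coalgebra K A] {c : A ⊗[K] A →ₗ[K] A ⊗[K] A} (hA : IsBraidedBialgebra K c) {x : A}
    (hx : x ∈ prim K A) : Coalgebra.counit (R := K) x = 0 := by
  have h := Coalgebra.rTensor_counit_comul (R := K) x
  rw [mem_prim_iff.1 hx, map_add, LinearMap.rTensor_tmul, LinearMap.rTensor_tmul,
    hA.counit_one, add_eq_right] at h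
  have h' := congrArg (fun z => Coalgebra.counit (R := K) (TensorProduct.lid K A z)) h
  simpa [hA.counit_one] using h'

theorem primToGr_bijective {K : Type u} [Field K] {A : Type v} [Ring A] [Algebra K A]
    [Coalgebra K A] {c : A ⊗[K] A →ₗ[K] A ⊗[K] A} (hA : IsBraidedBialgebra K c)
    (hconn : IsConnectedCoalgebra K A) : Function.Bijective (primToGr hA hconn) := by
  constructor
  · rw [injective_iff_map_eq_zero]
    rintro ⟨x, hx⟩ h
    have h0 : x ∈ coradical K A :=
      (Submodule.Quotient.mk_eq_zero ((corad K A 0).comap (corad K A 1).subtype)).1 h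
    rw [coradical_eq_span_one hA hconn, Submodule.mem_span_singleton] at h0
    obtain ⟨a, rfl⟩ := h0
    have := counit_eq_zero_of_mem_prim hA hx
    rw [map_smul, hA.counit_one, smul_eq_mul, mul_one] at this
    ext
    simp [this]
  · intro y
    obtain ⟨⟨x, hx⟩, rfl⟩ := Submodule.Quotient.mk_surjective _ y
    -- the projection onto the kernel of the counit along `1`
    let q : A →ₗ[K] A := LinearMap.id - (Coalgebra.counit (R := K) (A := A)).smulRight (1 : A)
    have hq : ∀ a, q a = a - Coalgebra.counit (R := K) a • (1 : A) := fun a => rfl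
    have hq0 : corad K A 0 ≤ LinearMap.ker q := by
      change coradical K A ≤ _
      rw [coradical_eq_span_one hA hconn, Submodule.span_singleton_le_iff_mem, LinearMap.mem_ker,
        hq, hA.counit_one, one_smul, sub_self]
    have hxx : TensorProduct.map q q (Coalgebra.comul (R := K) x) = 0 := by
      have hx' : TensorProduct.map (corad K A 0).mkQ (corad K A 0).mkQ
        (Coalgebra.comul (R := K) x) = 0 := hx
      have e : q = (corad K A 0).liftQ q hq0 ∘ₗ (corad K A 0).mkQ :=
        (Submodule.liftQ_mkQ _ _ _).symm
      rw [e, TensorProduct.map_comp, LinearMap.comp_apply, hx', map_zero]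
    have hexp : ∀ z : A ⊗[K] A, TensorProduct.map q q z = z -
        TensorProduct.mk K A A 1 (TensorProduct.lid K A
          ((Coalgebra.counit (R := K) (A := A)).rTensor A z)) -
        (TensorProduct.mk K A A).flip 1 (TensorProduct.rid K A
          ((Coalgebra.counit (R := K) (A := A)).lTensor A z)) +
        TensorProduct.lid K K (TensorProduct.map (Coalgebra.counit (R := K) (A := A))
          (Coalgebra.counit (R := K) (A := A)) z) • ((1 : A) ⊗ₜ[K] (1 : A)) := fun z => by
      induction z using TensorProduct.induction_on with
      | zero => simp
      | add u v hu hv => rw [map_add, hu, hv]; simp only [map_add, add_smul]; abel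
      | tmul a b =>
        simp only [TensorProduct.map_tmul, hq, TensorProduct.sub_tmul, TensorProduct.tmul_sub,
          LinearMap.rTensor_tmul, LinearMap.lTensor_tmul, TensorProduct.lid_tmul,
          TensorProduct.rid_tmul, TensorProduct.mk_apply, LinearMap.flip_apply,
          TensorProduct.smul_tmul, TensorProduct.tmul_smul, smul_sub, smul_smul, smul_eq_mul]
        rw [mul_comm]
        abel
    have hεε : TensorProduct.map (Coalgebra.counit (R := K) (A := A))
        (Coalgebra.counit (R := K) (A := A)) (Coalgebra.comul x) =
        1 ⊗ₜ[K] Coalgebra.counit (R := K) x := by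
      have := congrArg ((Coalgebra.counit (R := K) (A := A)).lTensor K)
        (Coalgebra.rTensor_counit_comul (R := K) x)
      rw [← LinearMap.comp_apply, LinearMap.lTensor_comp_rTensor, LinearMap.lTensor_tmul] at this
      exact this
    rw [hexp, Coalgebra.rTensor_counit_comul, Coalgebra.lTensor_counit_comul, hεε] at hxx
    have hp : q x ∈ prim K A := by
      rw [mem_prim_iff, hq, map_sub, map_smul, hA.comul_one, TensorProduct.sub_tmul,
        TensorProduct.tmul_sub, TensorProduct.smul_tmul, TensorProduct.tmul_smul]
      simp only [TensorProduct.lid_tmul, TensorProduct.rid_tmul, one_smul,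
        TensorProduct.mk_apply, LinearMap.flip_apply, smul_eq_mul, one_mul] at hxx
      rw [← sub_eq_zero, ← hxx]
      abel
    refine ⟨⟨q x, hp⟩, ?_⟩
    refine (Submodule.Quotient.eq _).2 ?_
    change q x - x ∈ coradical K A
    rw [coradical_eq_span_one hA hconn, hq, sub_sub_cancel_left]
    exact neg_mem (Submodule.smul_mem _ _ (Submodule.mem_span_singleton_self 1))

/-- The canonical identification `P(A) = C₁/C₀` in a connected braided bialgebra. -/
def primEquivGr {K : Type u} [Field K] {A : Type v} [Ring A] [Algebra K A]
    [Coalgebra K A] {c : A ⊗[K] A →ₗ[K] A ⊗[K] A} (hA : IsBraidedBialgebra K c)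
    (hconn : IsConnectedCoalgebra K A) : prim K A ≃ₗ[K] GrOne K A :=
  LinearEquiv.ofBijective (primToGr hA hconn) (primToGr_bijective hA hconn)

/-- The infinitesimal comultiplication as a map `C₂/C₁ → C₁/C₀ ⊗ C₁/C₀ = P(A) ⊗ P(A)`. -/
def infComulPrim {K : Type u} [Field K] {A : Type v} [Ring A] [Algebra K A]
    [Coalgebra K A] {c : A ⊗[K] A →ₗ[K] A ⊗[K] A} (hA : IsBraidedBialgebra K c)
    (hconn : IsConnectedCoalgebra K A) : GrTwo K A →ₗ[K] prim K A ⊗[K] prim K A :=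
  TensorProduct.map (primEquivGr hA hconn).symm.toLinearMap
    (primEquivGr hA hconn).symm.toLinearMap ∘ₗ infComul K A

/-- The infinitesimal comultiplication of `A` is `q`-cocommutative. -/
def IsInfCocommutative {K : Type u} [Field K] {A : Type v} [Ring A] [Algebra K A]
    [Coalgebra K A] {c : A ⊗[K] A →ₗ[K] A ⊗[K] A} (hA : IsBraidedBialgebra K c)
    (hconn : IsConnectedCoalgebra K A) (q : K) : Prop :=
  infBraiding hA ∘ₗ infComulPrim hA hconn = q • infComulPrim hA hconn

/-! ### The braided tensor algebra `T(V, 𝔠)` -/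

/-- The product `V ⊗ V → T(V)`, i.e. the inclusion of `T²(V)`. -/
def tensorSq (K : Type u) [Field K] (V : Type v) [AddCommGroup V] [Module K V] :
    V ⊗[K] V →ₗ[K] TensorAlgebra K V :=
  LinearMap.mul' K (TensorAlgebra K V) ∘ₗ
    TensorProduct.map (TensorAlgebra.ι K) (TensorAlgebra.ι K)

/-- The left action `w ⊗ (t ⊗ m) ↦ w t ⊗ m` of `V` on `T(V) ⊗ M`. -/
def genMul (K : Type u) [Field K] (V : Type v) [AddCommGroup V] [Module K V]
    (M : Type w) [AddCommGroup M] [Module K M] :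
    V →ₗ[K] Module.End K (TensorAlgebra K V ⊗[K] M) :=
  LinearMap.rTensorHom M ∘ₗ LinearMap.mul K (TensorAlgebra K V) ∘ₗ TensorAlgebra.ι K

/-- For `w ∈ V`, the operator on maps `f : V → T(V) ⊗ V` given by
`(w f)(v) = ∑ wᵢ f(vᵢ)`, where `𝔠(v ⊗ w) = ∑ wᵢ ⊗ vᵢ`. -/
def slideAct {K : Type u} [Field K] {V : Type v} [AddCommGroup V] [Module K V]
    (c : V ⊗[K] V →ₗ[K] V ⊗[K] V) :
    V →ₗ[K] Module.End K (V →ₗ[K] TensorAlgebra K V ⊗[K] V) :=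
  LinearMap.mk₂ K
    (fun w f => TensorProduct.lift (genMul K V V) ∘ₗ f.lTensor V ∘ₗ c ∘ₗ
      (TensorProduct.mk K V V).flip w)
    (fun w w' f => by ext v; simp)
    (fun a w f => by ext v; simp)
    (fun w f f' => by ext v; simp [LinearMap.lTensor_add])
    (fun a w f => by ext v; simp [LinearMap.lTensor_smul])

/-- The braiding `V ⊗ T(V) → T(V) ⊗ V` (written as `t ↦ v ↦ 𝔠_T(v ⊗ t)`): `v` crosses the factors
of `t` one after the other, i.e. `𝔠_T(v ⊗ 1) = 1 ⊗ v` and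
`𝔠_T(v ⊗ w t) = ∑ wᵢ 𝔠_T(vᵢ ⊗ t)` for `w ∈ V` and `𝔠(v ⊗ w) = ∑ wᵢ ⊗ vᵢ`. -/
def slide {K : Type u} [Field K] {V : Type v} [AddCommGroup V] [Module K V]
    (c : V ⊗[K] V →ₗ[K] V ⊗[K] V) :
    TensorAlgebra K V →ₗ[K] V →ₗ[K] TensorAlgebra K V ⊗[K] V :=
  LinearMap.applyₗ (TensorProduct.mk K (TensorAlgebra K V) V 1) ∘ₗ
    (TensorAlgebra.lift K (slideAct c)).toLinearMap

/-- `(t ⊗ v) ⊗ b ↦ t ⊗ v b`. -/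
def absorb (K : Type u) [Field K] (V : Type v) [AddCommGroup V] [Module K V] :
    (TensorAlgebra K V ⊗[K] V) ⊗[K] TensorAlgebra K V →ₗ[K]
      TensorAlgebra K V ⊗[K] TensorAlgebra K V :=
  (LinearMap.mul' K (TensorAlgebra K V) ∘ₗ
      (TensorAlgebra.ι K).rTensor (TensorAlgebra K V)).lTensor (TensorAlgebra K V) ∘ₗ
    (TensorProduct.assoc K (TensorAlgebra K V) V (TensorAlgebra K V)).toLinearMap

/-- For `v ∈ V`, the operator `a ⊗ b ↦ 𝔠_T(v ⊗ a) b` on `T(V) ⊗ T(V)`. -/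
def crossAct {K : Type u} [Field K] {V : Type v} [AddCommGroup V] [Module K V]
    (c : V ⊗[K] V →ₗ[K] V ⊗[K] V) :
    V →ₗ[K] Module.End K (TensorAlgebra K V ⊗[K] TensorAlgebra K V) :=
  LinearMap.llcomp K _ _ _ (absorb K V) ∘ₗ LinearMap.rTensorHom (TensorAlgebra K V) ∘ₗ
    (slide c).flip

/-- The braiding `𝔠_T` of `T(V, 𝔠)`, built from `𝔠` by crossing the factors of the first argument,
the last one first, with the second argument: `𝔠_T(1 ⊗ a) = a ⊗ 1` and
`𝔠_T(v x ⊗ a) = (T ⊗ ∇)(𝔠_T ⊗ T)(v ⊗ 𝔠_T(x ⊗ a))` for `v ∈ V`. -/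
def tensorBraiding {K : Type u} [Field K] {V : Type v} [AddCommGroup V] [Module K V]
    (c : V ⊗[K] V →ₗ[K] V ⊗[K] V) :
    TensorAlgebra K V ⊗[K] TensorAlgebra K V →ₗ[K] TensorAlgebra K V ⊗[K] TensorAlgebra K V :=
  TensorProduct.lift
    (LinearMap.lcomp K _ ((TensorProduct.mk K (TensorAlgebra K V) (TensorAlgebra K V)).flip 1) ∘ₗ
      (TensorAlgebra.lift K (crossAct c)).toLinearMap)

/-- For `v ∈ V`, left multiplication by `v ⊗ 1 + 1 ⊗ v` in the algebra `T ⊗_𝔠 T`: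
`(v ⊗ 1)(a ⊗ b) = v a ⊗ b` and `(1 ⊗ v)(a ⊗ b) = 𝔠_T(v ⊗ a) b`. -/
def comulAct {K : Type u} [Field K] {V : Type v} [AddCommGroup V] [Module K V]
    (c : V ⊗[K] V →ₗ[K] V ⊗[K] V) :
    V →ₗ[K] Module.End K (TensorAlgebra K V ⊗[K] TensorAlgebra K V) :=
  genMul K V (TensorAlgebra K V) + crossAct c

/-- The comultiplication `Δ_T` of `T(V, 𝔠)`, the algebra map `T → T ⊗_𝔠 T` with
`Δ_T(v) = v ⊗ 1 + 1 ⊗ v` for `v ∈ V`: thus `Δ_T(1) = 1 ⊗ 1` and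
`Δ_T(v x) = (v ⊗ 1 + 1 ⊗ v) Δ_T(x)`. -/
def tensorComul {K : Type u} [Field K] {V : Type v} [AddCommGroup V] [Module K V]
    (c : V ⊗[K] V →ₗ[K] V ⊗[K] V) :
    TensorAlgebra K V →ₗ[K] TensorAlgebra K V ⊗[K] TensorAlgebra K V :=
  LinearMap.applyₗ ((1 : TensorAlgebra K V) ⊗ₜ[K] (1 : TensorAlgebra K V)) ∘ₗ
    (TensorAlgebra.lift K (comulAct c)).toLinearMap

/-- The counit `ε_T` of `T(V, 𝔠)`, the algebra map that vanishes on `V`. -/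
def tensorCounit (K : Type u) [Field K] (V : Type v) [AddCommGroup V] [Module K V] :
    TensorAlgebra K V →ₐ[K] K :=
  TensorAlgebra.lift K 0

/-! ### The braided symmetric algebra `S(V, 𝔠)` -/

/-- The two-sided ideal of `T(V)` generated by the elements `𝔠(z) - q z` with `z ∈ V ⊗ V`. -/
def symIdeal {K : Type u} [Field K] {V : Type v} [AddCommGroup V] [Module K V]
    (c : V ⊗[K] V →ₗ[K] V ⊗[K] V) (q : K) : Ideal (TensorAlgebra K V) :=
  (TwoSidedIdeal.span
    (Set.range fun z : V ⊗[K] V => tensorSq K V (c z) - q • tensorSq K V z)).asIdeal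

instance symIdeal_isTwoSided {K : Type u} [Field K] {V : Type v} [AddCommGroup V] [Module K V]
    (c : V ⊗[K] V →ₗ[K] V ⊗[K] V) (q : K) : (symIdeal c q).IsTwoSided :=
  inferInstanceAs (TwoSidedIdeal.asIdeal _).IsTwoSided

/-- The braided symmetric algebra of a braided vector space of Hecke type of mark `q`. -/
abbrev SymAlg {K : Type u} [Field K] {V : Type v} [AddCommGroup V] [Module K V]
    (c : V ⊗[K] V →ₗ[K] V ⊗[K] V) (q : K) : Type (max u v) :=
  TensorAlgebra K V ⧸ symIdeal c q

/-- The projection `T(V) → S(V, 𝔠)`. -/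
def symProj {K : Type u} [Field K] {V : Type v} [AddCommGroup V] [Module K V]
    (c : V ⊗[K] V →ₗ[K] V ⊗[K] V) (q : K) : TensorAlgebra K V →ₐ[K] SymAlg c q :=
  Ideal.Quotient.mkₐ K (symIdeal c q)

/-- The projection `T(V) ⊗ T(V) → S(V, 𝔠) ⊗ S(V, 𝔠)`. -/
abbrev symProj₂ {K : Type u} [Field K] {V : Type v} [AddCommGroup V] [Module K V]
    (c : V ⊗[K] V →ₗ[K] V ⊗[K] V) (q : K) :
    TensorAlgebra K V ⊗[K] TensorAlgebra K V →ₗ[K] SymAlg c q ⊗[K] SymAlg c q :=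
  TensorProduct.map (symProj c q).toLinearMap (symProj c q).toLinearMap

section Descent

variable {K : Type u} [Field K] {V : Type v} [AddCommGroup V] [Module K V]
  (c : V ⊗[K] V →ₗ[K] V ⊗[K] V) (q : K)

theorem symProj_surjective : Function.Surjective (symProj c q) :=
  Ideal.Quotient.mkₐ_surjective K _

theorem symProj₂_surjective : Function.Surjective (symProj₂ c q) :=
  TensorProduct.map_surjective (symProj_surjective c q) (symProj_surjective c q)

theorem symProj_eq_zero_iff (x : TensorAlgebra K V) :
    symProj c q x = 0 ↔ x ∈ symIdeal c q :=
  Ideal.Quotient.eq_zero_iff_mem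

theorem symProj_rel (z : V ⊗[K] V) :
    symProj c q (tensorSq K V (c z) - q • tensorSq K V z) = 0 :=
  (symProj_eq_zero_iff c q _).2 (TwoSidedIdeal.subset_span ⟨z, rfl⟩)

theorem symIdeal_induction {p : TensorAlgebra K V → Prop}
    (mem : ∀ z : V ⊗[K] V, p (tensorSq K V (c z) - q • tensorSq K V z))
    (zero : p 0) (add : ∀ x y, p x → p y → p (x + y))
    (left_absorb : ∀ a x, p x → p (a * x)) (right_absorb : ∀ b x, p x → p (x * b))
    {x : TensorAlgebra K V} (hx : x ∈ symIdeal c q) : p x :=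
  TwoSidedIdeal.span_induction (p := fun x _ => p x)
    (fun _ h => by obtain ⟨z, rfl⟩ := h; exact mem z) zero (fun x y _ _ => add x y)
    (fun x _ h => by rw [← neg_one_mul]; exact left_absorb _ _ h) (fun a x _ => left_absorb a x) (fun b x _ => right_absorb b x) hx

/-- `𝔠(v ⊗ w) = ∑ wᵢ ⊗ vᵢ ↦ ∑ wᵢ f(vᵢ)`. -/
theorem slideAct_apply (w : V) (f : V →ₗ[K] TensorAlgebra K V ⊗[K] V) (v : V) :
    slideAct c w f v = TensorProduct.lift (genMul K V V) (f.lTensor V (c (v ⊗ₜ[K] w))) := rfl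

theorem slide_ι_mul (w : V) (t : TensorAlgebra K V) :
    slide c (TensorAlgebra.ι K w * t) = slideAct c w (slide c t) := by
  simp [slide]

theorem slide_one (v : V) : slide c 1 v = 1 ⊗ₜ[K] v := by
  simp [slide]

theorem genMul_tmul (M : Type w) [AddCommGroup M] [Module K M] (v : V) (t : TensorAlgebra K V)
    (m : M) : genMul K V M v (t ⊗ₜ[K] m) = (TensorAlgebra.ι K v * t) ⊗ₜ[K] m := rfl

theorem map_genMul (M N : Type*) [AddCommGroup M] [Module K M] [AddCommGroup N] [Module K N]
    (g : M →ₗ[K] N) (v : V) (y : TensorAlgebra K V ⊗[K] M) :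
    TensorProduct.map (symProj c q).toLinearMap g (genMul K V M v y) =
      (LinearMap.mulLeft K (symProj c q (TensorAlgebra.ι K v))).rTensor N
        (TensorProduct.map (symProj c q).toLinearMap g y) := by
  induction y using TensorProduct.induction_on with
  | zero => simp
  | add a b ha hb => simp only [map_add, ha, hb]
  | tmul t m => simp [genMul_tmul]

/-- The maps `V → T ⊗ V` that vanish in `S ⊗ V`. -/
def slideKer : Submodule K (V →ₗ[K] TensorAlgebra K V ⊗[K] V) :=
  LinearMap.ker (LinearMap.llcomp K V _ _ ((symProj c q).toLinearMap.rTensor V))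

theorem mem_slideKer {f : V →ₗ[K] TensorAlgebra K V ⊗[K] V} :
    f ∈ slideKer c q ↔ ∀ v, (symProj c q).toLinearMap.rTensor V (f v) = 0 := by
  rw [slideKer, LinearMap.mem_ker, LinearMap.ext_iff]
  rfl

theorem lift_genMul_mem {f : V →ₗ[K] TensorAlgebra K V ⊗[K] V} (hf : f ∈ slideKer c q)
    (y : V ⊗[K] V) :
    (symProj c q).toLinearMap.rTensor V
      (TensorProduct.lift (genMul K V V) (f.lTensor V y)) = 0 := by
  rw [mem_slideKer] at hf
  induction y using TensorProduct.induction_on with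
  | zero => simp
  | add a b ha hb => simp only [map_add, ha, hb, add_zero]
  | tmul a b =>
    rw [LinearMap.lTensor_tmul, TensorProduct.lift.tmul]
    exact (map_genMul c q V V LinearMap.id a (f b)).trans
      ((congrArg _ (hf b)).trans (map_zero _))

theorem lift_slideAct_mem (x : TensorAlgebra K V) :
    ∀ f ∈ slideKer c q, TensorAlgebra.lift K (slideAct c) x f ∈ slideKer c q := by
  induction x using TensorAlgebra.induction with
  | algebraMap r =>
    intro f hf
    rw [AlgHom.commutes, Module.algebraMap_end_apply]
    exact Submodule.smul_mem _ _ hf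
  | ι w =>
    intro f hf
    rw [TensorAlgebra.lift_ι_apply, mem_slideKer]
    exact fun v => lift_genMul_mem c q hf _
  | mul a b ha hb =>
    intro f hf
    rw [map_mul]
    exact ha _ (hb _ hf)
  | add a b ha hb =>
    intro f hf
    rw [map_add]
    exact add_mem (ha _ hf) (hb _ hf)

/-- `(a ⊗ b) ⊗ v ↦ a b f(v)`. -/
def sqAct (f : V →ₗ[K] TensorAlgebra K V ⊗[K] V) :
    (V ⊗[K] V) ⊗[K] V →ₗ[K] TensorAlgebra K V ⊗[K] V :=
  TensorProduct.lift (LinearMap.rTensorHom V ∘ₗ LinearMap.mul K (TensorAlgebra K V) ∘ₗ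
    tensorSq K V) ∘ₗ f.lTensor (V ⊗[K] V)

theorem lift_slideAct_sq (f : V →ₗ[K] TensorAlgebra K V ⊗[K] V) (v : V) (z : V ⊗[K] V) :
    TensorAlgebra.lift K (slideAct c) (tensorSq K V z) f v =
      sqAct f (right c (left c ((TensorProduct.assoc K V V V).symm (v ⊗ₜ[K] z)))) := by
  induction z using TensorProduct.induction_on with
  | zero => simp
  | add a b ha hb => simp only [map_add, LinearMap.add_apply, TensorProduct.tmul_add, ha, hb]
  | tmul w w' =>
    have e : tensorSq K V (w ⊗ₜ[K] w') = TensorAlgebra.ι K w * TensorAlgebra.ι K w' := rfl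
    rw [e, map_mul, TensorAlgebra.lift_ι_apply, TensorAlgebra.lift_ι_apply, Module.End.mul_apply,
      slideAct_apply, TensorProduct.assoc_symm_tmul, left, LinearMap.rTensor_tmul]
    generalize c (v ⊗ₜ[K] w) = y
    induction y using TensorProduct.induction_on with
    | zero => simp
    | add a b ha hb => simp only [map_add, TensorProduct.add_tmul, ha, hb]
    | tmul a b =>
      rw [LinearMap.lTensor_tmul, TensorProduct.lift.tmul, slideAct_apply, right,
        LinearMap.comp_apply, LinearMap.comp_apply, LinearEquiv.coe_coe, LinearEquiv.coe_coe,
        TensorProduct.assoc_tmul, LinearMap.lTensor_tmul]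
      generalize c (b ⊗ₜ[K] w') = y
      induction y using TensorProduct.induction_on with
      | zero => simp
      | add a b ha hb => simp only [map_add, TensorProduct.tmul_add, ha, hb]
      | tmul a' b' =>
        rw [LinearMap.lTensor_tmul, TensorProduct.lift.tmul, TensorProduct.assoc_symm_tmul,
          sqAct, LinearMap.comp_apply, LinearMap.lTensor_tmul, TensorProduct.lift.tmul]
        generalize f b' = y
        induction y using TensorProduct.induction_on with
        | zero => simp
        | add a b ha hb => simp only [map_add, ha, hb]
        | tmul t m => simp [genMul_tmul, tensorSq, mul_assoc]

theorem lift_slideAct_rel (hc : IsBraiding c) (f : V →ₗ[K] TensorAlgebra K V ⊗[K] V)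
    (z : V ⊗[K] V) :
    TensorAlgebra.lift K (slideAct c) (tensorSq K V (c z) - q • tensorSq K V z) f ∈
      slideKer c q := by
  rw [mem_slideKer]
  intro v
  have e : (TensorProduct.assoc K V V V).symm (v ⊗ₜ[K] c z) =
      right c ((TensorProduct.assoc K V V V).symm (v ⊗ₜ[K] z)) := by
    simp [right]
  rw [← map_smul, ← map_sub, lift_slideAct_sq, TensorProduct.tmul_sub, TensorProduct.tmul_smul,
    map_sub, map_smul, e]
  simp only [map_sub (left c), map_smul (left c), map_sub (right c), map_smul (right c),
    map_sub (sqAct f), map_smul (sqAct f)]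
  generalize (TensorProduct.assoc K V V V).symm (v ⊗ₜ[K] z) = y
  have hb : right c (left c (right c y)) = left c (right c (left c y)) :=
    (LinearMap.congr_fun hc y).symm
  rw [hb]
  generalize right c (left c y) = y
  induction y using TensorProduct.induction_on with
  | zero => simp
  | add a b ha hb =>
    simp only [map_add, smul_add, map_sub] at ha hb ⊢
    rw [add_sub_add_comm, ha, hb, add_zero]
  | tmul z w =>
    simp only [left, LinearMap.rTensor_tmul, sqAct, LinearMap.comp_apply, LinearMap.lTensor_tmul,
      TensorProduct.lift.tmul]
    generalize f w = y
    induction y using TensorProduct.induction_on with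
    | zero => simp
    | add a b ha hb =>
      simp only [map_add, smul_add, map_sub] at ha hb ⊢
      rw [add_sub_add_comm, ha, hb, add_zero]
    | tmul t m =>
      have h := symProj_rel c q z
      rw [map_sub, map_smul] at h
      simp only [LinearMap.coe_rTensorHom, LinearMap.rTensor_tmul, LinearMap.mul_apply', map_sub,
        map_smul, AlgHom.toLinearMap_apply, map_mul]
      rw [TensorProduct.smul_tmul', ← TensorProduct.sub_tmul, ← smul_mul_assoc, ← sub_mul, h,
        zero_mul, TensorProduct.zero_tmul]

theorem slide_mem_of_mem (hc : IsBraiding c) {x : TensorAlgebra K V} (hx : x ∈ symIdeal c q) :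
    slide c x ∈ slideKer c q := by
  suffices h : ∀ f, TensorAlgebra.lift K (slideAct c) x f ∈ slideKer c q from h _
  refine symIdeal_induction c q
    (p := fun x => ∀ f, TensorAlgebra.lift K (slideAct c) x f ∈ slideKer c q)
    (fun z f => lift_slideAct_rel c q hc f z) ?_ ?_ ?_ ?_ hx
  · intro f; rw [map_zero]; exact zero_mem _
  · intro x y hx hy f; rw [map_add]; exact add_mem (hx f) (hy f)
  · intro a x hx f; rw [map_mul]; exact lift_slideAct_mem c q a _ (hx f)
  · intro b x hx f; rw [map_mul]; exact hx _

theorem crossAct_tmul (v : V) (a b : TensorAlgebra K V) :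
    crossAct c v (a ⊗ₜ[K] b) = absorb K V (slide c a v ⊗ₜ[K] b) := rfl

theorem absorb_tmul (t : TensorAlgebra K V) (v : V) (b : TensorAlgebra K V) :
    absorb K V ((t ⊗ₜ[K] v) ⊗ₜ[K] b) = t ⊗ₜ[K] (TensorAlgebra.ι K v * b) := rfl

theorem ker_symProj₂_le {N : Type*} [AddCommGroup N] [Module K N]
    (F : TensorAlgebra K V ⊗[K] TensorAlgebra K V →ₗ[K] N)
    (h₁ : ∀ a ∈ symIdeal c q, ∀ b, F (a ⊗ₜ[K] b) = 0)
    (h₂ : ∀ a, ∀ b ∈ symIdeal c q, F (a ⊗ₜ[K] b) = 0) :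
    LinearMap.ker (symProj₂ c q) ≤ LinearMap.ker F := by
  have hex : Function.Exact (LinearMap.ker (symProj c q).toLinearMap).subtype
      (symProj c q).toLinearMap := LinearMap.exact_subtype_ker_map _
  rw [symProj₂, TensorProduct.map_ker hex (symProj_surjective c q) hex (symProj_surjective c q)]
  refine sup_le ?_ ?_
  · rintro _ ⟨z, rfl⟩
    induction z using TensorProduct.induction_on with
    | zero => rw [map_zero]; exact zero_mem _
    | add a b ha hb => rw [map_add]; exact add_mem ha hb
    | tmul a b => exact h₂ a b ((symProj_eq_zero_iff c q _).1 b.2)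
  · rintro _ ⟨z, rfl⟩
    induction z using TensorProduct.induction_on with
    | zero => rw [map_zero]; exact zero_mem _
    | add a b ha hb => rw [map_add]; exact add_mem ha hb
    | tmul a b => exact h₁ a ((symProj_eq_zero_iff c q _).1 a.2) b

theorem crossAct_mem (hc : IsBraiding c) (v : V) :
    LinearMap.ker (symProj₂ c q) ≤ LinearMap.ker (symProj₂ c q ∘ₗ crossAct c v) := by
  refine ker_symProj₂_le c q _ (fun a ha b => ?_) (fun a b hb => ?_)
  · rw [LinearMap.comp_apply, crossAct_tmul]
    have h := (mem_slideKer c q).1 (slide_mem_of_mem c q hc ha) v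
    have e : ∀ y : TensorAlgebra K V ⊗[K] V, symProj₂ c q (absorb K V (y ⊗ₜ[K] b)) =
        ((LinearMap.mulRight K (symProj c q b)) ∘ₗ (symProj c q).toLinearMap ∘ₗ
          TensorAlgebra.ι K).lTensor (SymAlg c q)
            ((symProj c q).toLinearMap.rTensor V y) := fun y => by
      induction y using TensorProduct.induction_on with
      | zero => simp
      | add a b ha hb => simp only [map_add, TensorProduct.add_tmul, ha, hb]
      | tmul t w => simp [absorb_tmul]
    rw [e, h, map_zero]
  · rw [LinearMap.comp_apply, crossAct_tmul]
    generalize slide c a v = y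
    induction y using TensorProduct.induction_on with
    | zero => simp
    | add a b ha hb => simp only [map_add, TensorProduct.add_tmul, ha, hb, add_zero]
    | tmul t w =>
      simp [absorb_tmul, (symProj_eq_zero_iff c q b).2 hb]

theorem genMul_mem (v : V) :
    LinearMap.ker (symProj₂ c q) ≤
      LinearMap.ker (symProj₂ c q ∘ₗ genMul K V (TensorAlgebra K V) v) := by
  intro y hy
  rw [LinearMap.mem_ker] at hy
  rw [LinearMap.mem_ker, LinearMap.comp_apply, map_genMul, hy, map_zero]

theorem lift_act_mem
    {Φ : V →ₗ[K] Module.End K (TensorAlgebra K V ⊗[K] TensorAlgebra K V)}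
    (hΦ : ∀ v, LinearMap.ker (symProj₂ c q) ≤ LinearMap.ker (symProj₂ c q ∘ₗ Φ v))
    (x : TensorAlgebra K V) :
    ∀ u ∈ LinearMap.ker (symProj₂ c q),
      TensorAlgebra.lift K Φ x u ∈ LinearMap.ker (symProj₂ c q) := by
  induction x using TensorAlgebra.induction with
  | algebraMap r =>
    intro f hf
    rw [AlgHom.commutes, Module.algebraMap_end_apply]
    exact Submodule.smul_mem _ _ hf
  | ι w =>
    intro f hf
    rw [TensorAlgebra.lift_ι_apply]
    exact hΦ w hf
  | mul a b ha hb =>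
    intro f hf
    rw [map_mul]
    exact ha _ (hb _ hf)
  | add a b ha hb =>
    intro f hf
    rw [map_add]
    exact add_mem (ha _ hf) (hb _ hf)

theorem lift_act_mem_of_mem
    {Φ : V →ₗ[K] Module.End K (TensorAlgebra K V ⊗[K] TensorAlgebra K V)}
    (hΦ : ∀ v, LinearMap.ker (symProj₂ c q) ≤ LinearMap.ker (symProj₂ c q ∘ₗ Φ v))
    (hΦ' : ∀ (z : V ⊗[K] V) (a b : TensorAlgebra K V), symProj₂ c q
      (TensorAlgebra.lift K Φ (tensorSq K V (c z) - q • tensorSq K V z) (a ⊗ₜ[K] b)) = 0)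
    {x : TensorAlgebra K V} (hx : x ∈ symIdeal c q) :
    ∀ u, TensorAlgebra.lift K Φ x u ∈ LinearMap.ker (symProj₂ c q) := by
  refine symIdeal_induction c q
    (p := fun x => ∀ u, TensorAlgebra.lift K Φ x u ∈ LinearMap.ker (symProj₂ c q))
    ?_ ?_ ?_ ?_ ?_ hx
  · intro z u
    induction u using TensorProduct.induction_on with
    | zero => rw [map_zero]; exact zero_mem _
    | add a b ha hb => rw [map_add]; exact add_mem ha hb
    | tmul a b => exact hΦ' z a b
  · intro f; rw [map_zero]; exact zero_mem _
  · intro x y hx hy f; rw [map_add]; exact add_mem (hx f) (hy f)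
  · intro a x hx f; rw [map_mul]; exact lift_act_mem c q hΦ a _ (hx f)
  · intro b x hx f; rw [map_mul]; exact hx _

/-- `V ⊗ V ⊗ T → T ⊗ V ⊗ V`. -/
def slide₂ : TensorAlgebra K V →ₗ[K] V ⊗[K] V →ₗ[K] TensorAlgebra K V ⊗[K] (V ⊗[K] V) :=
  LinearMap.mk₂ K
    (fun a z => TensorProduct.assoc K (TensorAlgebra K V) V V
      (TensorProduct.lift (LinearMap.rTensorHom V ∘ₗ (slide c).flip)
        ((slide c a).lTensor V z)))
    (fun a a' z => by simp [LinearMap.lTensor_add])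
    (fun r a z => by simp [LinearMap.lTensor_smul])
    (fun a z z' => by simp)
    (fun r a z => by simp)

theorem slide₂_tmul (a : TensorAlgebra K V) (v w : V) :
    slide₂ c a (v ⊗ₜ[K] w) = TensorProduct.assoc K (TensorAlgebra K V) V V
      (((slide c).flip v).rTensor V (slide c a w)) := rfl

/-- `(w ⊗ v) ⊗ v' ↦ w 𝔠_T(v ⊗ v' ⊗ a)`. -/
def slideMul₂ (a : TensorAlgebra K V) :
    (V ⊗[K] V) ⊗[K] V →ₗ[K] TensorAlgebra K V ⊗[K] (V ⊗[K] V) :=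
  TensorProduct.lift (genMul K V (V ⊗[K] V)) ∘ₗ (slide₂ c a).lTensor V ∘ₗ
    (TensorProduct.assoc K V V V).toLinearMap

theorem slide₂_ι_mul (w : V) (a : TensorAlgebra K V) (z : V ⊗[K] V) :
    slide₂ c (TensorAlgebra.ι K w * a) z =
      slideMul₂ c a (left c (right c (z ⊗ₜ[K] w))) := by
  induction z using TensorProduct.induction_on with
  | zero => simp
  | add x y hx hy => simp only [map_add, TensorProduct.add_tmul, hx, hy]
  | tmul v v' =>
    rw [slide₂_tmul, slide_ι_mul, slideAct_apply, right, LinearMap.comp_apply,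
      LinearMap.comp_apply, LinearEquiv.coe_coe, LinearEquiv.coe_coe, TensorProduct.assoc_tmul,
      LinearMap.lTensor_tmul]
    generalize c (v' ⊗ₜ[K] w) = y
    induction y using TensorProduct.induction_on with
    | zero => simp
    | add x y hx hy => simp only [map_add, TensorProduct.tmul_add, hx, hy]
    | tmul w₁ v₁ =>
      rw [LinearMap.lTensor_tmul, TensorProduct.lift.tmul, TensorProduct.assoc_symm_tmul, left,
        LinearMap.rTensor_tmul, slideMul₂]
      have e₁ : ∀ x : V ⊗[K] V, (TensorProduct.lift (genMul K V (V ⊗[K] V)) ∘ₗ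
            (slide₂ c a).lTensor V ∘ₗ (TensorProduct.assoc K V V V).toLinearMap)
              (x ⊗ₜ[K] v₁) =
          TensorProduct.assoc K (TensorAlgebra K V) V V
            (TensorProduct.lift (LinearMap.rTensorHom V ∘ₗ (TensorProduct.lift
              (LinearMap.llcomp K _ _ _ ∘ₗ genMul K V V) ∘ₗ
              (slide c).flip.lTensor V) ) (x ⊗ₜ[K] slide c a v₁)) := fun x => by
        induction x using TensorProduct.induction_on with
        | zero => simp
        | add x y hx hy => simp only [map_add, TensorProduct.add_tmul, hx, hy]
        | tmul w₂ v₂ =>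
          simp only [LinearMap.comp_apply, LinearEquiv.coe_coe, TensorProduct.assoc_tmul,
            LinearMap.lTensor_tmul, TensorProduct.lift.tmul, slide₂_tmul]
          generalize slide c a v₁ = y
          induction y using TensorProduct.induction_on with
          | zero => simp
          | add x y hx hy => simp only [map_add, hx, hy]
          | tmul t m =>
            simp only [LinearMap.rTensor_tmul, LinearMap.flip_apply, LinearMap.coe_rTensorHom,
              LinearMap.llcomp_apply]
            generalize slide c t v₂ = y
            induction y using TensorProduct.induction_on with
            | zero => simp
            | add x y hx hy => simp only [map_add, TensorProduct.add_tmul, hx, hy]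
            | tmul t' m' => rfl
      rw [e₁]
      congr 1
      generalize slide c a v₁ = y
      induction y using TensorProduct.induction_on with
      | zero => simp
      | add x y hx hy => simp only [map_add, TensorProduct.tmul_add, hx, hy]
      | tmul t m =>
        rw [genMul_tmul, LinearMap.rTensor_tmul, LinearMap.flip_apply, slide_ι_mul,
          slideAct_apply, TensorProduct.lift.tmul]
        simp only [LinearMap.comp_apply, LinearMap.coe_rTensorHom, LinearMap.rTensor_tmul]
        congr 1
        generalize c (v ⊗ₜ[K] w₁) = y
        induction y using TensorProduct.induction_on with
        | zero => simp
        | add x y hx hy => simp only [map_add, LinearMap.add_apply, hx, hy]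
        | tmul a' b' => simp

theorem slide₂_natural (hc : IsBraiding c) (a : TensorAlgebra K V) (z : V ⊗[K] V) :
    slide₂ c a (c z) = c.lTensor (TensorAlgebra K V) (slide₂ c a z) := by
  suffices h : ∀ x a : TensorAlgebra K V,
      (∀ z, slide₂ c a (c z) = c.lTensor (TensorAlgebra K V) (slide₂ c a z)) →
      ∀ z, slide₂ c (x * a) (c z) = c.lTensor (TensorAlgebra K V) (slide₂ c (x * a) z) by
    have h1 : ∀ z, slide₂ c 1 z = 1 ⊗ₜ[K] z := fun z => by
      induction z using TensorProduct.induction_on with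
      | zero => simp
      | add x y hx hy => simp only [map_add, TensorProduct.tmul_add, hx, hy]
      | tmul v v' => simp [slide₂_tmul, slide_one]
    have := h a 1 (fun z => by rw [h1, h1, LinearMap.lTensor_tmul]) z
    rwa [mul_one] at this
  intro x
  induction x using TensorAlgebra.induction with
  | algebraMap r =>
    intro a ha z
    rw [← Algebra.smul_def, map_smul, LinearMap.smul_apply, LinearMap.smul_apply, map_smul, ha]
  | ι w =>
    intro a ha z
    rw [slide₂_ι_mul, slide₂_ι_mul]
    have e : c z ⊗ₜ[K] w = left c (z ⊗ₜ[K] w) := rfl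
    have hb := LinearMap.congr_fun hc (z ⊗ₜ[K] w)
    simp only [LinearMap.comp_apply] at hb
    rw [e, hb]
    generalize left c (right c (z ⊗ₜ[K] w)) = y
    induction y using TensorProduct.induction_on with
    | zero => simp
    | add x y hx hy => simp only [map_add, hx, hy]
    | tmul y v =>
      induction y using TensorProduct.induction_on with
      | zero => simp
      | add x y hx hy => simp only [map_add, TensorProduct.add_tmul, hx, hy]
      | tmul w₁ v₁ =>
        simp only [right, slideMul₂, LinearMap.comp_apply, LinearEquiv.coe_coe,
          TensorProduct.assoc_tmul, LinearMap.lTensor_tmul, LinearEquiv.apply_symm_apply,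
          TensorProduct.lift.tmul, ha]
        generalize slide₂ c a (v₁ ⊗ₜ[K] v) = y
        induction y using TensorProduct.induction_on with
        | zero => simp
        | add x y hx hy => simp only [map_add, hx, hy]
        | tmul t m => simp [genMul_tmul]
  | mul x y hx hy =>
    intro a ha z
    rw [mul_assoc]
    exact hx _ (hy _ ha) z
  | add x y hx hy =>
    intro a ha z
    simp only [add_mul, map_add, LinearMap.add_apply, hx a ha, hy a ha]

theorem lift_crossAct_sq (z : V ⊗[K] V) (a b : TensorAlgebra K V) :
    TensorAlgebra.lift K (crossAct c) (tensorSq K V z) (a ⊗ₜ[K] b) =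
      (LinearMap.mulRight K b ∘ₗ tensorSq K V).lTensor (TensorAlgebra K V) (slide₂ c a z) := by
  induction z using TensorProduct.induction_on with
  | zero => simp
  | add x y hx hy => simp only [map_add, LinearMap.add_apply, hx, hy]
  | tmul v w =>
    have e : tensorSq K V (v ⊗ₜ[K] w) = TensorAlgebra.ι K v * TensorAlgebra.ι K w := rfl
    rw [e, map_mul, TensorAlgebra.lift_ι_apply, TensorAlgebra.lift_ι_apply, Module.End.mul_apply,
      crossAct_tmul, slide₂_tmul]
    generalize slide c a w = y
    induction y using TensorProduct.induction_on with
    | zero => simp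
    | add x y hx hy => simp only [map_add, TensorProduct.add_tmul, hx, hy]
    | tmul t w' =>
      rw [absorb_tmul, crossAct_tmul, LinearMap.rTensor_tmul, LinearMap.flip_apply]
      generalize slide c t v = y
      induction y using TensorProduct.induction_on with
      | zero => simp
      | add x y hx hy => simp only [map_add, TensorProduct.add_tmul, hx, hy]
      | tmul t' v' => simp [absorb_tmul, tensorSq, mul_assoc]

theorem lift_crossAct_rel (hc : IsBraiding c) (z : V ⊗[K] V) (a b : TensorAlgebra K V) :
    symProj₂ c q (TensorAlgebra.lift K (crossAct c)
      (tensorSq K V (c z) - q • tensorSq K V z) (a ⊗ₜ[K] b)) = 0 := by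
  rw [map_sub, map_smul, LinearMap.sub_apply, LinearMap.smul_apply, lift_crossAct_sq,
    lift_crossAct_sq, slide₂_natural c hc]
  generalize slide₂ c a z = y
  induction y using TensorProduct.induction_on with
  | zero => simp
  | add x y hx hy =>
    simp only [map_add, smul_add, map_sub] at hx hy ⊢
    rw [add_sub_add_comm, hx, hy, add_zero]
  | tmul t z =>
    have h := symProj_rel c q z
    rw [map_sub, map_smul] at h
    simp only [LinearMap.lTensor_tmul, LinearMap.comp_apply, LinearMap.mulRight_apply, map_sub,
      map_smul, TensorProduct.map_tmul, AlgHom.toLinearMap_apply, map_mul]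
    rw [← TensorProduct.tmul_smul, ← TensorProduct.tmul_sub, ← smul_mul_assoc, ← sub_mul, h,
      zero_mul, TensorProduct.tmul_zero]

theorem tensorBraiding_tmul (x a : TensorAlgebra K V) :
    tensorBraiding c (x ⊗ₜ[K] a) = TensorAlgebra.lift K (crossAct c) x (a ⊗ₜ[K] 1) := rfl

/-- `𝔠_T` passes to the quotient `S(V, 𝔠)`. -/
theorem tensorBraiding_ker_le (hc : IsBraiding c) :
    LinearMap.ker (symProj₂ c q) ≤ LinearMap.ker (symProj₂ c q ∘ₗ tensorBraiding c) := by
  refine ker_symProj₂_le c q _ (fun a ha b => ?_) (fun a b hb => ?_)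
  · exact lift_act_mem_of_mem c q (crossAct_mem c q hc) (lift_crossAct_rel c q hc) ha _
  · refine lift_act_mem c q (crossAct_mem c q hc) a _ ?_
    simp [(symProj_eq_zero_iff c q b).2 hb]

theorem comulAct_mem (hc : IsBraiding c) (v : V) :
    LinearMap.ker (symProj₂ c q) ≤ LinearMap.ker (symProj₂ c q ∘ₗ comulAct c v) := by
  intro y hy
  have h₁ := genMul_mem c q v hy
  have h₂ := crossAct_mem c q hc v hy
  rw [LinearMap.mem_ker, LinearMap.comp_apply] at *
  rw [comulAct, LinearMap.add_apply, LinearMap.add_apply, map_add, h₁, h₂, add_zero]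

/-- `v ⊗ w ↦ v 𝔠_T(w ⊗ a) b`. -/
def crossMul (u : TensorAlgebra K V ⊗[K] TensorAlgebra K V) :
    V ⊗[K] V →ₗ[K] TensorAlgebra K V ⊗[K] TensorAlgebra K V :=
  TensorProduct.lift (genMul K V (TensorAlgebra K V)) ∘ₗ ((crossAct c).flip u).lTensor V

theorem lift_comulAct_sq (z : V ⊗[K] V) (a b : TensorAlgebra K V) :
    TensorAlgebra.lift K (comulAct c) (tensorSq K V z) (a ⊗ₜ[K] b) =
      (tensorSq K V z * a) ⊗ₜ[K] b + crossMul c (a ⊗ₜ[K] b) (z + c z) +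
      TensorAlgebra.lift K (crossAct c) (tensorSq K V z) (a ⊗ₜ[K] b) := by
  induction z using TensorProduct.induction_on with
  | zero => simp
  | add x y hx hy =>
    simp only [map_add, LinearMap.add_apply, add_mul, TensorProduct.add_tmul] at hx hy ⊢
    rw [hx, hy]
    abel
  | tmul v w =>
    have e : tensorSq K V (v ⊗ₜ[K] w) = TensorAlgebra.ι K v * TensorAlgebra.ι K w := rfl
    have h₁ : crossMul c (a ⊗ₜ[K] b) (v ⊗ₜ[K] w) =
        genMul K V _ v (crossAct c w (a ⊗ₜ[K] b)) := rfl
    have h₂ : crossMul c (a ⊗ₜ[K] b) (c (v ⊗ₜ[K] w)) =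
        crossAct c v ((TensorAlgebra.ι K w * a) ⊗ₜ[K] b) := by
      rw [crossAct_tmul, slide_ι_mul, slideAct_apply]
      generalize c (v ⊗ₜ[K] w) = y
      induction y using TensorProduct.induction_on with
      | zero => simp
      | add x y hx hy => simp only [map_add, TensorProduct.add_tmul, hx, hy]
      | tmul x y =>
        rw [LinearMap.lTensor_tmul, TensorProduct.lift.tmul, crossMul, LinearMap.comp_apply,
          LinearMap.lTensor_tmul, TensorProduct.lift.tmul, LinearMap.flip_apply, crossAct_tmul]
        generalize slide c a y = y
        induction y using TensorProduct.induction_on with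
        | zero => simp
        | add x y hx hy => simp only [map_add, TensorProduct.add_tmul, hx, hy]
        | tmul t v' => rfl
    rw [e, map_mul, map_mul, TensorAlgebra.lift_ι_apply, TensorAlgebra.lift_ι_apply,
      TensorAlgebra.lift_ι_apply, TensorAlgebra.lift_ι_apply, Module.End.mul_apply,
      Module.End.mul_apply, map_add, h₁, h₂, comulAct]
    simp only [LinearMap.add_apply, map_add, genMul_tmul, mul_assoc]
    abel

theorem lift_comulAct_rel (hc : IsBraiding c) (hq : IsHecke c q) (z : V ⊗[K] V)
    (a b : TensorAlgebra K V) :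
    symProj₂ c q (TensorAlgebra.lift K (comulAct c)
      (tensorSq K V (c z) - q • tensorSq K V z) (a ⊗ₜ[K] b)) = 0 := by
  have e : tensorSq K V (c z) - q • tensorSq K V z = tensorSq K V (c z - q • z) := by
    rw [map_sub, map_smul]
  have h₁ : (c z - q • z) + c (c z - q • z) = 0 := by
    have := LinearMap.congr_fun hq z
    rw [add_comm]
    exact this
  have h₂ := symProj_rel c q z
  have h₃ := lift_crossAct_rel c q hc z a b
  rw [e] at h₂ h₃ ⊢
  rw [lift_comulAct_sq, h₁, map_zero, add_zero, map_add, h₃, add_zero,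
    TensorProduct.map_tmul, AlgHom.toLinearMap_apply, map_mul, h₂, zero_mul,
    TensorProduct.zero_tmul]

/-- `Δ_T` passes to the quotient `S(V, 𝔠)` when `𝔠` is of Hecke type of mark `q`. -/
theorem tensorComul_ker_le (hc : IsBraiding c) (hq : IsHecke c q) :
    LinearMap.ker (symProj c q).toLinearMap ≤ LinearMap.ker (symProj₂ c q ∘ₗ tensorComul c) :=
  fun _ hx => lift_act_mem_of_mem c q (comulAct_mem c q hc) (lift_comulAct_rel c q hc hq)
    ((symProj_eq_zero_iff c q _).1 hx) _

theorem tensorCounit_eq_zero {x : TensorAlgebra K V} (hx : x ∈ symIdeal c q) :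
    tensorCounit K V x = 0 := by
  refine symIdeal_induction c q (p := fun x => tensorCounit K V x = 0) ?_ ?_ ?_ ?_ ?_ hx
  · intro z
    have h : ∀ z, tensorCounit K V (tensorSq K V z) = 0 := fun z => by
      induction z using TensorProduct.induction_on with
      | zero => simp
      | add x y hx hy => simp only [map_add, hx, hy, add_zero]
      | tmul v w => simp [tensorSq, tensorCounit]
    rw [map_sub, map_smul, h, h, smul_zero, sub_zero]
  · exact map_zero _
  · intro x y hx hy; rw [map_add, hx, hy, add_zero]
  · intro a x hx; rw [map_mul, hx, mul_zero]
  · intro b x hx; rw [map_mul, hx, zero_mul]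

end Descent

/-- The factorization of `f` through the surjective map `g`. -/
def descend {K : Type u} [Field K] {M N P : Type*} [AddCommGroup M] [Module K M]
    [AddCommGroup N] [Module K N] [AddCommGroup P] [Module K P] (g : M →ₗ[K] N)
    (hg : Function.Surjective g) (f : M →ₗ[K] P) (h : LinearMap.ker g ≤ LinearMap.ker f) :
    N →ₗ[K] P :=
  (LinearMap.ker g).liftQ f h ∘ₗ (g.quotKerEquivOfSurjective hg).symm.toLinearMap

theorem descend_apply {K : Type u} [Field K] {M N P : Type*} [AddCommGroup M] [Module K M]
    [AddCommGroup N] [Module K N] [AddCommGroup P] [Module K P] (g : M →ₗ[K] N)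
    (hg : Function.Surjective g) (f : M →ₗ[K] P) (h : LinearMap.ker g ≤ LinearMap.ker f) (x : M) :
    descend g hg f h (g x) = f x := by
  have e : (g.quotKerEquivOfSurjective hg).symm (g x) = (LinearMap.ker g).mkQ x := by
    rw [LinearEquiv.symm_apply_eq]; rfl
  rw [descend, LinearMap.comp_apply, LinearEquiv.coe_coe, e]
  rfl

/-- The braiding `𝔠_S` of `S(V, 𝔠)`: `𝔠_S (π ⊗ π) = (π ⊗ π) 𝔠_T`. -/
def symBraiding {K : Type u} [Field K] {V : Type v} [AddCommGroup V] [Module K V]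
    (c : V ⊗[K] V →ₗ[K] V ⊗[K] V) (q : K) (hc : IsBraiding c) :
    SymAlg c q ⊗[K] SymAlg c q →ₗ[K] SymAlg c q ⊗[K] SymAlg c q :=
  descend (symProj₂ c q) (symProj₂_surjective c q) (symProj₂ c q ∘ₗ tensorBraiding c)
    (tensorBraiding_ker_le c q hc)

/-- The comultiplication `Δ_S` of `S(V, 𝔠)`: `Δ_S π = (π ⊗ π) Δ_T`. -/
def symComul {K : Type u} [Field K] {V : Type v} [AddCommGroup V] [Module K V]
    (c : V ⊗[K] V →ₗ[K] V ⊗[K] V) (q : K) (hc : IsBraiding c) (hq : IsHecke c q) :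
    SymAlg c q →ₗ[K] SymAlg c q ⊗[K] SymAlg c q :=
  descend (symProj c q).toLinearMap (symProj_surjective c q) (symProj₂ c q ∘ₗ tensorComul c)
    (tensorComul_ker_le c q hc hq)

/-- The counit `ε_S` of `S(V, 𝔠)`: `ε_S π = ε_T`. -/
def symCounit {K : Type u} [Field K] {V : Type v} [AddCommGroup V] [Module K V]
    (c : V ⊗[K] V →ₗ[K] V ⊗[K] V) (q : K) : SymAlg c q →ₗ[K] K :=
  descend (symProj c q).toLinearMap (symProj_surjective c q) (tensorCounit K V).toLinearMap
    (fun _ hx => tensorCounit_eq_zero c q ((symProj_eq_zero_iff c q _).1 hx))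

/-- `A` is isomorphic, as a braided bialgebra, to the braided symmetric algebra `S(V, 𝔠)` of a
braided vector space of Hecke type of mark `q`: there is an isomorphism of unital algebras that is
compatible with the comultiplications, the counits and the braidings. -/
def IsoSymAlg {K : Type u} [Field K] {A : Type w} [Ring A] [Algebra K A] [Coalgebra K A]
    (cA : A ⊗[K] A →ₗ[K] A ⊗[K] A) {V : Type v} [AddCommGroup V] [Module K V]
    (c : V ⊗[K] V →ₗ[K] V ⊗[K] V) (q : K) (hc : IsBraiding c) (hq : IsHecke c q) : Prop :=
  ∃ f : A ≃ₐ[K] SymAlg c q,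
    symComul c q hc hq ∘ₗ f.toLinearMap =
      TensorProduct.map f.toLinearMap f.toLinearMap ∘ₗ Coalgebra.comul ∧
    symCounit c q ∘ₗ f.toLinearMap = Coalgebra.counit ∧
    symBraiding c q hc ∘ₗ TensorProduct.map f.toLinearMap f.toLinearMap =
      TensorProduct.map f.toLinearMap f.toLinearMap ∘ₗ cA

end

end Braided

/-!
Let `P` be the space of primitive elements of `A`. The inclusion of `P` extends to a morphism
`φ : T(P, 𝔠_P) → A` (`primLift`) that respects the braidings, the comultiplications and the counits
(`primLift₂_tensorBraiding`, `primLift₂_tensorComul`, `counit_primLift`). It is surjective and its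
kernel is the ideal of relations of `S(P, 𝔠_P)`.

*Hecke type.* For primitive `u` and `w` the component of `Δ(uw)` in `P ⊗ P` is
`(1 + 𝔠)(u ⊗ w)` (`comul_mul_primIncl`). Cocommutativity turns this into
`𝔠(1 + 𝔠) = q (1 + 𝔠)` on `P ⊗ P`, which is the Hecke relation (`isHecke_of_isInfCocommutative`).

*Relations.* By the Hecke relation `(1 + 𝔠)(𝔠 - q) = 0`, so that `b = ∇(𝔠 - q)` sends `P ⊗ P` to
`P`. It is a bracket: `b𝔠 = -b`, and `b` is compatible with `𝔠` since `∇` is. For `q ≠ 1` and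
`1 + q + q² ≠ 0`, expanding `𝔠²` by the Hecke relation on the images of `b ⊗ P` and `P ⊗ b` gives
`b ⊗ P = -(P ⊗ b)` (`rTensor_add_rightBracket`). Slicing this identity with a functional shows
that `b(y ⊗ y)` would be a nonzero multiple of `y` if `b(x ⊗ y) ≠ 0`, and then the identity on
`y ⊗ y ⊗ y` contradicts `2 ≠ 0` (`bracket_eq_zero`). Hence `φ` kills the relations
(`mulDefect_primIncl_eq_zero`), without any recourse to a Jacobi identity.

*Surjectivity.* On the component of degree `n` of the graded coalgebra associated with the
coradical filtration, `∇Δ^{1,n-1}` is multiplication by `1 + q + ⋯ + q ^ (n - 1)`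
(`primMul_primComul_sub_mem`). This is proved by induction, from
`Δ^{1,n}(uy) = u ⊗ y + (P ⊗ ∇)(𝔠_P ⊗ A)(u ⊗ Δ^{1,n-1}(y))` (`map_comul_prim_mul`) and
cocommutativity. By regularity, the elements of degree `n` are products of primitive elements
modulo smaller degree. The coradical filtration is exhaustive (`exists_mem_corad`):
otherwise `A / ⋃ Aₙ` would contain a simple comodule; the coalgebra of its coefficients contains
`1`, so the operators `x ↦ ∑ f(x₁) x₂` with `f(1) = 0` kill it (`smul_eq_zero_of_character`), which means
that its elements come from `⋃ Aₙ`.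

*Injectivity.* The same recursion on tensors computes `∇Δ^{1,n-1}` as multiplication by
`1 + q + ⋯ + q ^ (n - 1)` in `S(P, 𝔠_P)` (`exists_tensor_comul`), now with the relations of
`S(P, 𝔠_P)` in place of cocommutativity. If `t` of degree `n` has image of smaller degree, then
`Δ^{1,n-1}(φ(t)) = 0`, by induction the corresponding tensor is a relation, and by
regularity so is `t` (`symProj_eq_zero_of_mem_filt`). Applied to the component of highest degree of
an element of the kernel, this shows that the kernel consists of relations
(`symProj_eq_zero_of_primLift`).
-/

namespace Braided

noncomputable section

universe u v w

set_option linter.unusedSectionVars false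

/-! ### Linear algebra over a field -/

section LinearAlgebra

variable {K : Type*} [Field K] {M N P : Type*} [AddCommGroup M] [Module K M]
  [AddCommGroup N] [Module K N] [AddCommGroup P] [Module K P]

theorem exists_eq_comp_of_ker_le (g : M →ₗ[K] N) (h : M →ₗ[K] P)
    (hk : LinearMap.ker g ≤ LinearMap.ker h) : ∃ h' : N →ₗ[K] P, h = h' ∘ₗ g := by
  obtain ⟨h', hh'⟩ := LinearMap.exists_extend
    ((LinearMap.ker g).liftQ h hk ∘ₗ g.quotKerEquivRange.symm.toLinearMap)
  refine ⟨h', LinearMap.ext fun x => ?_⟩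
  have := LinearMap.congr_fun hh' (g.quotKerEquivRange ((LinearMap.ker g).mkQ x))
  simp only [LinearMap.comp_apply, LinearEquiv.coe_coe, LinearEquiv.symm_apply_apply,
    Submodule.mkQ_apply, Submodule.liftQ_apply] at this
  rw [← this]
  rfl

/-- Over a field the vanishing of `(g ⊗ g') z` depends only on the kernels of `g` and `g'`, and
grows with them. All comparisons of filtered pieces below reduce to this. -/
theorem map_eq_zero_of_ker_le {M' N' P' : Type*} [AddCommGroup M'] [Module K M']
    [AddCommGroup N'] [Module K N'] [AddCommGroup P'] [Module K P']
    {g : M →ₗ[K] N} {h : M →ₗ[K] P} {g' : M' →ₗ[K] N'} {h' : M' →ₗ[K] P'}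
    (hk : LinearMap.ker g ≤ LinearMap.ker h) (hk' : LinearMap.ker g' ≤ LinearMap.ker h')
    {z : M ⊗[K] M'} (hz : TensorProduct.map g g' z = 0) : TensorProduct.map h h' z = 0 := by
  obtain ⟨f, rfl⟩ := exists_eq_comp_of_ker_le g h hk
  obtain ⟨f', rfl⟩ := exists_eq_comp_of_ker_le g' h' hk'
  rw [TensorProduct.map_comp, LinearMap.comp_apply, hz, map_zero]

theorem range_lTensor_subtype (F : Submodule K N) :
    LinearMap.range (F.subtype.lTensor M) = LinearMap.ker (F.mkQ.lTensor M) :=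
  ((LinearMap.exact_iff).1 (Module.Flat.lTensor_exact M
    (LinearMap.exact_subtype_mkQ F))).symm

theorem apply_eq_zero_of_mem_range_lTensor {F : Submodule K N} {L : M ⊗[K] N →ₗ[K] P}
    (hL : ∀ a, ∀ f ∈ F, L (a ⊗ₜ[K] f) = 0) {z : M ⊗[K] N}
    (hz : z ∈ LinearMap.range (F.subtype.lTensor M)) : L z = 0 := by
  obtain ⟨w, rfl⟩ := hz
  induction w using TensorProduct.induction_on with
  | zero => simp
  | add x y hx hy => simp only [map_add, hx, hy, add_zero]
  | tmul a f => exact hL a f f.2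

/-- A tensor all of whose slices along functionals on the right factor lie in `E` lies in
`E ⊗ N`. -/
theorem mem_range_rTensor_of_slices (E : Submodule K M) (z : M ⊗[K] N)
    (h : ∀ g : N →ₗ[K] K, TensorProduct.rid K M (g.lTensor M z) ∈ E) :
    z ∈ LinearMap.range (E.subtype.rTensor N) := by
  refine (Module.Flat.rTensor_exact N (LinearMap.exact_subtype_mkQ E) z).1 ?_
  classical
  let b := Module.Basis.ofVectorSpace K N
  apply (TensorProduct.equivFinsuppOfBasisRight (M := M ⧸ E) b).injective
  rw [map_zero]
  ext i
  have key : ∀ w : M ⊗[K] N, TensorProduct.equivFinsuppOfBasisRight b (E.mkQ.rTensor N w) i =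
      E.mkQ (TensorProduct.rid K M ((b.coord i).lTensor M w)) := fun w => by
    induction w using TensorProduct.induction_on with
    | zero => simp
    | add x y hx hy => simp only [map_add, Finsupp.add_apply, hx, hy]
    | tmul a f => simp
  rw [key, Finsupp.zero_apply, Submodule.mkQ_apply, Submodule.Quotient.mk_eq_zero]
  exact h _

theorem mem_range_lTensor_of_slices (E : Submodule K N) (z : M ⊗[K] N)
    (h : ∀ g : M →ₗ[K] K, TensorProduct.lid K N (g.rTensor N z) ∈ E) :
    z ∈ LinearMap.range (E.subtype.lTensor M) := by
  have key : ∀ (g : M →ₗ[K] K) (w : M ⊗[K] N), TensorProduct.rid K N (g.lTensor N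
      (TensorProduct.comm K M N w)) = TensorProduct.lid K N (g.rTensor N w) := fun g w => by
    induction w using TensorProduct.induction_on with
    | zero => simp
    | add x y hx hy => simp only [map_add, hx, hy]
    | tmul a f => simp
  obtain ⟨w, hw⟩ := mem_range_rTensor_of_slices E (TensorProduct.comm K M N z)
    (fun g => by rw [key]; exact h g)
  refine ⟨TensorProduct.comm K E M w, (TensorProduct.comm K M N).injective ?_⟩
  rw [← hw]
  clear hw
  induction w using TensorProduct.induction_on with
  | zero => simp
  | add x y hx hy => simp only [map_add, hx, hy]
  | tmul a f => simp

end LinearAlgebra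

/-! ### Brackets on braided vector spaces of Hecke type -/

theorem IsHecke.apply_apply {K : Type u} [Field K] {V : Type v} [AddCommGroup V] [Module K V]
    {c : V ⊗[K] V →ₗ[K] V ⊗[K] V} {q : K} (hH : IsHecke c q) (z : V ⊗[K] V) :
    c (c z) = (q - 1) • c z + q • z := by
  have h := LinearMap.congr_fun hH z
  simp only [LinearMap.comp_apply, LinearMap.add_apply, LinearMap.sub_apply, LinearMap.id_apply,
    LinearMap.smul_apply, map_sub, map_smul, LinearMap.zero_apply] at h
  linear_combination (norm := module) h

/-- The map `V ⊗ b` on `(V ⊗ V) ⊗ V`. -/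
def rightBracket {K : Type u} [Field K] {V : Type v} [AddCommGroup V] [Module K V]
    (b : V ⊗[K] V →ₗ[K] V) : (V ⊗[K] V) ⊗[K] V →ₗ[K] V ⊗[K] V :=
  b.lTensor V ∘ₗ (TensorProduct.assoc K V V V).toLinearMap

section Bracket

variable {K : Type u} [Field K] {V : Type v} [AddCommGroup V] [Module K V]
  {c : V ⊗[K] V →ₗ[K] V ⊗[K] V} {q : K} {b : V ⊗[K] V →ₗ[K] V}

theorem IsHecke.left_left (hH : IsHecke c q) (z : (V ⊗[K] V) ⊗[K] V) :
    left c (left c z) = (q - 1) • left c z + q • z := by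
  induction z using TensorProduct.induction_on with
  | zero => simp
  | add x y hx hy => simp only [map_add, hx, hy]; module
  | tmul x y =>
    simp only [left, LinearMap.rTensor_tmul, hH.apply_apply, TensorProduct.add_tmul,
      TensorProduct.smul_tmul']

theorem IsHecke.right_right (hH : IsHecke c q) (z : (V ⊗[K] V) ⊗[K] V) :
    right c (right c z) = (q - 1) • right c z + q • z := by
  obtain ⟨z, rfl⟩ := (TensorProduct.assoc K V V V).symm.surjective z
  simp only [right, LinearMap.comp_apply, LinearEquiv.coe_coe, LinearEquiv.apply_symm_apply]
  induction z using TensorProduct.induction_on with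
  | zero => simp
  | add x y hx hy => simp only [map_add, hx, hy]; module
  | tmul x y =>
    simp only [LinearMap.lTensor_tmul, hH.apply_apply, TensorProduct.tmul_add,
      TensorProduct.tmul_smul, map_add, map_smul]

theorem rTensor_left (hb : b ∘ₗ c = -b) (z : (V ⊗[K] V) ⊗[K] V) :
    b.rTensor V (left c z) = -b.rTensor V z := by
  rw [left, ← LinearMap.rTensor_comp_apply, hb, LinearMap.rTensor_neg, LinearMap.neg_apply]

theorem rightBracket_right (hb : b ∘ₗ c = -b) (z : (V ⊗[K] V) ⊗[K] V) :
    rightBracket b (right c z) = -rightBracket b z := by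
  simp only [rightBracket, right, LinearMap.comp_apply, LinearEquiv.coe_coe,
    LinearEquiv.apply_symm_apply]
  rw [← LinearMap.lTensor_comp_apply, hb, LinearMap.lTensor_neg, LinearMap.neg_apply]

/-- The skew-symmetry, the compatibility with the braiding and the Hecke relation force
`b ⊗ V = -(V ⊗ b)` when `q ≠ 1` and `1 + q + q² ≠ 0`. -/
theorem rTensor_add_rightBracket (hc : IsBraiding c) (hH : IsHecke c q) (hq0 : q ≠ 0)
    (hq1 : q ≠ 1) (hq3 : 1 + q + q ^ 2 ≠ 0) (hb : b ∘ₗ c = -b)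
    (hl : ∀ z, c (b.rTensor V z) = rightBracket b (left c (right c z)))
    (hr : ∀ z, c (rightBracket b z) = b.rTensor V (right c (left c z)))
    (z : (V ⊗[K] V) ⊗[K] V) : b.rTensor V z + rightBracket b z = 0 := by
  have hbr : ∀ z, left c (right c (left c z)) = right c (left c (right c z)) :=
    LinearMap.congr_fun hc
  have hL := rTensor_left hb
  have hR := rightBracket_right hb
  have hll := hH.left_left
  have hrr := hH.right_right
  generalize b.rTensor V = L at *
  generalize rightBracket b = R at *
  have hq1' : q - 1 ≠ 0 := sub_ne_zero.2 hq1
  -- both identities come from expanding `c²` on the images of `L` and `R`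
  have s₁ : ∀ z, c (L z) + c (R z) = q • (L (right c z) + L z) := fun z => by
    have h := hH.apply_apply (L z)
    rw [hl, hr, hll, map_add, map_smul, map_smul, ← hbr, hrr] at h
    simp only [map_add, map_smul, hL] at h
    rw [← hr, ← hl] at h
    refine smul_right_injective _ hq1' ?_
    linear_combination (norm := module) -h
  have s₂ : ∀ z, c (L z) + c (R z) = q • (R (left c z) + R z) := fun z => by
    have h := hH.apply_apply (R z)
    rw [hr, hl, hrr, map_add, map_smul, map_smul, hbr, hll] at h
    simp only [map_add, map_smul, hR] at h
    rw [← hl, ← hr] at h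
    refine smul_right_injective _ hq1' ?_
    linear_combination (norm := module) -h
  have s₃ : ∀ z, L (right c z) + L z = R (left c z) + R z := fun z =>
    smul_right_injective _ hq0 ((s₁ z).symm.trans (s₂ z))
  have t₁ : ∀ z, c (L z) = R z + q • R z + q • R (left c z) := fun z => by
    have h := s₃ (right c z)
    have h' := s₃ z
    rw [hrr, hR, ← hl] at h
    simp only [map_add, map_smul] at h
    linear_combination (norm := module) -h + q • h'
  have t₂ : ∀ z, c (R z) = L z + q • L z + q • L (right c z) := fun z => by
    have h := s₃ (left c z)
    have h' := s₃ z
    rw [hll, hL, ← hr] at h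
    simp only [map_add, map_smul] at h
    linear_combination (norm := module) h - q • h'
  have t₃ : ∀ z, L z = -(R z + q • R z + q • R (left c z)) := fun z => by
    linear_combination (norm := module) s₁ z - t₂ z - t₁ z
  have t₄ : R (left c z) + R z = 0 := by
    refine smul_right_injective _ hq3 ?_
    have h := t₃ (left c z)
    have h' := t₃ z
    rw [hL, hll] at h
    simp only [map_add, map_smul] at h
    simp only [smul_zero]
    linear_combination (norm := module) h + h'
  linear_combination (norm := module) t₃ z - q • t₄

/-- A braided vector space of Hecke type of regular mark `q ≠ 1` carries no nonzero braided
bracket, in characteristic different from two. -/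
theorem bracket_eq_zero (h2 : (2 : K) ≠ 0) (hc : IsBraiding c) (hH : IsHecke c q)
    (hq0 : q ≠ 0) (hq1 : q ≠ 1) (hq3 : 1 + q + q ^ 2 ≠ 0) (hb : b ∘ₗ c = -b)
    (hl : ∀ z, c (b.rTensor V z) = rightBracket b (left c (right c z)))
    (hr : ∀ z, c (rightBracket b z) = b.rTensor V (right c (left c z))) : b = 0 := by
  have key : ∀ x y z : V, b (x ⊗ₜ[K] y) ⊗ₜ[K] z + x ⊗ₜ[K] b (y ⊗ₜ[K] z) = 0 := fun x y z =>
    rTensor_add_rightBracket hc hH hq0 hq1 hq3 hb hl hr ((x ⊗ₜ[K] y) ⊗ₜ[K] z)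
  refine TensorProduct.ext' fun x y => ?_
  by_contra hne
  obtain ⟨f, hf⟩ := Module.Projective.exists_dual_ne_zero K (x := b (x ⊗ₜ[K] y)) hne
  -- slicing `key` with `f` shows that `z` and `b (y ⊗ z)` are proportional
  have h₁ : ∀ z, f (b (x ⊗ₜ[K] y)) • z + f x • b (y ⊗ₜ[K] z) = 0 := fun z => by
    have := congrArg (fun w => TensorProduct.lid K V (f.rTensor V w)) (key x y z)
    simpa using this
  have hy : y ≠ 0 := by
    rintro rfl
    simp at hne
  have hfx : f x ≠ 0 := by
    intro h
    have := h₁ y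
    rw [h, zero_smul, add_zero] at this
    exact (smul_ne_zero hf hy) this
  have h₂ : b (y ⊗ₜ[K] y) = (-(f x)⁻¹ * f (b (x ⊗ₜ[K] y))) • y := by
    have := h₁ y
    refine smul_right_injective _ hfx ?_
    simp only [smul_smul]
    rw [← mul_assoc, mul_neg, mul_inv_cancel₀ hfx, neg_one_mul, neg_smul]
    linear_combination (norm := module) this
  have h₃ := key y y y
  rw [h₂, ← TensorProduct.smul_tmul', TensorProduct.tmul_smul, ← two_smul K, smul_smul,
    smul_eq_zero] at h₃
  rcases h₃ with h₃ | h₃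
  · exact mul_ne_zero h2 (mul_ne_zero (neg_ne_zero.2 (inv_ne_zero hfx)) hf) h₃
  · obtain ⟨g, hg⟩ := Module.Projective.exists_dual_ne_zero K hy
    have := congrArg (fun w => TensorProduct.lid K K (TensorProduct.map g g w)) h₃
    simp [hg] at this

end Bracket

/-! ### The coradical filtration of a connected coalgebra is exhaustive -/

/-- Let `M` be a simple module, finite-dimensional over `K`, whose annihilator is contained in the
kernel of a character `χ`. Then `ker χ` annihilates `M`: the algebra acting on `M` is semisimple, so
that a proper two-sided ideal containing the annihilator has a complement, which it kills. -/
theorem smul_eq_zero_of_character {K : Type*} [Field K] {S : Type*} [Ring S] [Algebra K S]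
    {M : Type*} [AddCommGroup M] [Module K M] [Module S M] [IsScalarTower K S M]
    [FiniteDimensional K M] [IsSimpleModule S M] (χ : S →+* K)
    (hχ : ∀ s : S, (∀ m : M, s • m = 0) → χ s = 0) {s : S} (hs : χ s = 0) (m : M) :
    s • m = 0 := by
  let b := Module.finBasis K M
  -- `S / ann M` embeds into a power of `M`
  let θ : S →ₗ[S] (Fin (Module.finrank K M) →₀ M) :=
    (Finsupp.linearEquivFunOnFinite S M _).symm.toLinearMap ∘ₗ
      LinearMap.pi fun i => LinearMap.toSpanSingleton S M (b i)
  have hθ : ∀ s, θ s = 0 → ∀ m : M, s • m = 0 := by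
    intro s hs m
    have h : ∀ i, s • b i = 0 := fun i => DFunLike.congr_fun hs i
    let l : M →ₗ[K] M :=
      { toFun := fun m => s • m
        map_add' := smul_add s
        map_smul' := fun r m => smul_algebra_smul_comm r s m }
    have : l = 0 := b.ext fun i => h i
    exact LinearMap.congr_fun this m
  let N : Submodule S S := RingHom.ker χ
  obtain ⟨L, hL⟩ := exists_isCompl (N.map θ)
  have hNL : ∀ n, χ n = 0 → ∀ n', θ n' ∈ L → ∀ m : M, (n * n') • m = 0 := by
    intro n hn n' hn' m
    refine hθ _ ?_ m
    have h₁ : θ (n * n') ∈ N.map θ :=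
      ⟨n * n', by change χ _ = 0; rw [map_mul, hn, zero_mul], rfl⟩
    have h₂ : θ (n * n') ∈ L := by
      rw [← smul_eq_mul, map_smul]
      exact L.smul_mem n hn'
    exact (Submodule.disjoint_def.1 hL.disjoint) _ h₁ h₂
  obtain ⟨x, hx, y, hy, hxy⟩ := Submodule.mem_sup.1
    (show θ 1 ∈ N.map θ ⊔ L by rw [hL.sup_eq_top]; trivial)
  obtain ⟨n, hn, rfl⟩ := hx
  have hn : χ n = 0 := hn
  have hn' : θ (1 - n) ∈ L := by
    rw [map_sub, ← hxy, add_sub_cancel_left]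
    exact hy
  obtain ⟨m₀, hm₀⟩ : ∃ m₀ : M, (1 - n) • m₀ ≠ 0 := by
    by_contra! h
    have := hχ _ h
    rw [map_sub, map_one, hn, sub_zero] at this
    exact one_ne_zero this
  obtain ⟨r, rfl⟩ := (IsSimpleModule.toSpanSingleton_surjective S hm₀) m
  rw [LinearMap.toSpanSingleton_apply, smul_smul, smul_smul]
  have h := hNL (s * r) (by rw [map_mul, hs, zero_mul]) _ hn' m₀
  rwa [mul_assoc] at h ⊢

section Exhaustion

variable {K : Type u} [Field K] {C : Type v} [AddCommGroup C] [Module K C] [Coalgebra K C]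

theorem corad_mono : Monotone (corad K C) := by
  refine monotone_nat_of_le_succ fun n => ?_
  induction n with
  | zero => exact corad_zero_le_one K C
  | succ n ih =>
    intro x hx
    exact map_eq_zero_of_ker_le le_rfl (by simpa using ih) hx

theorem exists_isSimpleSubcoalgebra_le {E : Submodule K C} [FiniteDimensional K E]
    (hE : IsSubcoalgebra K E) (hE0 : E ≠ ⊥) : ∃ D, IsSimpleSubcoalgebra K D ∧ D ≤ E := by
  obtain ⟨D, ⟨hD, hD0, hDE⟩, hmin⟩ := WellFounded.has_min
    (measure fun D : Submodule K C => Module.finrank K D).wf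
    {D | IsSubcoalgebra K D ∧ D ≠ ⊥ ∧ D ≤ E} ⟨E, hE, hE0, le_rfl⟩
  have : FiniteDimensional K D := Submodule.finiteDimensional_of_le hDE
  refine ⟨D, ⟨hD, hD0, fun D' hD' hle => ?_⟩, hDE⟩
  by_cases h : D' = ⊥
  · exact Or.inl h
  · exact Or.inr (Submodule.eq_of_le_of_finrank_le hle
      (not_lt.1 (hmin D' ⟨hD', h, hle.trans hDE⟩)))

/-- The algebra of the endomorphisms `φ` of `C` with `Δφ = (φ ⊗ C)Δ`, that is, of the operators
`x ↦ ∑ f(x₁) x₂` with `f` in the dual of `C`. -/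
def coendo (K : Type u) [Field K] (C : Type v) [AddCommGroup C] [Module K C] [Coalgebra K C] :
    Subalgebra K (Module.End K C) where
  carrier := {φ | ∀ x, Coalgebra.comul (R := K) (φ x) = φ.rTensor C (Coalgebra.comul (R := K) x)}
  mul_mem' := fun {φ ψ} hφ hψ x => by
    rw [Module.End.mul_apply, hφ, hψ, ← LinearMap.rTensor_comp_apply]; rfl
  add_mem' := fun {φ ψ} hφ hψ x => by
    rw [LinearMap.add_apply, map_add, hφ, hψ, LinearMap.rTensor_add, LinearMap.add_apply]
  algebraMap_mem' := fun r x => by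
    rw [Module.algebraMap_end_apply, map_smul, Algebra.algebraMap_eq_smul_one,
      LinearMap.rTensor_smul, LinearMap.smul_apply, Module.End.one_eq_id, LinearMap.rTensor_id,
      LinearMap.id_apply]

theorem coendo_comul (φ : coendo K C) (x : C) : Coalgebra.comul (R := K) (φ.1 x) =
    φ.1.rTensor C (Coalgebra.comul (R := K) x) := φ.2 x

/-- The operator `x ↦ ∑ f(x₁) x₂`. -/
def dualAct (f : C →ₗ[K] K) : coendo K C :=
  ⟨(TensorProduct.lid K C).toLinearMap ∘ₗ f.rTensor C ∘ₗ Coalgebra.comul, fun x => by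
    have key : ∀ w : C ⊗[K] C, Coalgebra.comul (TensorProduct.lid K C (f.rTensor C w)) =
        ((TensorProduct.lid K C).toLinearMap ∘ₗ f.rTensor C).rTensor C
          ((TensorProduct.assoc K C C C).symm (Coalgebra.comul.lTensor C w)) := fun w => by
      induction w using TensorProduct.induction_on with
      | zero => simp
      | add x y hx hy => simp only [map_add, hx, hy]
      | tmul a b =>
        simp only [LinearMap.rTensor_tmul, TensorProduct.lid_tmul, map_smul,
          LinearMap.lTensor_tmul]
        generalize Coalgebra.comul (R := K) b = y
        induction y using TensorProduct.induction_on with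
        | zero => simp
        | add x y hx hy => simp only [map_add, smul_add, TensorProduct.tmul_add, hx, hy]
        | tmul b b' => simp [TensorProduct.smul_tmul']
    change Coalgebra.comul (TensorProduct.lid K C (f.rTensor C _)) = _
    rw [key, Coalgebra.coassoc_symm_apply, ← LinearMap.rTensor_comp_apply]
    rfl⟩

theorem dualAct_apply (f : C →ₗ[K] K) (x : C) : (dualAct f).1 x =
    TensorProduct.lid K C (f.rTensor C (Coalgebra.comul (R := K) x)) := rfl

theorem coendo_apply (φ : coendo K C) (x : C) :
    φ.1 x = (dualAct (Coalgebra.counit ∘ₗ φ.1)).1 x := by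
  have h := congrArg (fun z => TensorProduct.lid K C (Coalgebra.counit.rTensor C z))
    (coendo_comul φ x)
  simp only [Coalgebra.rTensor_counit_comul, TensorProduct.lid_tmul, one_smul,
    ← LinearMap.rTensor_comp_apply] at h
  exact h

theorem counit_dualAct (f : C →ₗ[K] K) (x : C) :
    Coalgebra.counit (R := K) ((dualAct f).1 x) = f x := by
  have key : ∀ w : C ⊗[K] C, Coalgebra.counit (R := K) (TensorProduct.lid K C (f.rTensor C w)) =
      f (TensorProduct.rid K C (Coalgebra.counit.lTensor C w)) := fun w => by
    induction w using TensorProduct.induction_on with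
    | zero => simp
    | add x y hx hy => simp only [map_add, hx, hy]
    | tmul a b => simp [mul_comm]
  rw [dualAct_apply, key, Coalgebra.lTensor_counit_comul, TensorProduct.rid_tmul, one_smul]

theorem exists_finset_dualAct_mem (x : C) :
    ∃ s : Finset C, ∀ φ : coendo K C, φ.1 x ∈ Submodule.span K (s : Set C) := by
  classical
  obtain ⟨t, ht⟩ := TensorProduct.exists_finset (Coalgebra.comul (R := K) x)
  refine ⟨t.image Prod.snd, fun φ => ?_⟩
  rw [coendo_apply, dualAct_apply, ht, map_sum, map_sum]
  refine sum_mem fun i hi => ?_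
  rw [LinearMap.rTensor_tmul, TensorProduct.lid_tmul]
  exact Submodule.smul_mem _ _ (Submodule.subset_span (Finset.mem_coe.2
    (Finset.mem_image_of_mem _ hi)))

variable {g : C}

theorem coendo_apply_groupLike (hg : Coalgebra.comul (R := K) g = g ⊗ₜ[K] g) (φ : coendo K C) :
    φ.1 g = Coalgebra.counit (R := K) (φ.1 g) • g := by
  conv_lhs => rw [coendo_apply, dualAct_apply, hg]
  simp

/-- Evaluation at a group-like element, a character of `coendo K C`. -/
def coendoChar (hg : Coalgebra.comul (R := K) g = g ⊗ₜ[K] g)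
    (hε : Coalgebra.counit (R := K) g = 1) : coendo K C →+* K where
  toFun φ := Coalgebra.counit (φ.1 g)
  map_one' := hε
  map_mul' φ ψ := by
    change Coalgebra.counit (φ.1 (ψ.1 g)) = _
    rw [coendo_apply_groupLike hg ψ, map_smul, map_smul, smul_eq_mul, mul_comm,
      coendo_apply_groupLike hg ψ]
    simp [hε]
  map_zero' := by simp
  map_add' φ ψ := by simp

end Exhaustion

theorem exists_simple_finiteDimensional_submodule {K : Type*} [Field K] {S : Type*} [Ring S]
    [Algebra K S] {Q : Type*} [AddCommGroup Q] [Module K Q] [Module S Q] [IsScalarTower K S Q]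
    {x : Q} (hx : x ≠ 0) (F : Submodule K Q) [FiniteDimensional K F] (hF : ∀ s : S, s • x ∈ F) :
    ∃ M : Submodule S Q, IsSimpleModule S M ∧ FiniteDimensional K M := by
  let N : Submodule S Q := S ∙ x
  have hNfin : FiniteDimensional K N := by
    have hle : N.restrictScalars K ≤ F := by
      intro y hy
      obtain ⟨s, rfl⟩ := Submodule.mem_span_singleton.1 (show y ∈ N from hy)
      exact hF s
    exact Submodule.finiteDimensional_of_le hle
  have hNne : Nontrivial N :=
    ⟨⟨⟨x, Submodule.mem_span_singleton_self _⟩, 0, fun h => hx (congrArg Subtype.val h)⟩⟩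
  have hart : IsArtinian S N := isArtinian_of_tower K inferInstance
  obtain ⟨M, hM⟩ := IsAtomic.exists_atom (Submodule S N)
  have hsimple : IsSimpleModule S M := isSimpleModule_iff_isAtom.2 hM
  have hMfin : FiniteDimensional K M :=
    FiniteDimensional.of_injective (M.subtype.restrictScalars K) M.subtype_injective
  let e := M.equivMapOfInjective N.subtype N.subtype_injective
  exact ⟨M.map N.subtype, .congr e.symm, .of_injective (e.symm.toLinearMap.restrictScalars K)
    e.symm.injective⟩

section Exhaustion

variable {K : Type u} [Field K] {C : Type v} [AddCommGroup C] [Module K C] [Coalgebra K C] {g : C}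

theorem coendo_apply_mem_corad (hg : Coalgebra.comul (R := K) g = g ⊗ₜ[K] g)
    (hcor : coradical K C = K ∙ g) (φ : coendo K C) (n : ℕ) {x : C} (hx : x ∈ corad K C n) :
    φ.1 x ∈ corad K C n := by
  have h0 : ∀ x ∈ coradical K C, φ.1 x ∈ coradical K C := by
    intro x hx
    rw [hcor, Submodule.mem_span_singleton] at *
    obtain ⟨r, rfl⟩ := hx
    rw [map_smul, coendo_apply_groupLike hg, smul_smul]
    exact ⟨_, rfl⟩
  cases n with
  | zero => exact h0 x hx
  | succ n =>
    change TensorProduct.map _ _ _ = 0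
    rw [coendo_comul, ← LinearMap.comp_apply, LinearMap.map_comp_rTensor]
    refine map_eq_zero_of_ker_le ?_ le_rfl hx
    intro y hy
    rw [Submodule.ker_mkQ] at hy
    simpa using h0 y hy

/-- The union of the coradical filtration, as a module over `coendo K C`. -/
def coradUnion (hg : Coalgebra.comul (R := K) g = g ⊗ₜ[K] g)
    (hcor : coradical K C = K ∙ g) : Submodule (coendo K C) C where
  carrier := {x | ∃ n, x ∈ corad K C n}
  add_mem' := by
    rintro x y ⟨n, hn⟩ ⟨m, hm⟩
    exact ⟨max n m, add_mem (corad_mono (le_max_left _ _) hn) (corad_mono (le_max_right _ _) hm)⟩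
  zero_mem' := ⟨0, zero_mem _⟩
  smul_mem' := by
    rintro φ x ⟨n, hn⟩
    exact ⟨n, coendo_apply_mem_corad hg hcor φ n hn⟩

/-- If all the operators `∑ f(x₁) x₂` with `f(g) = 0` send `y` into the coradical filtration, then
`y` is in the filtration as well. -/
theorem mem_coradUnion_of_dualAct {hg : Coalgebra.comul (R := K) g = g ⊗ₜ[K] g}
    {hcor : coradical K C = K ∙ g} {y : C}
    (h : ∀ f : C →ₗ[K] K, f g = 0 → (dualAct f).1 y ∈ coradUnion hg hcor) :
    y ∈ coradUnion hg hcor := by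
  classical
  -- the slices of `Δ(y)` lie in a finite-dimensional space, so a single step of the filtration
  -- contains all those that lie in the union
  obtain ⟨s, hs⟩ := exists_finset_dualAct_mem (K := K) y
  let B : Submodule K C := Submodule.span K (s : Set C) ⊓ (coradUnion hg hcor).restrictScalars K
  have hfin : FiniteDimensional K B := Submodule.finiteDimensional_of_le
    (inf_le_left : B ≤ Submodule.span K (s : Set C))
  obtain ⟨t, ht⟩ := (IsNoetherian.noetherian (⊤ : Submodule K B)).map B.subtype
  rw [Submodule.map_subtype_top] at ht
  have htU : ∀ b ∈ t, ∃ n, b ∈ corad K C n := fun b hb => by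
    have : b ∈ B := ht ▸ Submodule.subset_span hb
    exact this.2
  choose! N hN using htU
  have hB : B ≤ corad K C (t.sup N) := by
    rw [← ht, Submodule.span_le]
    exact fun b hb => corad_mono (Finset.le_sup hb) (hN b hb)
  refine ⟨t.sup N + 1, ?_⟩
  change TensorProduct.map _ _ _ = 0
  rw [← LinearMap.lTensor_comp_rTensor, LinearMap.comp_apply, ← LinearMap.mem_ker,
    ← range_lTensor_subtype]
  refine mem_range_lTensor_of_slices _ _ fun f => hB ⟨?_, ?_⟩
  · rw [← LinearMap.rTensor_comp_apply]
    exact hs (dualAct (f ∘ₗ (coradical K C).mkQ))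
  · rw [← LinearMap.rTensor_comp_apply]
    refine h (f ∘ₗ (coradical K C).mkQ) ?_
    have : g ∈ coradical K C := hcor ▸ Submodule.mem_span_singleton_self g
    rw [LinearMap.comp_apply, Submodule.mkQ_apply, (Submodule.Quotient.mk_eq_zero _).2 this,
      map_zero]

/-- An operator that annihilates a nonzero finite-dimensional subquotient `M` of `C` annihilates
`g`: the elements of `C` killed by the annihilator of `M` form a nonzero finite-dimensional
subcoalgebra, which contains a simple subcoalgebra, hence `g`. -/
theorem apply_groupLike_eq_zero (hcor : coradical K C = K ∙ g) {M : Type*} [AddCommGroup M]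
    [Module K M] [Module (coendo K C) M] [IsScalarTower K (coendo K C) M] [FiniteDimensional K M]
    {W : Submodule (coendo K C) C} (π : W →ₗ[coendo K C] M) (hπ : Function.Surjective π)
    [Nontrivial M] {φ : coendo K C} (hφ : ∀ m : M, φ • m = 0) : φ.1 g = 0 := by
  classical
  let X : Set (coendo K C) := {φ | ∀ m : M, φ • m = 0}
  let E : Submodule K C :=
    { carrier := {a | ∀ φ ∈ X, φ.1 a = 0}
      add_mem' := fun {a b} ha hb φ hφ => by rw [map_add, ha φ hφ, hb φ hφ, add_zero]
      zero_mem' := fun φ _ => map_zero _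
      smul_mem' := fun r a ha φ hφ => by rw [map_smul, ha φ hφ, smul_zero] }
  -- `X` is a two-sided ideal, so `E` is a subcoalgebra
  have hE : IsSubcoalgebra K E := by
    rintro _ ⟨a, ha, rfl⟩
    refine mem_range_map_of_mem E.subtype_injective E.subtype_injective ?_ ?_
    · refine mem_range_rTensor_of_slices _ _ fun f φ hφ => ?_
      have key : ∀ w : C ⊗[K] C, φ.1 (TensorProduct.rid K C (f.lTensor C w)) =
          TensorProduct.rid K C (f.lTensor C (φ.1.rTensor C w)) := fun w => by
        induction w using TensorProduct.induction_on with
        | zero => simp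
        | add x y hx hy => simp only [map_add, hx, hy]
        | tmul a b => simp
      rw [key, ← coendo_comul, ha φ hφ]
      simp
    · refine mem_range_lTensor_of_slices _ _ fun f φ hφ => ?_
      refine ha (φ * dualAct f) fun m => ?_
      rw [mul_smul]
      exact hφ _
  obtain ⟨m₀, hm₀⟩ := exists_ne (0 : M)
  obtain ⟨y₀, rfl⟩ := hπ m₀
  have hE0 : E ≠ ⊥ := by
    let W' : Submodule K W := LinearMap.ker (π.restrictScalars K)
    obtain ⟨f', hf', hle⟩ := Submodule.exists_le_ker_of_notMem (p := W') (v := y₀)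
      (fun h => hm₀ h)
    obtain ⟨f, hf⟩ := LinearMap.exists_extend (p := W.restrictScalars K) f'
    have hf : ∀ w : W, f w = f' w := LinearMap.congr_fun hf
    -- the coefficient `∑ f(y₂) y₁` of `y₀`
    let e : C := TensorProduct.rid K C (f.lTensor C (Coalgebra.comul (R := K) (y₀ : C)))
    have key : ∀ φ : coendo K C, Coalgebra.counit (R := K) (φ.1 e) = f (φ.1 y₀) := by
      intro φ
      conv_rhs => rw [coendo_apply, dualAct_apply]
      generalize φ.1 = φ
      simp only [e]
      generalize (Coalgebra.comul (R := K) (y₀ : C)) = w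
      induction w using TensorProduct.induction_on with
      | zero => simp
      | add x y hx hy => simp only [map_add, hx, hy]
      | tmul a b => simp [mul_comm]
    intro h
    have he : e ∈ E := by
      intro φ hφ
      -- all functionals vanish on `φ e`
      by_contra hne
      obtain ⟨l, hl⟩ := Module.Projective.exists_dual_ne_zero K hne
      apply hl
      have h₁ : l (φ.1 e) = Coalgebra.counit (R := K) ((dualAct l * φ).1 e) :=
        (counit_dualAct l _).symm
      rw [h₁, key]
      have h₂ : (dualAct l * φ) • y₀ ∈ W' := by
        change π _ = 0
        rw [map_smul, mul_smul, hφ, smul_zero]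
      exact (hf ((dualAct l * φ) • y₀)).trans (hle h₂)
    rw [h, Submodule.mem_bot] at he
    have h₁ := key 1
    rw [he] at h₁
    change Coalgebra.counit (R := K) (0 : C) = f y₀ at h₁
    rw [map_zero, hf] at h₁
    exact hf' h₁.symm
  -- `E` lies in the span of left tensor factors of `Δ` on lifts of generators of `M`
  have hfin : FiniteDimensional K E := by
    obtain ⟨t, ht⟩ := (Module.Finite.fg_top (R := K) (M := M))
    choose σ hσ using hπ
    choose F hF using fun m : M => TensorProduct.exists_finset (Coalgebra.comul (R := K) (σ m : C))
    let s : Finset C := t.biUnion fun m => (F m).image Prod.fst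
    refine Submodule.finiteDimensional_of_le (S₂ := Submodule.span K (s : Set C)) fun a ha => ?_
    by_contra hns
    obtain ⟨f, hfa, hfs⟩ := Submodule.exists_le_ker_of_notMem hns
    refine hfa ?_
    rw [← counit_dualAct f a, ha (dualAct f), map_zero]
    have h : ∀ m ∈ t, dualAct f • m = 0 := by
      intro m hm
      have : dualAct f • σ m = 0 := by
        apply Subtype.ext
        change (dualAct f).1 (σ m) = 0
        rw [dualAct_apply, hF, map_sum, map_sum]
        refine Finset.sum_eq_zero fun i hi => ?_
        have hi' : f i.1 = 0 := hfs (Submodule.subset_span (Finset.mem_coe.2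
          (Finset.mem_biUnion.2 ⟨m, hm, Finset.mem_image_of_mem _ hi⟩)))
        rw [LinearMap.rTensor_tmul, hi', TensorProduct.zero_tmul, map_zero]
      rw [← hσ m, ← map_smul, this, map_zero]
    intro m
    have hm : m ∈ Submodule.span K (t : Set M) := ht ▸ Submodule.mem_top
    induction hm using Submodule.span_induction with
    | mem x hx => exact h x hx
    | zero => exact smul_zero _
    | add x y _ _ hx hy => rw [smul_add, hx, hy, add_zero]
    | smul r x _ hx => rw [smul_algebra_smul_comm, hx, smul_zero]
  obtain ⟨D, hD, hDE⟩ := exists_isSimpleSubcoalgebra_le hE hE0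
  have hDg : D ≤ K ∙ g := hcor ▸ le_sSup hD
  obtain ⟨d, hd, hd0⟩ := Submodule.exists_mem_ne_zero_of_ne_bot hD.2.1
  obtain ⟨r, rfl⟩ := Submodule.mem_span_singleton.1 (hDg hd)
  have hr : r ≠ 0 := fun h => hd0 (by rw [h, zero_smul])
  have := hDE hd φ hφ
  rw [map_smul] at this
  exact (smul_eq_zero.1 this).resolve_left hr

/-- The operators `∑ f(x₁) x₂` with `f(g) = 0` annihilate the simple subquotients of `C`. -/
theorem map_smul_eq_zero (hg : Coalgebra.comul (R := K) g = g ⊗ₜ[K] g)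
    (hε : Coalgebra.counit (R := K) g = 1) (hcor : coradical K C = K ∙ g) {M : Type*}
    [AddCommGroup M] [Module K M] [Module (coendo K C) M] [IsScalarTower K (coendo K C) M]
    [FiniteDimensional K M] [IsSimpleModule (coendo K C) M]
    {W : Submodule (coendo K C) C} (π : W →ₗ[coendo K C] M) (hπ : Function.Surjective π)
    {φ : coendo K C} (hφ : φ.1 g = 0) (w : W) : π (φ • w) = 0 := by
  have : Nontrivial M := IsSimpleModule.nontrivial (coendo K C) M
  rw [map_smul]
  refine smul_eq_zero_of_character (coendoChar hg hε) (fun ψ h => ?_) ?_ _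
  · change Coalgebra.counit (ψ.1 g) = 0
    rw [apply_groupLike_eq_zero hcor π hπ h, map_zero]
  · change Coalgebra.counit (φ.1 g) = 0
    rw [hφ, map_zero]

/-- A coalgebra whose coradical is spanned by a group-like element is the union of its coradical
filtration. -/
theorem exists_mem_corad (hg : Coalgebra.comul (R := K) g = g ⊗ₜ[K] g)
    (hε : Coalgebra.counit (R := K) g = 1) (hcor : coradical K C = K ∙ g) (x : C) :
    ∃ n, x ∈ corad K C n := by
  change x ∈ coradUnion hg hcor
  by_contra hx
  have hx0 : (coradUnion hg hcor).mkQ x ≠ 0 := fun h =>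
    hx ((Submodule.Quotient.mk_eq_zero _).1 h)
  -- the cyclic comodule generated by the class of `x` has a simple subcomodule
  obtain ⟨M, hsimple, hMfin⟩ : ∃ M : Submodule (coendo K C) (C ⧸ coradUnion hg hcor),
      IsSimpleModule (coendo K C) M ∧ FiniteDimensional K M := by
    obtain ⟨s, hs⟩ := exists_finset_dualAct_mem (K := K) x
    refine exists_simple_finiteDimensional_submodule hx0
      ((Submodule.span K (s : Set C)).map ((coradUnion hg hcor).mkQ.restrictScalars K)) fun φ => ?_
    exact ⟨φ.1 x, hs φ, rfl⟩
  -- `M` as a quotient of its preimage in `C`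
  have hsurj : Function.Surjective (((coradUnion hg hcor).mkQ.restrict
      (p := M.comap (coradUnion hg hcor).mkQ) (q := M)) fun _ h => h) := fun m => by
    obtain ⟨y, hy⟩ := (coradUnion hg hcor).mkQ_surjective m.1
    exact ⟨⟨y, by rw [Submodule.mem_comap, hy]; exact m.2⟩, Subtype.ext hy⟩
  have : Nontrivial M := IsSimpleModule.nontrivial (coendo K C) M
  obtain ⟨m, hm⟩ := exists_ne (0 : M)
  obtain ⟨w, rfl⟩ := hsurj m
  have hwU : (w : C) ∈ coradUnion hg hcor := mem_coradUnion_of_dualAct fun f hf => by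
    have h := map_smul_eq_zero hg hε hcor _ hsurj
      (show (dualAct f).1 g = 0 by rw [dualAct_apply, hg]; simp [hf]) w
    exact (Submodule.Quotient.mk_eq_zero _).1 (congrArg Subtype.val h)
  exact hm (Subtype.ext ((Submodule.Quotient.mk_eq_zero _).2 hwU))

end Exhaustion

/-! ### The coradical filtration of a connected braided bialgebra -/

section Filtration

variable {K : Type u} [Field K] {A : Type v} [Ring A] [Algebra K A] [Coalgebra K A]
  {c : A ⊗[K] A →ₗ[K] A ⊗[K] A}

/-- The projection `a ↦ a - ε(a) 1` onto the augmentation ideal. -/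
def augProj (K : Type u) [Field K] (A : Type v) [Ring A] [Algebra K A] [Coalgebra K A] :
    A →ₗ[K] A :=
  LinearMap.id - (Coalgebra.counit (R := K) (A := A)).smulRight (1 : A)

theorem augProj_apply (a : A) : augProj K A a = a - Coalgebra.counit (R := K) a • (1 : A) := rfl

/-- The coradical filtration, with the index shifted by one: `F₀ = 0` and `Fₙ₊₁ = Aₙ`. It is
described through the projection onto the augmentation ideal instead of the quotient by `A₀`. -/
def filt (K : Type u) [Field K] (A : Type v) [Ring A] [Algebra K A] [Coalgebra K A] :
    ℕ → Submodule K A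
  | 0 => ⊥
  | n + 1 => LinearMap.ker (TensorProduct.map (augProj K A) (filt K A n).mkQ ∘ₗ Coalgebra.comul)

theorem mem_filt_succ {n : ℕ} {x : A} : x ∈ filt K A (n + 1) ↔
    TensorProduct.map (augProj K A) (filt K A n).mkQ (Coalgebra.comul (R := K) x) = 0 := Iff.rfl

theorem augProj_one (hA : IsBraidedBialgebra K c) : augProj K A 1 = 0 := by
  rw [augProj_apply, hA.counit_one, one_smul, sub_self]

theorem augProj_of_mem_prim (hA : IsBraidedBialgebra K c) {u : A} (hu : u ∈ prim K A) :
    augProj K A u = u := by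
  rw [augProj_apply, counit_eq_zero_of_mem_prim hA hu, zero_smul, sub_zero]

theorem ker_augProj (hA : IsBraidedBialgebra K c) :
    LinearMap.ker (augProj K A) = K ∙ (1 : A) := by
  ext x
  rw [LinearMap.mem_ker, Submodule.mem_span_singleton, augProj_apply, sub_eq_zero]
  refine ⟨fun h => ⟨_, h.symm⟩, ?_⟩
  rintro ⟨r, rfl⟩
  rw [map_smul, hA.counit_one, smul_eq_mul, mul_one]

theorem smulRight_rTensor_comul (x : A) :
    ((Coalgebra.counit (R := K) (A := A)).smulRight (1 : A)).rTensor A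
      (Coalgebra.comul (R := K) x) = 1 ⊗ₜ[K] x := by
  have key : ∀ z : A ⊗[K] A, ((Coalgebra.counit (R := K) (A := A)).smulRight (1 : A)).rTensor A z =
      1 ⊗ₜ[K] TensorProduct.lid K A ((Coalgebra.counit (R := K) (A := A)).rTensor A z) :=
    fun z => by
      induction z using TensorProduct.induction_on with
      | zero => simp
      | add x y hx hy => simp only [map_add, TensorProduct.tmul_add, hx, hy]
      | tmul a b => simp [TensorProduct.smul_tmul]
  rw [key, Coalgebra.rTensor_counit_comul, TensorProduct.lid_tmul, one_smul]

theorem augProj_rTensor_comul (x : A) :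
    (augProj K A).rTensor A (Coalgebra.comul (R := K) x) = Coalgebra.comul x - 1 ⊗ₜ[K] x := by
  rw [augProj, LinearMap.rTensor_sub, LinearMap.sub_apply, smulRight_rTensor_comul,
    LinearMap.rTensor_id, LinearMap.id_apply]

theorem filt_succ_eq_corad (hA : IsBraidedBialgebra K c) (hconn : IsConnectedCoalgebra K A)
    (n : ℕ) : filt K A (n + 1) = corad K A n := by
  have hcor := coradical_eq_span_one hA hconn
  induction n with
  | zero =>
    ext x
    change _ ↔ x ∈ coradical K A
    rw [hcor, mem_filt_succ, Submodule.mem_span_singleton]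
    constructor
    · intro h
      have h₁ : (augProj K A).rTensor A (Coalgebra.comul (R := K) x) = 0 :=
        map_eq_zero_of_ker_le (h' := LinearMap.id) le_rfl
          (by rw [Submodule.ker_mkQ]; exact bot_le) h
      rw [augProj_rTensor_comul, sub_eq_zero] at h₁
      have h₂ := congrArg (fun z => TensorProduct.rid K A (Coalgebra.counit.lTensor A z)) h₁
      simp only [Coalgebra.lTensor_counit_comul, TensorProduct.rid_tmul, one_smul,
        LinearMap.lTensor_tmul] at h₂
      exact ⟨_, h₂.symm⟩
    · rintro ⟨r, rfl⟩
      rw [map_smul, hA.comul_one, map_smul, TensorProduct.map_tmul, augProj_one hA,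
        TensorProduct.zero_tmul, smul_zero]
  | succ n ih =>
    ext x
    rw [mem_filt_succ, ih]
    have hk : LinearMap.ker (augProj K A) = LinearMap.ker (coradical K A).mkQ := by
      rw [ker_augProj hA, Submodule.ker_mkQ, hcor]
    exact ⟨map_eq_zero_of_ker_le hk.le le_rfl, map_eq_zero_of_ker_le hk.ge le_rfl⟩

theorem filt_mono (hA : IsBraidedBialgebra K c) (hconn : IsConnectedCoalgebra K A) :
    Monotone (filt K A) := by
  refine monotone_nat_of_le_succ fun n => ?_
  cases n with
  | zero => exact bot_le
  | succ n =>
    rw [filt_succ_eq_corad hA hconn, filt_succ_eq_corad hA hconn]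
    exact corad_mono n.le_succ

theorem one_mem_filt (hA : IsBraidedBialgebra K c) (n : ℕ) : (1 : A) ∈ filt K A (n + 1) := by
  rw [mem_filt_succ, hA.comul_one, TensorProduct.map_tmul, augProj_one hA, TensorProduct.zero_tmul]

theorem mem_filt_one (hA : IsBraidedBialgebra K c) (hconn : IsConnectedCoalgebra K A) {x : A} :
    x ∈ filt K A 1 ↔ ∃ r : K, r • (1 : A) = x := by
  rw [filt_succ_eq_corad hA hconn]
  change x ∈ coradical K A ↔ _
  rw [coradical_eq_span_one hA hconn, Submodule.mem_span_singleton]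

theorem map_map_comp_comul {M N P : Type*} [AddCommGroup M] [Module K M] [AddCommGroup N]
    [Module K N] [AddCommGroup P] [Module K P] (f : A →ₗ[K] M) (g : A →ₗ[K] N) (h : A →ₗ[K] P)
    (x : A) : TensorProduct.map (TensorProduct.map f g ∘ₗ Coalgebra.comul) h
        (Coalgebra.comul (R := K) x) = (TensorProduct.assoc K M N P).symm
      (TensorProduct.map f (TensorProduct.map g h ∘ₗ Coalgebra.comul)
        (Coalgebra.comul (R := K) x)) := by
  rw [← LinearMap.map_comp_rTensor, ← LinearMap.map_comp_lTensor, LinearMap.comp_apply,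
    LinearMap.comp_apply, ← Coalgebra.coassoc_apply]
  generalize Coalgebra.comul.rTensor A (Coalgebra.comul (R := K) x) = z
  induction z using TensorProduct.induction_on with
  | zero => simp
  | add x y hx hy => simp only [map_add, hx, hy]
  | tmul a b =>
    induction a using TensorProduct.induction_on with
    | zero => simp
    | add x y hx hy => simp only [map_add, TensorProduct.add_tmul, hx, hy]
    | tmul a b => simp

/-- `Δ(F_{j+k}) ⊆ F_j ⊗ A + A ⊗ F_k` for `j ≥ 1`, by coassociativity. -/
theorem map_mkQ_comul_of_mem_filt (hA : IsBraidedBialgebra K c) {j k : ℕ} {x : A}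
    (hx : x ∈ filt K A (j + 1 + k)) : TensorProduct.map (filt K A (j + 1)).mkQ (filt K A k).mkQ
      (Coalgebra.comul (R := K) x) = 0 := by
  induction j generalizing x with
  | zero =>
    rw [zero_add, add_comm] at hx
    refine map_eq_zero_of_ker_le ?_ le_rfl hx
    rw [ker_augProj hA, Submodule.span_singleton_le_iff_mem, Submodule.ker_mkQ]
    exact one_mem_filt hA 0
  | succ j ih =>
    refine map_eq_zero_of_ker_le (Submodule.ker_mkQ (filt K A (j + 1 + 1))).ge le_rfl ?_
    rw [map_map_comp_comul]
    have h₀ : TensorProduct.map (augProj K A)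
        (TensorProduct.map (filt K A (j + 1)).mkQ (filt K A k).mkQ ∘ₗ Coalgebra.comul)
        (Coalgebra.comul (R := K) x) = 0 := by
      refine map_eq_zero_of_ker_le (g' := (filt K A (j + 1 + k)).mkQ) le_rfl ?_ ?_
      · rw [Submodule.ker_mkQ]
        exact fun y hy => ih hy
      · rwa [show j + 1 + 1 + k = j + 1 + k + 1 by ring] at hx
    rw [h₀, map_zero]

theorem map_comul_of_mem_filt (hA : IsBraidedBialgebra K c) {M N : Type*}
    [AddCommGroup M] [Module K M] [AddCommGroup N] [Module K N] {j k : ℕ} {g : A →ₗ[K] M}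
    {h : A →ₗ[K] N} (hg : filt K A (j + 1) ≤ LinearMap.ker g) (hh : filt K A k ≤ LinearMap.ker h)
    {x : A} (hx : x ∈ filt K A (j + 1 + k)) :
    TensorProduct.map g h (Coalgebra.comul (R := K) x) = 0 :=
  map_eq_zero_of_ker_le (by rwa [Submodule.ker_mkQ]) (by rwa [Submodule.ker_mkQ])
    (map_mkQ_comul_of_mem_filt hA hx)

/-- Modulo `A ⊗ Fₙ`, the comultiplication of `x ∈ Fₙ₊₁` is `1 ⊗ x`. -/
theorem apply_comul_of_mem_filt_one {n : ℕ} {N : Type*} [AddCommGroup N]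
    [Module K N] {L : A ⊗[K] A →ₗ[K] N} (hL : ∀ a, ∀ f ∈ filt K A n, L (a ⊗ₜ[K] f) = 0) {x : A}
    (hx : x ∈ filt K A (n + 1)) : L (Coalgebra.comul (R := K) x) = L (1 ⊗ₜ[K] x) := by
  rw [← sub_eq_zero, ← map_sub, ← augProj_rTensor_comul]
  refine apply_eq_zero_of_mem_range_lTensor hL ?_
  rw [range_lTensor_subtype, LinearMap.mem_ker, ← LinearMap.comp_apply,
    LinearMap.lTensor_comp_rTensor]
  exact hx

theorem exists_primProj (hA : IsBraidedBialgebra K c) : ∃ p : A →ₗ[K] prim K A,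
    p 1 = 0 ∧ ∀ u : prim K A, p u = u := by
  obtain ⟨s, hs⟩ := (prim K A).subtype.exists_leftInverse_of_injective (Submodule.ker_subtype _)
  refine ⟨s ∘ₗ augProj K A, ?_, fun u => ?_⟩
  · rw [LinearMap.comp_apply, augProj_one hA, map_zero]
  · rw [LinearMap.comp_apply, augProj_of_mem_prim hA u.2]
    exact LinearMap.congr_fun hs u

/-- A linear projection of `A` onto its primitive elements that vanishes at `1`. -/
def primProj (hA : IsBraidedBialgebra K c) : A →ₗ[K] prim K A := (exists_primProj hA).choose

theorem primProj_one (hA : IsBraidedBialgebra K c) : primProj hA 1 = 0 :=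
  (exists_primProj hA).choose_spec.1

theorem primProj_coe (hA : IsBraidedBialgebra K c) (u : prim K A) : primProj hA u = u :=
  (exists_primProj hA).choose_spec.2 u

theorem exists_prim_add_of_mem_filt_two (hA : IsBraidedBialgebra K c)
    (hconn : IsConnectedCoalgebra K A) {x : A} (hx : x ∈ filt K A 2) :
    ∃ (u : prim K A) (r : K), x = u + r • (1 : A) := by
  rw [filt_succ_eq_corad hA hconn] at hx
  obtain ⟨u, hu⟩ := (primToGr_bijective hA hconn).2 (Submodule.Quotient.mk ⟨x, hx⟩)
  have h : (u : A) - x ∈ coradical K A :=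
    (Submodule.Quotient.eq ((corad K A 0).comap (corad K A 1).subtype)).1 hu
  rw [coradical_eq_span_one hA hconn, Submodule.mem_span_singleton] at h
  obtain ⟨r, hr⟩ := h
  exact ⟨u, -r, by rw [neg_smul, hr]; abel⟩

theorem filt_two_le_ker (hA : IsBraidedBialgebra K c) (hconn : IsConnectedCoalgebra K A) :
    filt K A 2 ≤ LinearMap.ker (augProj K A - (prim K A).subtype ∘ₗ primProj hA) := by
  intro x hx
  obtain ⟨u, r, rfl⟩ := exists_prim_add_of_mem_filt_two hA hconn hx
  rw [LinearMap.mem_ker]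
  simp [augProj_one hA, augProj_of_mem_prim hA u.2, primProj_one, primProj_coe]

theorem filt_one_le_ker_primProj (hA : IsBraidedBialgebra K c) (hconn : IsConnectedCoalgebra K A) :
    filt K A 1 ≤ LinearMap.ker (primProj hA) := by
  intro x hx
  obtain ⟨r, rfl⟩ := (mem_filt_one hA hconn).1 hx
  rw [LinearMap.mem_ker, map_smul, primProj_one, smul_zero]

/-- Modulo `A ⊗ Fₙ`, the comultiplication of `x ∈ Fₙ₊₂` is `1 ⊗ x` plus a term in `P ⊗ A`. -/
theorem apply_comul_of_mem_filt_two (hA : IsBraidedBialgebra K c)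
    (hconn : IsConnectedCoalgebra K A) {n : ℕ} {N : Type*} [AddCommGroup N]
    [Module K N] {L : A ⊗[K] A →ₗ[K] N} (hL : ∀ a, ∀ f ∈ filt K A n, L (a ⊗ₜ[K] f) = 0) {x : A}
    (hx : x ∈ filt K A (n + 2)) : L (Coalgebra.comul (R := K) x) =
      L (1 ⊗ₜ[K] x) + L (((prim K A).subtype ∘ₗ primProj hA).rTensor A
        (Coalgebra.comul (R := K) x)) := by
  rw [← sub_eq_zero, ← sub_sub, ← map_sub, ← map_sub, ← augProj_rTensor_comul,
    ← LinearMap.sub_apply, ← LinearMap.rTensor_sub]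
  refine apply_eq_zero_of_mem_range_lTensor hL ?_
  rw [range_lTensor_subtype, LinearMap.mem_ker, ← LinearMap.comp_apply,
    LinearMap.lTensor_comp_rTensor]
  refine map_comul_of_mem_filt hA (filt_two_le_ker hA hconn) (k := n)
    (by rw [Submodule.ker_mkQ]) ?_
  rwa [add_comm]

theorem exists_filt (hA : IsBraidedBialgebra K c) (hconn : IsConnectedCoalgebra K A) (x : A) :
    ∃ n, x ∈ filt K A (n + 1) := by
  simp only [filt_succ_eq_corad hA hconn]
  exact exists_mem_corad hA.comul_one hA.counit_one (coradical_eq_span_one hA hconn) x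

/-! ### Multiplication by primitive elements -/

/-- Left multiplication by `1 ⊗ s` in the algebra `A ⊗_𝔠 A`: the map
`a ⊗ b ↦ (A ⊗ ∇)(𝔠(s ⊗ a) ⊗ b)`. -/
def bcross (c : A ⊗[K] A →ₗ[K] A ⊗[K] A) : A →ₗ[K] Module.End K (A ⊗[K] A) :=
  LinearMap.llcomp K _ _ _ ((LinearMap.mul' K A).lTensor A ∘ₗ
    (TensorProduct.assoc K A A A).toLinearMap) ∘ₗ LinearMap.rTensorHom A ∘ₗ TensorProduct.curry c

theorem bcross_tmul (s a b : A) : bcross c s (a ⊗ₜ[K] b) =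
    (LinearMap.mul' K A).lTensor A (TensorProduct.assoc K A A A (c (s ⊗ₜ[K] a) ⊗ₜ[K] b)) := rfl

theorem bcross_one_tmul (hA : IsBraidedBialgebra K c) (s b : A) :
    bcross c s (1 ⊗ₜ[K] b) = 1 ⊗ₜ[K] (s * b) := by
  simp [bcross_tmul, hA.alg.one_right]

theorem comul_prim_mul (hA : IsBraidedBialgebra K c) {u : A} (hu : u ∈ prim K A) (y : A) :
    Coalgebra.comul (R := K) (u * y) = (LinearMap.mulLeft K u).rTensor A (Coalgebra.comul y) +
      bcross c u (Coalgebra.comul y) := by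
  have h := LinearMap.congr_fun hA.comul_mul (u ⊗ₜ[K] y)
  simp only [LinearMap.comp_apply, LinearMap.mul'_apply, TensorProduct.map_tmul,
    mem_prim_iff.1 hu] at h
  rw [h]
  generalize Coalgebra.comul (R := K) y = w
  induction w using TensorProduct.induction_on with
  | zero => simp
  | add x y hx hy => simp only [map_add, TensorProduct.tmul_add, hx, hy]; abel
  | tmul a b =>
    rw [TensorProduct.add_tmul, map_add, map_add, bcross_tmul]
    congr 1
    · simp [middle, hA.alg.one_left]
    · simp only [middle, LinearMap.comp_apply, LinearEquiv.coe_coe, TensorProduct.assoc_tmul,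
        LinearMap.lTensor_tmul, TensorProduct.assoc_symm_tmul, LinearMap.rTensor_tmul]
      generalize c (u ⊗ₜ[K] a) = z
      induction z using TensorProduct.induction_on with
      | zero => simp
      | add x y hx hy => simp only [map_add, TensorProduct.add_tmul, TensorProduct.tmul_add, hx, hy]
      | tmul a' b' => simp

theorem braiding_mem_range_of_mem_prim (hA : IsBraidedBialgebra K c) {u : A} (hu : u ∈ prim K A)
    (a : A) : c (u ⊗ₜ[K] a) ∈ LinearMap.range ((prim K A).subtype.lTensor A) := by
  rw [mem_prim_iff] at hu
  refine (Module.Flat.lTensor_exact A (exact_prim K A) _).1 ?_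
  have h := LinearMap.congr_fun hA.coalg.comul_left (u ⊗ₜ[K] a)
  simp only [LinearMap.comp_apply, LinearMap.rTensor_tmul, hu, TensorProduct.add_tmul,
    map_add, LinearEquiv.coe_coe, left, right, TensorProduct.assoc_tmul,
    LinearMap.lTensor_tmul, hA.alg.one_left, TensorProduct.assoc_symm_tmul] at h
  rw [LinearEquiv.symm_apply_eq] at h
  rw [primDefect, LinearMap.lTensor_sub, LinearMap.lTensor_sub, LinearMap.sub_apply,
    LinearMap.sub_apply, h, sub_sub, sub_eq_zero, map_add]
  have h₁ : ∀ w : A ⊗[K] A, TensorProduct.assoc K A A A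
      (c.rTensor A ((TensorProduct.assoc K A A A).symm (1 ⊗ₜ[K] w))) =
      (TensorProduct.mk K A A 1).lTensor A w := fun w => by
    induction w using TensorProduct.induction_on with
    | zero => simp
    | add u v hu hv => simp only [TensorProduct.tmul_add, map_add, hu, hv]
    | tmul a b => simp [hA.alg.one_left]
  have h₂ : ∀ w : A ⊗[K] A, TensorProduct.assoc K A A A (w ⊗ₜ[K] 1) =
      ((TensorProduct.mk K A A).flip 1).lTensor A w := fun w => by
    induction w using TensorProduct.induction_on with
    | zero => simp
    | add u v hu hv => simp only [TensorProduct.add_tmul, map_add, hu, hv]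
    | tmul a b => simp
  rw [h₁, h₂]

theorem bcross_mem_range (hA : IsBraidedBialgebra K c) {u : A} (hu : u ∈ prim K A) (a : A)
    {f : A} {F : Submodule K A} (hf : ∀ v ∈ prim K A, v * f ∈ F) :
    bcross c u (a ⊗ₜ[K] f) ∈ LinearMap.range (F.subtype.lTensor A) := by
  rw [bcross_tmul]
  obtain ⟨w, hw⟩ := braiding_mem_range_of_mem_prim hA hu a
  rw [← hw]
  clear hw
  induction w using TensorProduct.induction_on with
  | zero => simp
  | add x y hx hy => simp only [map_add, TensorProduct.add_tmul]; exact add_mem hx hy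
  | tmul a v => exact ⟨a ⊗ₜ[K] ⟨v * f, hf v v.2⟩, rfl⟩

theorem map_bcross_eq_zero (hA : IsBraidedBialgebra K c) {u : A} (hu : u ∈ prim K A) (a : A)
    {f : A} {M N : Type*} [AddCommGroup M] [Module K M] [AddCommGroup N] [Module K N]
    (g : A →ₗ[K] M) {h : A →ₗ[K] N} (hf : ∀ v ∈ prim K A, h (v * f) = 0) :
    TensorProduct.map g h (bcross c u (a ⊗ₜ[K] f)) = 0 := by
  refine apply_eq_zero_of_mem_range_lTensor (F := LinearMap.ker h) (fun a f hf => ?_)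
    (bcross_mem_range hA hu a hf)
  rw [TensorProduct.map_tmul, LinearMap.mem_ker.1 hf, TensorProduct.tmul_zero]

theorem prim_mul_mem_filt (hA : IsBraidedBialgebra K c) (hconn : IsConnectedCoalgebra K A)
    {n : ℕ} {u y : A} (hu : u ∈ prim K A) (hy : y ∈ filt K A n) : u * y ∈ filt K A (n + 1) := by
  induction n generalizing u y with
  | zero =>
    rw [show y = 0 from hy, mul_zero]
    exact zero_mem _
  | succ n ih =>
    have hyn : (filt K A (n + 1)).mkQ y = 0 := by
      rwa [Submodule.mkQ_apply, Submodule.Quotient.mk_eq_zero]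
    rw [mem_filt_succ, comul_prim_mul hA hu]
    have h := apply_comul_of_mem_filt_one (L := TensorProduct.map (augProj K A)
      (filt K A (n + 1)).mkQ ∘ₗ ((LinearMap.mulLeft K u).rTensor A + bcross c u)) (n := n) ?_ hy
    · refine h.trans ?_
      rw [LinearMap.comp_apply, LinearMap.add_apply, bcross_one_tmul hA, LinearMap.rTensor_tmul,
        map_add, TensorProduct.map_tmul, TensorProduct.map_tmul, hyn, augProj_one hA,
        TensorProduct.tmul_zero, TensorProduct.zero_tmul, add_zero]
    · intro a f hf
      have hfn : (filt K A (n + 1)).mkQ f = 0 := by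
        rw [Submodule.mkQ_apply, Submodule.Quotient.mk_eq_zero]
        exact filt_mono hA hconn n.le_succ hf
      rw [LinearMap.comp_apply, LinearMap.add_apply, map_add, LinearMap.rTensor_tmul,
        TensorProduct.map_tmul, hfn, TensorProduct.tmul_zero, zero_add]
      refine map_bcross_eq_zero hA hu a _ fun v hv => ?_
      rw [Submodule.mkQ_apply, Submodule.Quotient.mk_eq_zero]
      exact ih hv hf

end Filtration

/-! ### The component of degree `(1, n)` of the comultiplication -/

section Euler

variable {K : Type u} [Field K] {A : Type v} [Ring A] [Algebra K A] [Coalgebra K A]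
  {c : A ⊗[K] A →ₗ[K] A ⊗[K] A}

/-- The product `P ⊗ A → A`. -/
def primMul (K : Type u) [Field K] (A : Type v) [Ring A] [Algebra K A] [Coalgebra K A] :
    prim K A ⊗[K] A →ₗ[K] A :=
  LinearMap.mul' K A ∘ₗ (prim K A).subtype.rTensor A

theorem primMul_tmul (u : prim K A) (a : A) : primMul K A (u ⊗ₜ[K] a) = u * a := rfl

/-- The component `A → P ⊗ A` of the comultiplication. -/
def primComul (hA : IsBraidedBialgebra K c) : A →ₗ[K] prim K A ⊗[K] A :=
  TensorProduct.map (primProj hA) LinearMap.id ∘ₗ Coalgebra.comul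

theorem primComul_mem_range (hA : IsBraidedBialgebra K c) (hconn : IsConnectedCoalgebra K A)
    {n : ℕ} {x : A} (hx : x ∈ filt K A (n + 1)) :
    primComul hA x ∈ LinearMap.range ((filt K A n).subtype.lTensor (prim K A)) := by
  rw [range_lTensor_subtype, LinearMap.mem_ker, primComul, LinearMap.comp_apply,
    ← LinearMap.comp_apply, LinearMap.lTensor_comp_map, LinearMap.comp_id]
  exact map_comul_of_mem_filt hA (j := 0) (filt_one_le_ker_primProj hA hconn)
    (Submodule.ker_mkQ _).ge (by rwa [zero_add, add_comm])

/-- The component of degree `(1, n)` of the comultiplication has its first factor in `P`. -/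
theorem map_subtype_primComul (hA : IsBraidedBialgebra K c) (hconn : IsConnectedCoalgebra K A)
    {n : ℕ} {x : A} (hx : x ∈ filt K A (n + 2)) :
    TensorProduct.map (prim K A).subtype (filt K A n).mkQ (primComul hA x) =
      TensorProduct.map (augProj K A) (filt K A n).mkQ (Coalgebra.comul (R := K) x) := by
  have e : ∀ z, TensorProduct.map (augProj K A) (filt K A n).mkQ z - TensorProduct.map
      ((prim K A).subtype ∘ₗ primProj hA) (filt K A n).mkQ z = TensorProduct.map
      (augProj K A - (prim K A).subtype ∘ₗ primProj hA) (filt K A n).mkQ z := fun z => by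
    induction z using TensorProduct.induction_on with
    | zero => simp
    | add x y hx hy => rw [map_add, map_add, map_add, ← hx, ← hy]; abel
    | tmul a b => simp [TensorProduct.sub_tmul]
  rw [primComul, LinearMap.comp_apply, ← LinearMap.comp_apply, ← TensorProduct.map_comp,
    LinearMap.comp_id, eq_comm, ← sub_eq_zero, e]
  exact map_comul_of_mem_filt hA (j := 1) (filt_two_le_ker hA hconn)
    (Submodule.ker_mkQ _).ge (by rwa [add_comm])

/-- The map `u ⊗ v ⊗ a ↦ (P ⊗ ∇)(𝔠_P(u ⊗ v) ⊗ a)`. -/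
def primCross (hA : IsBraidedBialgebra K c) :
    (prim K A ⊗[K] prim K A) ⊗[K] A →ₗ[K] prim K A ⊗[K] A :=
  (primMul K A).lTensor (prim K A) ∘ₗ (TensorProduct.assoc K _ _ _).toLinearMap ∘ₗ
    (infBraiding hA).rTensor A

theorem rTensor_primCross (hA : IsBraidedBialgebra K c) (u : prim K A) (w : prim K A ⊗[K] A) :
    (prim K A).subtype.rTensor A (primCross hA ((TensorProduct.assoc K _ _ _).symm (u ⊗ₜ[K] w))) =
      bcross c u ((prim K A).subtype.rTensor A w) := by
  induction w using TensorProduct.induction_on with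
  | zero => simp
  | add x y hx hy => simp only [map_add, TensorProduct.tmul_add, hx, hy]
  | tmul v a =>
    have h := primIncl_infBraiding hA (u ⊗ₜ[K] v)
    rw [LinearMap.rTensor_tmul, bcross_tmul]
    change _ = (LinearMap.mul' K A).lTensor A (TensorProduct.assoc K A A A
      (c (primIncl K A (u ⊗ₜ[K] v)) ⊗ₜ[K] a))
    rw [← h, TensorProduct.assoc_symm_tmul, primCross, LinearMap.comp_apply, LinearMap.comp_apply,
      LinearMap.rTensor_tmul]
    generalize infBraiding hA (u ⊗ₜ[K] v) = z
    induction z using TensorProduct.induction_on with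
    | zero => simp
    | add x y hx hy => simp only [map_add, TensorProduct.add_tmul, hx, hy]
    | tmul v' u' => simp [primMul_tmul]

/-- A substitute for `n - 1` that treats `n = 0` as well: there `Fₘ = 0` with `m = 0` is already
stable under multiplication by `P`. -/
theorem exists_filt_pred (hA : IsBraidedBialgebra K c) (hconn : IsConnectedCoalgebra K A)
    (n : ℕ) : ∃ m, n ≤ m + 1 ∧ (∀ f ∈ filt K A m, ∀ u : prim K A, (u : A) * f ∈ filt K A n) ∧
      filt K A m ≤ filt K A n := by
  cases n with
  | zero =>
    refine ⟨0, Nat.zero_le _, fun f hf u => ?_, le_rfl⟩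
    rw [show f = 0 from hf, mul_zero]
    exact zero_mem _
  | succ n => exact ⟨n, le_rfl, fun f hf u => prim_mul_mem_filt hA hconn u.2 hf,
      filt_mono hA hconn n.le_succ⟩

theorem mkQ_eq_zero {M : Type*} [AddCommGroup M] [Module K M] {F : Submodule K M} {x : M}
    (hx : x ∈ F) : F.mkQ x = 0 := (Submodule.Quotient.mk_eq_zero F).2 hx

/-- The component of degree `(1, n - 1)` of `Δ(uy)`, for `u` primitive and `y` of degree `n`. -/
theorem map_comul_prim_mul (hA : IsBraidedBialgebra K c) (hconn : IsConnectedCoalgebra K A)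
    {n : ℕ} (u : prim K A) {y : A} (hy : y ∈ filt K A (n + 1)) :
    TensorProduct.map (augProj K A) (filt K A n).mkQ (Coalgebra.comul (R := K) ((u : A) * y)) =
      TensorProduct.map (prim K A).subtype (filt K A n).mkQ (u ⊗ₜ[K] y +
        primCross hA ((TensorProduct.assoc K _ _ _).symm (u ⊗ₜ[K] primComul hA y))) := by
  obtain ⟨m, hnm, hm, hmn⟩ := exists_filt_pred hA hconn n
  rw [comul_prim_mul hA u.2]
  have h := apply_comul_of_mem_filt_two hA hconn (L := TensorProduct.map (augProj K A)
      (filt K A n).mkQ ∘ₗ ((LinearMap.mulLeft K (u : A)).rTensor A + bcross c u)) (n := m) ?_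
    (filt_mono hA hconn (Nat.succ_le_succ hnm) hy)
  · refine h.trans ?_
    have e₁ : ((prim K A).subtype ∘ₗ primProj hA).rTensor A (Coalgebra.comul (R := K) y) =
        (prim K A).subtype.rTensor A (primComul hA y) := by
      rw [LinearMap.rTensor_comp_apply]; rfl
    have e₂ : TensorProduct.map (augProj K A) (filt K A n).mkQ
        ((LinearMap.mulLeft K (u : A)).rTensor A
          (((prim K A).subtype ∘ₗ primProj hA).rTensor A (Coalgebra.comul (R := K) y))) = 0 := by
      rw [← LinearMap.rTensor_comp_apply, ← LinearMap.comp_apply, LinearMap.map_comp_rTensor]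
      refine map_comul_of_mem_filt hA (j := 0) (k := n) ?_ (Submodule.ker_mkQ _).ge
        (by rwa [zero_add, add_comm])
      intro x hx
      have hx' : primProj hA x = 0 := filt_one_le_ker_primProj hA hconn hx
      simp [hx']
    have e₃ : ∀ w : prim K A ⊗[K] A, TensorProduct.map (augProj K A) (filt K A n).mkQ
        ((prim K A).subtype.rTensor A w) =
        TensorProduct.map (prim K A).subtype (filt K A n).mkQ w := fun w => by
      rw [← LinearMap.comp_apply, LinearMap.map_comp_rTensor]
      congr 2
      ext v
      exact augProj_of_mem_prim hA v.2
    simp only [LinearMap.comp_apply (TensorProduct.map (augProj K A) (filt K A n).mkQ),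
      LinearMap.add_apply, map_add (TensorProduct.map (augProj K A) (filt K A n).mkQ), e₂]
    rw [e₁, ← rTensor_primCross hA, e₃, bcross_one_tmul hA, TensorProduct.map_tmul, augProj_one hA,
      map_add, TensorProduct.map_tmul, LinearMap.rTensor_tmul, TensorProduct.map_tmul,
      LinearMap.mulLeft_apply, mul_one, augProj_of_mem_prim hA u.2]
    simp
  · intro a f hf
    rw [LinearMap.comp_apply, LinearMap.add_apply, map_add, LinearMap.rTensor_tmul,
      TensorProduct.map_tmul, mkQ_eq_zero (hmn hf), TensorProduct.tmul_zero, zero_add]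
    exact map_bcross_eq_zero hA u.2 a _ fun v hv => mkQ_eq_zero (hm f hf ⟨v, hv⟩)

/-! ### Consequences of cocommutativity -/

theorem map_primProj_comul (hA : IsBraidedBialgebra K c) (hconn : IsConnectedCoalgebra K A)
    (x : corad K A 2) : TensorProduct.map (primProj hA) (primProj hA)
      (Coalgebra.comul (R := K) (x : A)) = infComulPrim hA hconn (Submodule.Quotient.mk x) := by
  obtain ⟨p, hp⟩ := exists_eq_comp_of_ker_le (corad K A 0).mkQ (primProj hA) (by
    rw [Submodule.ker_mkQ, ← filt_succ_eq_corad hA hconn]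
    exact filt_one_le_ker_primProj hA hconn)
  have h : p ∘ₗ grOneIncl K A = (primEquivGr hA hconn).symm.toLinearMap := by
    refine LinearMap.ext fun y => ?_
    obtain ⟨u, rfl⟩ := (primEquivGr hA hconn).surjective y
    rw [LinearEquiv.coe_coe, LinearEquiv.symm_apply_apply]
    refine Eq.trans ?_ (primProj_coe hA u)
    rw [hp]
    rfl
  rw [infComulPrim, LinearMap.comp_apply, ← h, TensorProduct.map_comp, LinearMap.comp_apply,
    infComul_spec, hp, TensorProduct.map_comp, LinearMap.comp_apply]

theorem infBraiding_map_primProj_comul (hA : IsBraidedBialgebra K c)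
    (hconn : IsConnectedCoalgebra K A) {q : K} (hcoc : IsInfCocommutative hA hconn q) {x : A}
    (hx : x ∈ filt K A 3) :
    infBraiding hA (TensorProduct.map (primProj hA) (primProj hA) (Coalgebra.comul (R := K) x)) =
      q • TensorProduct.map (primProj hA) (primProj hA) (Coalgebra.comul (R := K) x) := by
  rw [filt_succ_eq_corad hA hconn] at hx
  rw [map_primProj_comul hA hconn ⟨x, hx⟩]
  exact LinearMap.congr_fun hcoc _

theorem prim_le_filt_two (hA : IsBraidedBialgebra K c) (hconn : IsConnectedCoalgebra K A) :
    prim K A ≤ filt K A 2 := by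
  rw [filt_succ_eq_corad hA hconn]
  exact prim_le_corad_one hA hconn

/-- `Δ(uw) = uw ⊗ 1 + 1 ⊗ uw + (1 + 𝔠)(u ⊗ w)` for primitive `u` and `w`. -/
theorem comul_mul_primIncl (hA : IsBraidedBialgebra K c) (z : prim K A ⊗[K] prim K A) :
    Coalgebra.comul (R := K) (LinearMap.mul' K A (primIncl K A z)) =
      LinearMap.mul' K A (primIncl K A z) ⊗ₜ[K] 1 + 1 ⊗ₜ[K] LinearMap.mul' K A (primIncl K A z) +
        primIncl K A (z + infBraiding hA z) := by
  rw [map_add, primIncl_infBraiding]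
  induction z using TensorProduct.induction_on with
  | zero => simp
  | add x y hx hy =>
    simp only [map_add, hx, hy, TensorProduct.add_tmul, TensorProduct.tmul_add]
    abel
  | tmul u w =>
    have e : ∀ z, (LinearMap.mul' K A).lTensor A (TensorProduct.assoc K A A A (z ⊗ₜ[K] 1)) = z :=
      fun z => by
        induction z using TensorProduct.induction_on with
        | zero => simp
        | add x y hx hy => simp only [map_add, TensorProduct.add_tmul, hx, hy]
        | tmul a b => simp
    rw [TensorProduct.map_tmul, LinearMap.mul'_apply, Submodule.subtype_apply,
      Submodule.subtype_apply, comul_prim_mul hA u.2, mem_prim_iff.1 w.2, map_add, map_add,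
      bcross_one_tmul hA, bcross_tmul, e]
    simp only [LinearMap.rTensor_tmul, LinearMap.mulLeft_apply, mul_one]
    abel

theorem isHecke_of_forall {V : Type*} [AddCommGroup V] [Module K V] {b : V ⊗[K] V →ₗ[K] V ⊗[K] V}
    {q : K} (h : ∀ z, b (z + b z) = q • (z + b z)) : IsHecke b q := by
  refine LinearMap.ext fun z => ?_
  have h := h z
  simp only [LinearMap.comp_apply, LinearMap.add_apply, LinearMap.sub_apply, LinearMap.id_apply,
    LinearMap.smul_apply, map_sub, map_smul, LinearMap.zero_apply, map_add] at h ⊢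
  linear_combination (norm := module) h

theorem map_primProj_primIncl (hA : IsBraidedBialgebra K c) (z : prim K A ⊗[K] prim K A) :
    TensorProduct.map (primProj hA) (primProj hA) (primIncl K A z) = z := by
  rw [← LinearMap.comp_apply, ← TensorProduct.map_comp,
    show primProj hA ∘ₗ (prim K A).subtype = LinearMap.id from
      LinearMap.ext (primProj_coe hA), TensorProduct.map_id, LinearMap.id_apply]

theorem mul_primIncl_mem_filt (hA : IsBraidedBialgebra K c) (hconn : IsConnectedCoalgebra K A)
    (z : prim K A ⊗[K] prim K A) : LinearMap.mul' K A (primIncl K A z) ∈ filt K A 3 := by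
  induction z using TensorProduct.induction_on with
  | zero => simp
  | add x y hx hy => simp only [map_add]; exact add_mem hx hy
  | tmul u w => exact prim_mul_mem_filt hA hconn u.2 (prim_le_filt_two hA hconn w.2)

/-- The `P ⊗ P`-component of the comultiplication of a product `uw` of primitive elements is
`u ⊗ w + 𝔠_P(u ⊗ w)`, so that cocommutativity yields the Hecke relation. -/
theorem isHecke_of_isInfCocommutative (hA : IsBraidedBialgebra K c)
    (hconn : IsConnectedCoalgebra K A) {q : K} (hcoc : IsInfCocommutative hA hconn q) :
    IsHecke (infBraiding hA) q := by
  refine isHecke_of_forall fun z => ?_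
  have h := infBraiding_map_primProj_comul hA hconn hcoc (mul_primIncl_mem_filt hA hconn z)
  rw [comul_mul_primIncl hA, map_add (TensorProduct.map _ _), map_add (TensorProduct.map _ _),
    TensorProduct.map_tmul, TensorProduct.map_tmul, primProj_one, TensorProduct.tmul_zero,
    TensorProduct.zero_tmul, zero_add, zero_add,
    map_primProj_primIncl hA] at h
  exact h

/-- An identity `f g = q g` that holds on `F₃` holds in the left tensor factor of `Δ(x)` for
`x ∈ Fₙ₊₃`, up to terms in `Q ⊗ Fₙ`. -/
theorem apply_rTensor_map_comul (hA : IsBraidedBialgebra K c) {n : ℕ} {N Q : Type*}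
    [AddCommGroup N] [Module K N] [AddCommMonoid Q] [Module K Q] (f : Q →ₗ[K] Q) (q : K)
    (g : A →ₗ[K] Q) (hfg : ∀ x ∈ filt K A 3, f (g x) = q • g x) {L : Q ⊗[K] A →ₗ[K] N}
    (hL : ∀ a, ∀ f ∈ filt K A n, L (a ⊗ₜ[K] f) = 0) {x : A} (hx : x ∈ filt K A (n + 3)) :
    L (f.rTensor A (TensorProduct.map g LinearMap.id (Coalgebra.comul (R := K) x))) =
      q • L (TensorProduct.map g LinearMap.id (Coalgebra.comul (R := K) x)) := by
  let : AddCommGroup Q := Module.addCommMonoidToAddCommGroup K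
  rw [← sub_eq_zero, ← map_smul, ← map_sub]
  have e : ∀ w, f.rTensor A w - q • w = (f - q • LinearMap.id).rTensor A w := fun w => by
    rw [LinearMap.rTensor_sub, LinearMap.rTensor_smul, LinearMap.rTensor_id]; rfl
  rw [e]
  refine apply_eq_zero_of_mem_range_lTensor hL ?_
  rw [range_lTensor_subtype, LinearMap.mem_ker, ← LinearMap.comp_apply, ← LinearMap.comp_apply,
    LinearMap.lTensor_comp_rTensor, ← TensorProduct.map_comp, LinearMap.comp_id]
  refine map_comul_of_mem_filt hA (j := 2) (k := n) (fun x hx => ?_)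
    (Submodule.ker_mkQ _).ge (by rwa [add_comm])
  rw [LinearMap.mem_ker, LinearMap.comp_apply, LinearMap.sub_apply, hfg x hx]
  exact sub_self _

/-- On elements of the coradical filtration the two `P`-components of the comultiplication are
`q`-symmetric, up to terms of lower degree. -/
theorem apply_primComul_primComul (hA : IsBraidedBialgebra K c) (hconn : IsConnectedCoalgebra K A)
    {q : K} (hcoc : IsInfCocommutative hA hconn q) {n : ℕ} {N : Type*} [AddCommGroup N]
    [Module K N] {L : (prim K A ⊗[K] prim K A) ⊗[K] A →ₗ[K] N}
    (hL : ∀ a, ∀ f ∈ filt K A n, L (a ⊗ₜ[K] f) = 0) {x : A} (hx : x ∈ filt K A (n + 3)) :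
    L ((infBraiding hA).rTensor A ((TensorProduct.assoc K _ _ _).symm
      ((primComul hA).lTensor _ (primComul hA x)))) =
    q • L ((TensorProduct.assoc K _ _ _).symm ((primComul hA).lTensor _ (primComul hA x))) := by
  have e : (TensorProduct.assoc K _ _ _).symm ((primComul hA).lTensor _ (primComul hA x)) =
      TensorProduct.map (TensorProduct.map (primProj hA) (primProj hA) ∘ₗ Coalgebra.comul)
        LinearMap.id (Coalgebra.comul (R := K) x) := by
    rw [map_map_comp_comul, primComul, LinearMap.comp_apply, ← LinearMap.comp_apply,
      LinearMap.lTensor_comp_map, LinearMap.comp_id]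
  rw [e]
  exact apply_rTensor_map_comul hA _ q _
    (fun x hx => infBraiding_map_primProj_comul hA hconn hcoc hx) hL hx

/-- The Euler identity: on the component of degree `n` of the associated graded coalgebra,
`∇Δ^{1,n-1}` is multiplication by `1 + q + ⋯ + q ^ (n - 1)`. -/
theorem primMul_primComul_sub_mem (hA : IsBraidedBialgebra K c) (hconn : IsConnectedCoalgebra K A)
    {q : K} (hcoc : IsInfCocommutative hA hconn q) {n : ℕ} {x : A} (hx : x ∈ filt K A (n + 1)) :
    primMul K A (primComul hA x) - (∑ i ∈ Finset.range n, q ^ i) • x ∈ filt K A n := by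
  induction n generalizing x with
  | zero =>
    obtain ⟨r, rfl⟩ := (mem_filt_one hA hconn).1 hx
    simp [primComul, hA.comul_one, primProj_one]
  | succ n ih =>
    have hD := primComul_mem_range hA hconn hx
    obtain ⟨m, hnm, hm, -⟩ := exists_filt_pred hA hconn n
    -- the component of degree `(1, n)` of `Δ` on products with primitive elements
    have h₁ : ∀ z ∈ LinearMap.range ((filt K A (n + 1)).subtype.lTensor (prim K A)),
        TensorProduct.map (augProj K A) (filt K A n).mkQ
          (Coalgebra.comul (R := K) (primMul K A z)) =
        TensorProduct.map (prim K A).subtype (filt K A n).mkQ (z + primCross hA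
          ((TensorProduct.assoc K _ _ _).symm ((primComul hA).lTensor _ z))) := by
      rintro _ ⟨z, rfl⟩
      induction z using TensorProduct.induction_on with
      | zero => simp
      | add x y hx hy =>
        simp only [map_add] at hx hy ⊢
        rw [hx, hy]
        abel
      | tmul u y => exact map_comul_prim_mul hA hconn u y.2
    -- cocommutativity replaces the braiding by the scalar `q`
    have h₂ := apply_primComul_primComul hA hconn hcoc (n := m) (x := x)
      (L := TensorProduct.map (prim K A).subtype (filt K A n).mkQ ∘ₗ
        (primMul K A).lTensor (prim K A) ∘ₗ (TensorProduct.assoc K _ _ _).toLinearMap)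
      (fun a f hf => by
        induction a using TensorProduct.induction_on with
        | zero => simp
        | add x y hx hy => rw [TensorProduct.add_tmul, map_add, hx, hy, add_zero]
        | tmul u v =>
          simp only [LinearMap.comp_apply, LinearEquiv.coe_coe, TensorProduct.assoc_tmul,
            LinearMap.lTensor_tmul, primMul_tmul, TensorProduct.map_tmul,
            mkQ_eq_zero (hm f hf v), TensorProduct.tmul_zero])
      (filt_mono hA hconn (by omega) hx)
    -- the induction hypothesis on the second tensor factor
    have h₃ : TensorProduct.map (prim K A).subtype (filt K A n).mkQ
        ((primMul K A ∘ₗ primComul hA).lTensor _ (primComul hA x)) =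
        (∑ i ∈ Finset.range n, q ^ i) •
          TensorProduct.map (prim K A).subtype (filt K A n).mkQ (primComul hA x) := by
      obtain ⟨z, hz⟩ := hD
      rw [← hz]
      clear hz
      induction z using TensorProduct.induction_on with
      | zero => simp
      | add x y hx hy => simp only [map_add, hx, hy, smul_add]
      | tmul u y =>
        have h := mkQ_eq_zero (ih y.2)
        rw [map_sub, sub_eq_zero] at h
        rw [LinearMap.lTensor_tmul, LinearMap.lTensor_tmul, TensorProduct.map_tmul,
          TensorProduct.map_tmul, LinearMap.comp_apply]
        rw [Submodule.subtype_apply, Submodule.subtype_apply, h, map_smul, TensorProduct.tmul_smul]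
    rw [mem_filt_succ, map_sub, map_sub, h₁ _ hD, map_add, map_smul, map_smul,
      ← map_subtype_primComul hA hconn hx]
    have h₄ : TensorProduct.map (prim K A).subtype (filt K A n).mkQ (primCross hA
        ((TensorProduct.assoc K _ _ _).symm ((primComul hA).lTensor _ (primComul hA x)))) =
        q • TensorProduct.map (prim K A).subtype (filt K A n).mkQ
          ((primMul K A ∘ₗ primComul hA).lTensor _ (primComul hA x)) := by
      refine h₂.trans ?_
      rw [LinearMap.comp_apply, LinearMap.comp_apply, LinearEquiv.coe_coe,
        LinearEquiv.apply_symm_apply, ← LinearMap.lTensor_comp_apply]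
    rw [h₄, h₃, geom_sum_succ]
    module

/-- A connected braided bialgebra with `q`-cocommutative infinitesimal comultiplication is generated
by its primitive elements. -/
theorem eq_top_of_prim_mul_mem (hA : IsBraidedBialgebra K c) (hconn : IsConnectedCoalgebra K A)
    {q : K} (hq : IsRegularMark q) (hcoc : IsInfCocommutative hA hconn q) (B : Submodule K A)
    (h1 : 1 ∈ B) (hB : ∀ u ∈ prim K A, ∀ b ∈ B, u * b ∈ B) : B = ⊤ := by
  have key : ∀ n, filt K A (n + 1) ≤ B := by
    intro n
    induction n with
    | zero =>
      intro x hx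
      obtain ⟨r, rfl⟩ := (mem_filt_one hA hconn).1 hx
      exact B.smul_mem r h1
    | succ n ih =>
      intro x hx
      have h₁ : primMul K A (primComul hA x) ∈ B := by
        obtain ⟨z, hz⟩ := primComul_mem_range hA hconn hx
        rw [← hz]
        clear hz
        induction z using TensorProduct.induction_on with
        | zero => simp
        | add x y hx hy => simp only [map_add]; exact add_mem hx hy
        | tmul u y => exact hB u u.2 y (ih y.2)
      have h₂ := sub_mem h₁ (ih (primMul_primComul_sub_mem hA hconn hcoc hx))
      rw [sub_sub_cancel] at h₂
      exact (B.smul_mem_iff (hq.2 (n + 1) n.succ_pos)).1 h₂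
  refine Submodule.eq_top_iff'.2 fun x => ?_
  obtain ⟨n, hn⟩ := exists_filt hA hconn x
  exact key n hn

end Euler

/-! ### The relations of the braided symmetric algebra -/

section Relations

theorem map_left_natural {K : Type*} [Field K] {V W : Type*} [AddCommGroup V] [Module K V]
    [AddCommGroup W] [Module K W] {b : V ⊗[K] V →ₗ[K] V ⊗[K] V} {c : W ⊗[K] W →ₗ[K] W ⊗[K] W}
    {i : V →ₗ[K] W} (h : ∀ z, TensorProduct.map i i (b z) = c (TensorProduct.map i i z))
    (z : (V ⊗[K] V) ⊗[K] V) : TensorProduct.map (TensorProduct.map i i) i (left b z) =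
      left c (TensorProduct.map (TensorProduct.map i i) i z) := by
  induction z using TensorProduct.induction_on with
  | zero => simp
  | add u v hu hv => simp only [map_add, hu, hv]
  | tmul u x => simp only [left, LinearMap.rTensor_tmul, TensorProduct.map_tmul, h]

theorem map_right_natural {K : Type*} [Field K] {V W : Type*} [AddCommGroup V] [Module K V]
    [AddCommGroup W] [Module K W] {b : V ⊗[K] V →ₗ[K] V ⊗[K] V} {c : W ⊗[K] W →ₗ[K] W ⊗[K] W}
    {i : V →ₗ[K] W} (h : ∀ z, TensorProduct.map i i (b z) = c (TensorProduct.map i i z))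
    (z : (V ⊗[K] V) ⊗[K] V) : TensorProduct.map (TensorProduct.map i i) i (right b z) =
      right c (TensorProduct.map (TensorProduct.map i i) i z) := by
  have e : ∀ z : V ⊗[K] (V ⊗[K] V), TensorProduct.map (TensorProduct.map i i) i
      ((TensorProduct.assoc K V V V).symm z) = (TensorProduct.assoc K W W W).symm
        (TensorProduct.map i (TensorProduct.map i i) z) := fun z => by
    rw [LinearEquiv.eq_symm_apply, ← TensorProduct.map_map_assoc, LinearEquiv.apply_symm_apply]
  obtain ⟨z, rfl⟩ := (TensorProduct.assoc K V V V).symm.surjective z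
  simp only [right, LinearMap.comp_apply, LinearEquiv.coe_coe, LinearEquiv.apply_symm_apply, e]
  congr 1
  induction z using TensorProduct.induction_on with
  | zero => simp
  | add u v hu hv => simp only [map_add, hu, hv]
  | tmul u x => simp only [LinearMap.lTensor_tmul, TensorProduct.map_tmul, h]

/-- The deformed product `∇(𝔠 - q)`. -/
def mulDefect (K : Type*) [Field K] {A : Type*} [Ring A] [Algebra K A]
    (c : A ⊗[K] A →ₗ[K] A ⊗[K] A) (q : K) : A ⊗[K] A →ₗ[K] A :=
  LinearMap.mul' K A ∘ₗ (c - q • LinearMap.id)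

section BraidedAlgebra

variable {K : Type*} [Field K] {A : Type*} [Ring A] [Algebra K A]
  {c : A ⊗[K] A →ₗ[K] A ⊗[K] A}

theorem rTensor_mulDefect (q : K) (z : (A ⊗[K] A) ⊗[K] A) : (mulDefect K c q).rTensor A z =
    (LinearMap.mul' K A).rTensor A (left c z - q • z) := by
  rw [mulDefect, LinearMap.rTensor_comp_apply, LinearMap.rTensor_sub, LinearMap.rTensor_smul,
    LinearMap.rTensor_id]
  rfl

theorem rightBracket_mulDefect (q : K) (z : (A ⊗[K] A) ⊗[K] A) :
    rightBracket (mulDefect K c q) z =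
      (LinearMap.mul' K A).lTensor A (TensorProduct.assoc K A A A (right c z - q • z)) := by
  rw [rightBracket, mulDefect, LinearMap.comp_apply, LinearMap.lTensor_comp_apply,
    LinearMap.lTensor_sub, LinearMap.lTensor_smul, LinearMap.lTensor_id]
  simp [right]

theorem braiding_mulDefect_left (hA : IsBraidedAlgebra K c) (q : K) (z : (A ⊗[K] A) ⊗[K] A) :
    c ((mulDefect K c q).rTensor A z) =
      rightBracket (mulDefect K c q) (left c (right c z)) := by
  have h := LinearMap.congr_fun hA.mul_left
  have hb := LinearMap.congr_fun hA.braid z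
  simp only [LinearMap.comp_apply, LinearEquiv.coe_coe] at h hb
  rw [rTensor_mulDefect, rightBracket_mulDefect, h, map_sub (right c), map_smul (right c),
    map_sub (left c), map_smul (left c), hb]

theorem braiding_mulDefect_right (hA : IsBraidedAlgebra K c) (q : K) (z : (A ⊗[K] A) ⊗[K] A) :
    c (rightBracket (mulDefect K c q) z) =
      (mulDefect K c q).rTensor A (right c (left c z)) := by
  have h := LinearMap.congr_fun hA.mul_right
  have hb := LinearMap.congr_fun hA.braid z
  simp only [LinearMap.comp_apply, LinearEquiv.coe_coe] at h hb
  rw [rTensor_mulDefect, rightBracket_mulDefect, h, map_sub (left c), map_smul (left c),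
    map_sub (right c), map_smul (right c), hb]

end BraidedAlgebra

variable {K : Type u} [Field K] {A : Type v} [Ring A] [Algebra K A] [Coalgebra K A]
  {c : A ⊗[K] A →ₗ[K] A ⊗[K] A}

theorem mul_primIncl_mem_prim (hA : IsBraidedBialgebra K c) {w : prim K A ⊗[K] prim K A}
    (hw : w + infBraiding hA w = 0) : LinearMap.mul' K A (primIncl K A w) ∈ prim K A := by
  rw [mem_prim_iff, comul_mul_primIncl hA, hw, map_zero, add_zero]

theorem IsHecke.sub_add_apply_sub {V : Type*} [AddCommGroup V] [Module K V]
    {b : V ⊗[K] V →ₗ[K] V ⊗[K] V} {q : K} (hH : IsHecke b q) (z : V ⊗[K] V) :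
    (b z + (-q) • z) + b (b z + (-q) • z) = 0 := by
  rw [map_add, map_smul, hH.apply_apply]
  module

theorem mulDefect_primIncl (hA : IsBraidedBialgebra K c) (q : K) (z : prim K A ⊗[K] prim K A) :
    mulDefect K c q (primIncl K A z) =
      LinearMap.mul' K A (primIncl K A (infBraiding hA z + (-q) • z)) := by
  rw [mulDefect, map_add, map_smul, primIncl_infBraiding, LinearMap.comp_apply,
    LinearMap.sub_apply, LinearMap.smul_apply, LinearMap.id_apply, neg_smul, sub_eq_add_neg]

theorem mulDefect_primIncl_mem_prim (hA : IsBraidedBialgebra K c) {q : K}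
    (hH : IsHecke (infBraiding hA) q) (z : prim K A ⊗[K] prim K A) :
    mulDefect K c q (primIncl K A z) ∈ prim K A := by
  rw [mulDefect_primIncl hA]
  exact mul_primIncl_mem_prim hA (hH.sub_add_apply_sub z)

/-- The products of primitive elements satisfy the relations of the braided symmetric algebra: the
defect is a braided bracket on `P`, hence zero. -/
theorem mulDefect_primIncl_eq_zero (hK : (2 : K) ≠ 0) (hA : IsBraidedBialgebra K c) {q : K}
    (hq : IsRegularMark q) (hq1 : q ≠ 1) (hH : IsHecke (infBraiding hA) q)
    (z : prim K A ⊗[K] prim K A) : mulDefect K c q (primIncl K A z) = 0 := by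
  let b : prim K A ⊗[K] prim K A →ₗ[K] prim K A :=
    LinearMap.codRestrict _ (mulDefect K c q ∘ₗ primIncl K A) (mulDefect_primIncl_mem_prim hA hH)
  have hb : ∀ z, (b z : A) = mulDefect K c q (primIncl K A z) := fun z => rfl
  have hn : ∀ z, primIncl K A (infBraiding hA z) = c (primIncl K A z) := primIncl_infBraiding hA
  have hJl := map_left_natural hn
  have hJr := map_right_natural hn
  have e₁ : ∀ z, primIncl K A (b.rTensor _ z) = (mulDefect K c q).rTensor A
      (TensorProduct.map (primIncl K A) (prim K A).subtype z) := fun z => by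
    rw [← LinearMap.comp_apply, ← LinearMap.comp_apply, LinearMap.map_comp_rTensor,
      LinearMap.rTensor_comp_map]
    rfl
  have e₂ : ∀ z, primIncl K A (rightBracket b z) = rightBracket (mulDefect K c q)
      (TensorProduct.map (primIncl K A) (prim K A).subtype z) := fun z => by
    rw [rightBracket, rightBracket, LinearMap.comp_apply, LinearMap.comp_apply,
      LinearEquiv.coe_coe, LinearEquiv.coe_coe, ← TensorProduct.map_map_assoc,
      ← LinearMap.comp_apply, ← LinearMap.comp_apply, LinearMap.map_comp_lTensor,
      LinearMap.lTensor_comp_map]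
    rfl
  have key : b = 0 := by
    refine bracket_eq_zero hK (infBraiding_isBraiding hA) hH hq.1 hq1 ?_ ?_ ?_ ?_
    · have := hq.2 3 (by norm_num)
      simpa [Finset.sum_range_succ] using this
    · refine LinearMap.ext fun z => Subtype.ext ?_
      have h : infBraiding hA (infBraiding hA z) + (-q) • infBraiding hA z =
          (-1 : K) • (infBraiding hA z + (-q) • z) := by
        rw [hH.apply_apply]
        module
      rw [LinearMap.comp_apply, LinearMap.neg_apply, Submodule.coe_neg, hb, hb,
        mulDefect_primIncl hA, mulDefect_primIncl hA, h, map_smul, map_smul, neg_one_smul]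
    · intro z
      apply primIncl_injective
      rw [hn, e₁, e₂, hJl, hJr, braiding_mulDefect_left hA.alg]
    · intro z
      apply primIncl_injective
      rw [hn, e₁, e₂, hJr, hJl, braiding_mulDefect_right hA.alg]
  rw [← hb, key]
  rfl

end Relations

/-! ### The map from the tensor algebra of the primitive elements -/

section PrimLift

variable {K : Type u} [Field K] {A : Type v} [Ring A] [Algebra K A] [Coalgebra K A]
  {c : A ⊗[K] A →ₗ[K] A ⊗[K] A}

/-- The algebra map `T(P) → A` that extends the inclusion of the primitive elements. -/
def primLift (K : Type u) [Field K] (A : Type v) [Ring A] [Algebra K A] [Coalgebra K A] :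
    TensorAlgebra K (prim K A) →ₐ[K] A :=
  TensorAlgebra.lift K (prim K A).subtype

theorem primLift_ι (u : prim K A) : primLift K A (TensorAlgebra.ι K u) = u :=
  TensorAlgebra.lift_ι_apply _ _

/-- A property of `1` that is stable under linear combinations and under left multiplication by
generators holds on the whole tensor algebra. -/
theorem tensorAlgebra_left_induction {V : Type*} [AddCommGroup V] [Module K V]
    {p : TensorAlgebra K V → Prop} (one : p 1) (smul : ∀ (r : K) x, p x → p (r • x))
    (add : ∀ x y, p x → p y → p (x + y)) (ι_mul : ∀ v x, p x → p (TensorAlgebra.ι K v * x))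
    (x : TensorAlgebra K V) : p x := by
  suffices h : ∀ x y : TensorAlgebra K V, p y → p (x * y) by
    simpa using h x 1 one
  intro x
  induction x using TensorAlgebra.induction with
  | algebraMap r =>
    intro y hy
    rw [← Algebra.smul_def]
    exact smul r y hy
  | ι v => exact fun y hy => ι_mul v y hy
  | mul a b ha hb =>
    intro y hy
    rw [mul_assoc]
    exact ha _ (hb _ hy)
  | add a b ha hb =>
    intro y hy
    rw [add_mul]
    exact add _ _ (ha _ hy) (hb _ hy)

/-- The map `T(P) → A` carries the braiding `P ⊗ T(P) → T(P) ⊗ P` to the braiding of `A`. -/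
theorem map_slide (hA : IsBraidedBialgebra K c) (t : TensorAlgebra K (prim K A)) (v : prim K A) :
    TensorProduct.map (primLift K A).toLinearMap (prim K A).subtype (slide (infBraiding hA) t v) =
      c ((v : A) ⊗ₜ[K] primLift K A t) := by
  induction t using tensorAlgebra_left_induction generalizing v with
  | one => rw [slide_one, map_one, hA.alg.one_right]; simp
  | smul r x hx => simp only [map_smul, LinearMap.smul_apply, TensorProduct.tmul_smul, hx]
  | add x y hx hy => simp only [map_add, LinearMap.add_apply, TensorProduct.tmul_add, hx, hy]
  | ι_mul w x hx =>
    have h := LinearMap.congr_fun hA.alg.mul_right (((v : A) ⊗ₜ[K] (w : A)) ⊗ₜ[K] primLift K A x)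
    simp only [LinearMap.comp_apply, LinearEquiv.coe_coe, TensorProduct.assoc_tmul,
      LinearMap.lTensor_tmul, LinearMap.mul'_apply, left, LinearMap.rTensor_tmul] at h
    rw [map_mul (primLift K A), primLift_ι, h, slide_ι_mul, slideAct_apply,
      show (v : A) ⊗ₜ[K] (w : A) = primIncl K A (v ⊗ₜ[K] w) from rfl, ← primIncl_infBraiding hA]
    generalize infBraiding hA (v ⊗ₜ[K] w) = z
    induction z using TensorProduct.induction_on with
    | zero => simp
    | add x y hx hy => simp only [map_add, TensorProduct.add_tmul, hx, hy]
    | tmul w' v' =>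
      rw [LinearMap.lTensor_tmul, TensorProduct.lift.tmul, TensorProduct.map_tmul, right,
        LinearMap.comp_apply, LinearMap.comp_apply, LinearEquiv.coe_coe, LinearEquiv.coe_coe,
        TensorProduct.assoc_tmul, LinearMap.lTensor_tmul, Submodule.subtype_apply,
        Submodule.subtype_apply, ← hx]
      generalize slide (infBraiding hA) x v' = z
      induction z using TensorProduct.induction_on with
      | zero => simp
      | add x y hx hy => simp only [map_add, TensorProduct.tmul_add, hx, hy]
      | tmul t u => simp [genMul_tmul, primLift_ι]

/-- `φ ⊗ φ` for the canonical map `φ : T(P) → A`. -/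
abbrev primLift₂ (K : Type u) [Field K] (A : Type v) [Ring A] [Algebra K A] [Coalgebra K A] :
    TensorAlgebra K (prim K A) ⊗[K] TensorAlgebra K (prim K A) →ₗ[K] A ⊗[K] A :=
  TensorProduct.map (primLift K A).toLinearMap (primLift K A).toLinearMap

theorem primLift₂_crossAct (hA : IsBraidedBialgebra K c) (v : prim K A)
    (y : TensorAlgebra K (prim K A) ⊗[K] TensorAlgebra K (prim K A)) :
    primLift₂ K A (crossAct (infBraiding hA) v y) = bcross c v (primLift₂ K A y) := by
  induction y using TensorProduct.induction_on with
  | zero => simp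
  | add x y hx hy => simp only [map_add, hx, hy]
  | tmul a b =>
    rw [crossAct_tmul, TensorProduct.map_tmul, bcross_tmul, AlgHom.toLinearMap_apply,
      AlgHom.toLinearMap_apply, ← map_slide hA]
    generalize slide (infBraiding hA) a v = z
    induction z using TensorProduct.induction_on with
    | zero => simp
    | add x y hx hy => simp only [map_add, TensorProduct.add_tmul, hx, hy]
    | tmul t u => simp [absorb_tmul, primLift_ι]

theorem bcross_one (hA : IsBraidedBialgebra K c) (y : A ⊗[K] A) : bcross c 1 y = y := by
  induction y using TensorProduct.induction_on with
  | zero => simp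
  | add x y hx hy => simp only [map_add, hx, hy]
  | tmul a b => simp [bcross_tmul, hA.alg.one_left]

theorem bcross_mul (hA : IsBraidedBialgebra K c) (s t : A) (y : A ⊗[K] A) :
    bcross c (s * t) y = bcross c s (bcross c t y) := by
  induction y using TensorProduct.induction_on with
  | zero => simp
  | add x y hx hy => simp only [map_add, hx, hy]
  | tmul a b =>
    have h := LinearMap.congr_fun hA.alg.mul_left ((s ⊗ₜ[K] t) ⊗ₜ[K] a)
    simp only [LinearMap.comp_apply, LinearEquiv.coe_coe, LinearMap.rTensor_tmul,
      LinearMap.mul'_apply, right, TensorProduct.assoc_tmul, LinearMap.lTensor_tmul] at h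
    rw [bcross_tmul, h, bcross_tmul]
    generalize c (t ⊗ₜ[K] a) = z
    induction z using TensorProduct.induction_on with
    | zero => simp
    | add x y hx hy => simp only [map_add, TensorProduct.add_tmul, TensorProduct.tmul_add, hx, hy]
    | tmul a' t' =>
      simp only [TensorProduct.assoc_symm_tmul, left, LinearMap.rTensor_tmul,
        TensorProduct.assoc_tmul, LinearMap.lTensor_tmul, LinearMap.mul'_apply, bcross_tmul]
      generalize c (s ⊗ₜ[K] a') = z
      induction z using TensorProduct.induction_on with
      | zero => simp
      | add x y hx hy => simp only [map_add, TensorProduct.add_tmul, hx, hy]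
      | tmul a'' s' => simp [mul_assoc]

theorem primLift₂_lift_crossAct (hA : IsBraidedBialgebra K c) (x : TensorAlgebra K (prim K A))
    (y : TensorAlgebra K (prim K A) ⊗[K] TensorAlgebra K (prim K A)) :
    primLift₂ K A (TensorAlgebra.lift K (crossAct (infBraiding hA)) x y) =
      bcross c (primLift K A x) (primLift₂ K A y) := by
  induction x using tensorAlgebra_left_induction with
  | one => rw [map_one, map_one, bcross_one hA, Module.End.one_apply]
  | smul r x hx => simp only [map_smul, LinearMap.smul_apply, hx]
  | add x y hx hy => simp only [map_add, LinearMap.add_apply, hx, hy]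
  | ι_mul v x hx =>
    rw [map_mul, map_mul, bcross_mul hA, ← hx, primLift_ι, TensorAlgebra.lift_ι_apply,
      Module.End.mul_apply, primLift₂_crossAct]

theorem primLift₂_tensorBraiding (hA : IsBraidedBialgebra K c)
    (y : TensorAlgebra K (prim K A) ⊗[K] TensorAlgebra K (prim K A)) :
    primLift₂ K A (tensorBraiding (infBraiding hA) y) = c (primLift₂ K A y) := by
  induction y using TensorProduct.induction_on with
  | zero => simp
  | add x y hx hy => simp only [map_add, hx, hy]
  | tmul x a =>
    rw [tensorBraiding_tmul, primLift₂_lift_crossAct, TensorProduct.map_tmul, bcross_tmul,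
      TensorProduct.map_tmul, AlgHom.toLinearMap_apply, AlgHom.toLinearMap_apply,
      AlgHom.toLinearMap_apply, map_one]
    generalize c (primLift K A x ⊗ₜ[K] primLift K A a) = z
    induction z using TensorProduct.induction_on with
    | zero => simp
    | add x y hx hy => simp only [map_add, TensorProduct.add_tmul, hx, hy]
    | tmul a b => simp

theorem primLift₂_tensorComul (hA : IsBraidedBialgebra K c) (x : TensorAlgebra K (prim K A)) :
    primLift₂ K A (tensorComul (infBraiding hA) x) =
      Coalgebra.comul (R := K) (primLift K A x) := by
  induction x using tensorAlgebra_left_induction with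
  | one => simp [tensorComul, hA.comul_one]
  | smul r x hx => simp only [map_smul, hx]
  | add x y hx hy => simp only [map_add, hx, hy]
  | ι_mul v x hx =>
    have e : tensorComul (infBraiding hA) (TensorAlgebra.ι K v * x) =
        comulAct (infBraiding hA) v (tensorComul (infBraiding hA) x) := by
      simp [tensorComul]
    have e' : ∀ y, primLift₂ K A (genMul K _ _ v y) =
        (LinearMap.mulLeft K (v : A)).rTensor A (primLift₂ K A y) := fun y => by
      induction y using TensorProduct.induction_on with
      | zero => simp
      | add x y hx hy => simp only [map_add, hx, hy]
      | tmul a b => simp [genMul_tmul, primLift_ι]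
    rw [map_mul (primLift K A), primLift_ι, comul_prim_mul hA v.2, ← hx, e, comulAct,
      LinearMap.add_apply, LinearMap.add_apply, map_add, e', primLift₂_crossAct]

theorem counit_primLift (hA : IsBraidedBialgebra K c) (x : TensorAlgebra K (prim K A)) :
    Coalgebra.counit (R := K) (primLift K A x) = tensorCounit K (prim K A) x := by
  induction x using tensorAlgebra_left_induction with
  | one => simp [hA.counit_one]
  | smul r x hx => simp only [map_smul, hx]
  | add x y hx hy => simp only [map_add, hx, hy]
  | ι_mul v x hx =>
    rw [map_mul, primLift_ι, hA.counit_mul, counit_eq_zero_of_mem_prim hA v.2, map_mul]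
    simp [tensorCounit]

/-! ### The kernel of the map from the tensor algebra -/

/-- The tensors of degree `n`. -/
abbrev tensorPow (K : Type u) [Field K] (V : Type v) [AddCommGroup V] [Module K V] (n : ℕ) :
    Submodule K (TensorAlgebra K V) :=
  LinearMap.range (TensorAlgebra.ι K : V →ₗ[K] TensorAlgebra K V) ^ n

theorem ι_mul_mem_tensorPow {V : Type v} [AddCommGroup V] [Module K V] {n : ℕ} (v : V)
    {t : TensorAlgebra K V} (ht : t ∈ tensorPow K V n) :
    TensorAlgebra.ι K v * t ∈ tensorPow K V (n + 1) := by
  rw [tensorPow, pow_succ']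
  exact Submodule.mul_mem_mul ⟨v, rfl⟩ ht

theorem primLift_mem_filt (hA : IsBraidedBialgebra K c) (hconn : IsConnectedCoalgebra K A) {n : ℕ}
    {t : TensorAlgebra K (prim K A)} (ht : t ∈ tensorPow K (prim K A) n) :
    primLift K A t ∈ filt K A (n + 1) := by
  induction n generalizing t with
  | zero =>
    rw [tensorPow, pow_zero, Submodule.mem_one] at ht
    obtain ⟨r, rfl⟩ := ht
    rw [AlgHom.commutes, Algebra.algebraMap_eq_smul_one]
    exact Submodule.smul_mem _ _ (one_mem_filt hA 0)
  | succ n ih =>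
    rw [tensorPow, pow_succ'] at ht
    refine Submodule.mul_induction_on ht (fun x hx y hy => ?_) fun x y hx hy => ?_
    · obtain ⟨u, rfl⟩ := hx
      rw [map_mul, primLift_ι]
      exact prim_mul_mem_filt hA hconn u.2 (ih hy)
    · rw [map_add]
      exact add_mem hx hy

/-- The product `V ⊗ T(V) → T(V)`. -/
def tensorMul (K : Type u) [Field K] (V : Type v) [AddCommGroup V] [Module K V] :
    V ⊗[K] TensorAlgebra K V →ₗ[K] TensorAlgebra K V :=
  LinearMap.mul' K _ ∘ₗ (TensorAlgebra.ι K).rTensor (TensorAlgebra K V)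

theorem tensorMul_tmul {V : Type v} [AddCommGroup V] [Module K V] (v : V)
    (t : TensorAlgebra K V) : tensorMul K V (v ⊗ₜ[K] t) = TensorAlgebra.ι K v * t := rfl

/-- The map `v ⊗ (w ⊗ t) ↦ (V ⊗ ∇)(𝔠(v ⊗ w) ⊗ t)`. -/
def tensorCross {V : Type v} [AddCommGroup V] [Module K V] (b : V ⊗[K] V →ₗ[K] V ⊗[K] V) :
    (V ⊗[K] V) ⊗[K] TensorAlgebra K V →ₗ[K] V ⊗[K] TensorAlgebra K V :=
  (tensorMul K V).lTensor V ∘ₗ (TensorProduct.assoc K _ _ _).toLinearMap ∘ₗ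
    b.rTensor (TensorAlgebra K V)

theorem tensorCross_tmul {V : Type v} [AddCommGroup V] [Module K V]
    (b : V ⊗[K] V →ₗ[K] V ⊗[K] V) (z : V ⊗[K] V) (t : TensorAlgebra K V) :
    tensorCross b (z ⊗ₜ[K] t) =
      (tensorMul K V).lTensor V (TensorProduct.assoc K _ _ _ (b z ⊗ₜ[K] t)) := rfl

theorem symProj_tensorMul_tensorCross {V : Type v} [AddCommGroup V] [Module K V]
    (b : V ⊗[K] V →ₗ[K] V ⊗[K] V) (q : K) (v : V) (d : V ⊗[K] TensorAlgebra K V) :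
    symProj b q (tensorMul K V (tensorCross b ((TensorProduct.assoc K _ _ _).symm (v ⊗ₜ[K] d)))) =
      q • symProj b q (TensorAlgebra.ι K v * tensorMul K V d) := by
  induction d using TensorProduct.induction_on with
  | zero => simp
  | add x y hx hy =>
    simp only [TensorProduct.tmul_add, mul_add, map_add, smul_add] at hx hy ⊢
    rw [hx, hy]
  | tmul w t =>
    have e : ∀ z, tensorMul K V ((tensorMul K V).lTensor V (TensorProduct.assoc K _ _ _
        (z ⊗ₜ[K] t))) = tensorSq K V z * t := fun z => by
      induction z using TensorProduct.induction_on with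
      | zero => simp
      | add x y hx hy => simp only [TensorProduct.add_tmul, map_add, hx, hy, add_mul]
      | tmul a b => simp [tensorMul_tmul, tensorSq, mul_assoc]
    have h := symProj_rel b q (v ⊗ₜ[K] w)
    rw [map_sub, map_smul, sub_eq_zero] at h
    rw [TensorProduct.assoc_symm_tmul, tensorCross_tmul, e, map_mul, h, smul_mul_assoc, ← map_mul,
      tensorMul_tmul, ← mul_assoc]
    rfl

theorem lTensor_tensorCross (hA : IsBraidedBialgebra K c) (u : prim K A)
    (d : prim K A ⊗[K] TensorAlgebra K (prim K A)) :
    (primLift K A).toLinearMap.lTensor _ (tensorCross (infBraiding hA)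
      ((TensorProduct.assoc K _ _ _).symm (u ⊗ₜ[K] d))) =
    primCross hA ((TensorProduct.assoc K _ _ _).symm
      (u ⊗ₜ[K] (primLift K A).toLinearMap.lTensor _ d)) := by
  induction d using TensorProduct.induction_on with
  | zero => simp
  | add x y hx hy => simp only [TensorProduct.tmul_add, map_add, hx, hy]
  | tmul w t =>
    rw [LinearMap.lTensor_tmul, TensorProduct.assoc_symm_tmul, TensorProduct.assoc_symm_tmul,
      tensorCross_tmul, primCross, LinearMap.comp_apply, LinearMap.comp_apply,
      LinearMap.rTensor_tmul]
    generalize infBraiding hA (u ⊗ₜ[K] w) = z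
    induction z using TensorProduct.induction_on with
    | zero => simp
    | add x y hx hy => simp only [TensorProduct.add_tmul, map_add, hx, hy]
    | tmul a b => simp [tensorMul_tmul, primMul_tmul, primLift_ι]

theorem tensorCross_mem_range {V : Type v} [AddCommGroup V] [Module K V]
    (b : V ⊗[K] V →ₗ[K] V ⊗[K] V) (v : V) {n : ℕ} {d : V ⊗[K] TensorAlgebra K V}
    (hd : d ∈ LinearMap.range ((tensorPow K V n).subtype.lTensor V)) :
    tensorCross b ((TensorProduct.assoc K _ _ _).symm (v ⊗ₜ[K] d)) ∈
      LinearMap.range ((tensorPow K V (n + 1)).subtype.lTensor V) := by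
  obtain ⟨w, rfl⟩ := hd
  induction w using TensorProduct.induction_on with
  | zero => simp
  | add x y hx hy => simp only [TensorProduct.tmul_add, map_add]; exact add_mem hx hy
  | tmul w t =>
    rw [LinearMap.lTensor_tmul, TensorProduct.assoc_symm_tmul, tensorCross_tmul]
    generalize b (v ⊗ₜ[K] w) = z
    induction z using TensorProduct.induction_on with
    | zero => simp
    | add x y hx hy => simp only [TensorProduct.add_tmul, map_add]; exact add_mem hx hy
    | tmul a b => exact ⟨a ⊗ₜ[K] ⟨_, ι_mul_mem_tensorPow b t.2⟩, rfl⟩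

end PrimLift

section Kernel

variable {K : Type u} [Field K] {A : Type v} [Ring A] [Algebra K A] [Coalgebra K A]
  {c : A ⊗[K] A →ₗ[K] A ⊗[K] A}

theorem map_subtype_primCross_eq_zero (hA : IsBraidedBialgebra K c)
    (hconn : IsConnectedCoalgebra K A) {n : ℕ} (u : prim K A) {d : prim K A ⊗[K] A}
    (hd : d ∈ LinearMap.range ((filt K A n).subtype.lTensor (prim K A))) :
    TensorProduct.map (prim K A).subtype (filt K A (n + 1)).mkQ
      (primCross hA ((TensorProduct.assoc K _ _ _).symm (u ⊗ₜ[K] d))) = 0 := by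
  obtain ⟨w, rfl⟩ := hd
  induction w using TensorProduct.induction_on with
  | zero => simp
  | add x y hx hy => simp only [TensorProduct.tmul_add, map_add, hx, hy, add_zero]
  | tmul v f =>
    rw [LinearMap.lTensor_tmul, TensorProduct.assoc_symm_tmul, primCross, LinearMap.comp_apply,
      LinearMap.comp_apply, LinearMap.rTensor_tmul]
    generalize infBraiding hA (u ⊗ₜ[K] v) = z
    induction z using TensorProduct.induction_on with
    | zero => simp
    | add x y hx hy => simp only [TensorProduct.add_tmul, map_add, hx, hy, add_zero]
    | tmul a b =>
      have h : (filt K A (n + 1)).mkQ ((b : A) * f) = 0 :=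
        mkQ_eq_zero (prim_mul_mem_filt hA hconn b.2 f.2)
      rw [LinearEquiv.coe_coe, TensorProduct.assoc_tmul, LinearMap.lTensor_tmul,
        TensorProduct.map_tmul, primMul_tmul, Submodule.subtype_apply, Submodule.subtype_apply, h,
        TensorProduct.tmul_zero]

/-- For a tensor `t` of degree `n + 1`, an element `d` of `P ⊗ Pⁿ` that represents the component of
degree `(1, n)` of `Δ_T(t)`: its product is `(1 + q + ⋯ + qⁿ) t` in `S(P, 𝔠_P)`, and its image
represents the component of degree `(1, n)` of the comultiplication in `A`. -/
theorem exists_tensor_comul (hA : IsBraidedBialgebra K c) (hconn : IsConnectedCoalgebra K A)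
    (q : K) {n : ℕ} {t : TensorAlgebra K (prim K A)} (ht : t ∈ tensorPow K (prim K A) (n + 1)) :
    ∃ d ∈ LinearMap.range ((tensorPow K (prim K A) n).subtype.lTensor (prim K A)),
      symProj (infBraiding hA) q (tensorMul K _ d) =
        (∑ i ∈ Finset.range (n + 1), q ^ i) • symProj (infBraiding hA) q t ∧
      TensorProduct.map (prim K A).subtype (filt K A n).mkQ (primComul hA (primLift K A t)) =
        TensorProduct.map (prim K A).subtype (filt K A n).mkQ
          ((primLift K A).toLinearMap.lTensor _ d) := by
  induction n generalizing t with
  | zero =>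
    rw [tensorPow, zero_add, pow_one] at ht
    obtain ⟨u, rfl⟩ := ht
    refine ⟨u ⊗ₜ[K] 1, ⟨u ⊗ₜ[K] ⟨1, by rw [tensorPow, pow_zero]; exact Submodule.one_le.1 le_rfl⟩,
      rfl⟩, ?_, ?_⟩
    · simp [tensorMul_tmul]
    · rw [primLift_ι, primComul, LinearMap.comp_apply, mem_prim_iff.1 u.2, map_add,
        TensorProduct.map_tmul, TensorProduct.map_tmul, primProj_coe, primProj_one,
        TensorProduct.zero_tmul, add_zero, LinearMap.lTensor_tmul, AlgHom.toLinearMap_apply,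
        map_one (primLift K A), LinearMap.id_apply]
  | succ n ih =>
    rw [tensorPow, pow_succ'] at ht
    refine Submodule.mul_induction_on ht (fun x hx y hy => ?_) ?_
    · obtain ⟨u, rfl⟩ := hx
      obtain ⟨d, hd, h₁, h₂⟩ := ih hy
      -- the recursion for the component of degree `(1, n + 1)` of `Δ(uy)`
      refine ⟨u ⊗ₜ[K] y + tensorCross (infBraiding hA)
        ((TensorProduct.assoc K _ _ _).symm (u ⊗ₜ[K] d)), add_mem ⟨u ⊗ₜ[K] ⟨y, hy⟩, rfl⟩
          (tensorCross_mem_range _ u hd), ?_, ?_⟩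
      · rw [map_add, map_add, symProj_tensorMul_tensorCross, tensorMul_tmul,
          map_mul (symProj _ _) (TensorAlgebra.ι K u) (tensorMul _ _ d), h₁,
          geom_sum_succ (n := n + 1), map_mul, mul_smul_comm]
        module
      · have hyF : primLift K A y ∈ filt K A (n + 2) := primLift_mem_filt hA hconn hy
        rw [map_mul, primLift_ι,
          map_subtype_primComul hA hconn (prim_mul_mem_filt hA hconn u.2 hyF),
          map_comul_prim_mul hA hconn u hyF, map_add (LinearMap.lTensor _ _),
          lTensor_tensorCross, map_add, map_add]
        congr 1
        -- `d` represents `Δ(φ(y))` only modulo `P ⊗ Fₙ`, which `primCross` sends to `P ⊗ Fₙ₊₁`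
        let L := TensorProduct.map (prim K A).subtype (filt K A (n + 1)).mkQ ∘ₗ primCross hA ∘ₗ
          (TensorProduct.assoc K (prim K A) (prim K A) A).symm.toLinearMap ∘ₗ
            TensorProduct.mk K (prim K A) (prim K A ⊗[K] A) u
        change L _ = L _
        rw [← sub_eq_zero, ← map_sub L]
        refine map_subtype_primCross_eq_zero hA hconn u ?_
        rw [range_lTensor_subtype, LinearMap.mem_ker]
        refine map_eq_zero_of_ker_le (g := (prim K A).subtype) ?_ le_rfl
          (by rw [map_sub, h₂, sub_self])
        rw [Submodule.ker_subtype]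
        exact bot_le
    · rintro x y ⟨d, hd, h₁, h₂⟩ ⟨d', hd', h₁', h₂'⟩
      exact ⟨d + d', add_mem hd hd', by simp only [map_add, h₁, h₁', smul_add],
        by simp only [map_add, h₂, h₂']⟩

/-- A homogeneous tensor whose image in `A` has smaller degree lies in the ideal of relations. -/
theorem symProj_eq_zero_of_mem_filt (hA : IsBraidedBialgebra K c)
    (hconn : IsConnectedCoalgebra K A) {q : K} (hq : IsRegularMark q) {n : ℕ}
    {t : TensorAlgebra K (prim K A)} (ht : t ∈ tensorPow K (prim K A) n)
    (htF : primLift K A t ∈ filt K A n) : symProj (infBraiding hA) q t = 0 := by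
  induction n generalizing t with
  | zero =>
    rw [tensorPow, pow_zero, Submodule.mem_one] at ht
    obtain ⟨r, rfl⟩ := ht
    have h : primLift K A (algebraMap K _ r) = 0 := htF
    have h' := congrArg (Coalgebra.counit (R := K)) h
    rw [counit_primLift hA, AlgHom.commutes, map_zero] at h'
    rw [show r = 0 from h', map_zero, map_zero]
  | succ n ih =>
    obtain ⟨d, ⟨w, rfl⟩, h₁, h₂⟩ := exists_tensor_comul hA hconn q ht
    have h₃ : TensorProduct.map (prim K A).subtype (filt K A n).mkQ
        (primComul hA (primLift K A t)) = 0 := by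
      rw [primComul, LinearMap.comp_apply, ← LinearMap.comp_apply, ← TensorProduct.map_comp,
        LinearMap.comp_id]
      refine map_comul_of_mem_filt hA (j := 0) (fun x hx => ?_) (Submodule.ker_mkQ _).ge
        (by rwa [zero_add, add_comm])
      have hx' : primProj hA x = 0 := filt_one_le_ker_primProj hA hconn hx
      simp [hx']
    -- `P` embeds into `A`, and the kernel of `Tⁿ(P) → A / Fₙ` consists of relations by induction
    have h₄ : TensorProduct.map (TensorAlgebra.ι K) ((symProj (infBraiding hA) q).toLinearMap ∘ₗ
        (tensorPow K (prim K A) n).subtype) w = 0 := by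
      rw [h₂, ← LinearMap.comp_apply, ← LinearMap.comp_apply, LinearMap.comp_assoc,
        ← LinearMap.lTensor_comp, LinearMap.map_comp_lTensor] at h₃
      refine map_eq_zero_of_ker_le ?_ (fun t ht' => ?_) h₃
      · rw [Submodule.ker_subtype]
        exact bot_le
      · exact ih t.2 ((Submodule.Quotient.mk_eq_zero _).1 ht')
    have h₅ : ∀ w, symProj (infBraiding hA) q (tensorMul K _
        ((tensorPow K (prim K A) n).subtype.lTensor _ w)) =
        LinearMap.mul' K _ ((symProj (infBraiding hA) q).toLinearMap.rTensor _
          (TensorProduct.map (TensorAlgebra.ι K) ((symProj (infBraiding hA) q).toLinearMap ∘ₗ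
            (tensorPow K (prim K A) n).subtype) w)) := fun w => by
      induction w using TensorProduct.induction_on with
      | zero => simp
      | add x y hx hy => simp only [map_add, hx, hy]
      | tmul v t => simp [tensorMul_tmul]
    rw [h₅, h₄, map_zero, map_zero] at h₁
    exact (smul_eq_zero.1 h₁.symm).resolve_left (hq.2 (n + 1) n.succ_pos)

/-- The map `T(P) → A` factors through the braided symmetric algebra. -/
theorem primLift_eq_zero_of_symProj (hK : (2 : K) ≠ 0) (hA : IsBraidedBialgebra K c) {q : K}
    (hq : IsRegularMark q) (hq1 : q ≠ 1) (hH : IsHecke (infBraiding hA) q)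
    {t : TensorAlgebra K (prim K A)} (ht : symProj (infBraiding hA) q t = 0) :
    primLift K A t = 0 := by
  rw [symProj_eq_zero_iff] at ht
  refine symIdeal_induction _ q (p := fun t => primLift K A t = 0) (fun z => ?_) (map_zero _)
    (fun x y hx hy => by rw [map_add, hx, hy, add_zero])
    (fun a x hx => by rw [map_mul, hx, mul_zero]) (fun b x hx => by rw [map_mul, hx, zero_mul]) ht
  have e : ∀ z, primLift K A (tensorSq K _ z) = LinearMap.mul' K A (primIncl K A z) := fun z => by
    induction z using TensorProduct.induction_on with
    | zero => simp
    | add x y hx hy => simp only [map_add, hx, hy]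
    | tmul v w => simp [tensorSq, primLift_ι]
  rw [← mulDefect_primIncl_eq_zero hK hA hq hq1 hH z, mulDefect_primIncl hA, ← e, map_sub, map_smul,
    map_add, map_smul, map_add, map_smul, neg_smul, sub_eq_add_neg]

theorem exists_sum_tensorPow {V : Type v} [AddCommGroup V] [Module K V] (t : TensorAlgebra K V) :
    ∃ (N : ℕ) (x : ℕ → TensorAlgebra K V), (∀ i, x i ∈ tensorPow K V i) ∧
      t = ∑ i ∈ Finset.range N, x i := by
  classical
  let 𝒯 : ℕ → Submodule K (TensorAlgebra K V) := tensorPow K V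
  refine ⟨(DirectSum.decompose 𝒯 t).support.sup id + 1, fun i => DirectSum.decompose 𝒯 t i,
    fun i => (DirectSum.decompose 𝒯 t i).2, ?_⟩
  conv_lhs => rw [← DirectSum.sum_support_decompose 𝒯 t]
  refine Finset.sum_subset (fun i hi => ?_) fun i _ hi => ?_
  · exact Finset.mem_range_succ_iff.2 (Finset.le_sup (f := id) hi)
  · rw [DFinsupp.notMem_support_iff.1 hi]
    rfl

/-- The kernel of `T(P) → A` is the ideal of relations: the component of highest degree of an
element of the kernel is a relation, hence can be removed. -/
theorem symProj_eq_zero_of_primLift (hK : (2 : K) ≠ 0) (hA : IsBraidedBialgebra K c)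
    (hconn : IsConnectedCoalgebra K A) {q : K} (hq : IsRegularMark q) (hq1 : q ≠ 1)
    (hH : IsHecke (infBraiding hA) q) {t : TensorAlgebra K (prim K A)}
    (ht : primLift K A t = 0) : symProj (infBraiding hA) q t = 0 := by
  obtain ⟨N, x, hx, rfl⟩ := exists_sum_tensorPow t
  induction N with
  | zero => simp
  | succ N ih =>
    rw [Finset.sum_range_succ, map_add] at ht ⊢
    have h₁ : ∑ i ∈ Finset.range N, primLift K A (x i) ∈ filt K A N :=
      sum_mem fun i hi => filt_mono hA hconn (Finset.mem_range.1 hi)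
        (primLift_mem_filt hA hconn (hx i))
    rw [← map_sum] at h₁
    have h₂ : symProj (infBraiding hA) q (x N) = 0 := by
      refine symProj_eq_zero_of_mem_filt hA hconn hq (hx N) ?_
      rw [eq_neg_of_add_eq_zero_right ht]
      exact neg_mem h₁
    rw [primLift_eq_zero_of_symProj hK hA hq hq1 hH h₂, add_zero] at ht
    rw [ih ht, h₂, add_zero]

theorem primLift_surjective (hA : IsBraidedBialgebra K c) (hconn : IsConnectedCoalgebra K A)
    {q : K} (hq : IsRegularMark q) (hcoc : IsInfCocommutative hA hconn q) :
    Function.Surjective (primLift K A) := by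
  refine fun a => (?_ : a ∈ LinearMap.range (primLift K A).toLinearMap)
  rw [eq_top_of_prim_mul_mem hA hconn hq hcoc (LinearMap.range (primLift K A).toLinearMap)
    ⟨1, map_one (primLift K A)⟩]
  · trivial
  · rintro u hu _ ⟨t, rfl⟩
    exact ⟨TensorAlgebra.ι K ⟨u, hu⟩ * t, by simp [primLift_ι]⟩

/-! ### The isomorphism -/

theorem isoSymAlg (hK : (2 : K) ≠ 0) (hA : IsBraidedBialgebra K c)
    (hconn : IsConnectedCoalgebra K A) {q : K} (hq : IsRegularMark q) (hq1 : q ≠ 1)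
    (hcoc : IsInfCocommutative hA hconn q) (hH : IsHecke (infBraiding hA) q) :
    IsoSymAlg c (infBraiding hA) q (infBraiding_isBraiding hA) hH := by
  let ψ : SymAlg (infBraiding hA) q →ₐ[K] A := Ideal.Quotient.liftₐ _ (primLift K A)
    fun t ht => primLift_eq_zero_of_symProj hK hA hq hq1 hH ((symProj_eq_zero_iff _ _ _).2 ht)
  have hψ : ∀ t, ψ (symProj (infBraiding hA) q t) = primLift K A t := fun t => rfl
  have hsurj := symProj_surjective (infBraiding hA) q
  have hbij : Function.Bijective ψ := by
    constructor
    · rw [injective_iff_map_eq_zero]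
      intro s hs
      obtain ⟨t, rfl⟩ := hsurj s
      exact symProj_eq_zero_of_primLift hK hA hconn hq hq1 hH hs
    · intro a
      obtain ⟨t, rfl⟩ := primLift_surjective hA hconn hq hcoc a
      exact ⟨_, hψ t⟩
  let e : SymAlg (infBraiding hA) q ≃ₐ[K] A := AlgEquiv.ofBijective ψ hbij
  have he : ∀ t, e (symProj (infBraiding hA) q t) = primLift K A t := hψ
  have hes : ∀ t, e.symm (primLift K A t) = symProj (infBraiding hA) q t := fun t => by
    rw [← he, AlgEquiv.symm_apply_apply]
  have hes₂ : ∀ y, TensorProduct.map e.symm.toLinearMap e.symm.toLinearMap (primLift₂ K A y) =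
      symProj₂ (infBraiding hA) q y := fun y => by
    rw [← LinearMap.comp_apply, ← TensorProduct.map_comp]
    congr 2 <;> exact LinearMap.ext hes
  refine ⟨e.symm, ?_, ?_, ?_⟩
  · refine LinearMap.ext fun a => ?_
    obtain ⟨t, rfl⟩ := primLift_surjective hA hconn hq hcoc a
    rw [LinearMap.comp_apply, LinearMap.comp_apply, ← primLift₂_tensorComul hA, hes₂]
    exact (congrArg _ (hes t)).trans (descend_apply _ _ _ _ t)
  · refine LinearMap.ext fun a => ?_
    obtain ⟨t, rfl⟩ := primLift_surjective hA hconn hq hcoc a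
    rw [LinearMap.comp_apply, counit_primLift hA]
    exact (congrArg _ (hes t)).trans (descend_apply _ _ _ _ t)
  · refine LinearMap.ext fun y => ?_
    obtain ⟨y, rfl⟩ := TensorProduct.map_surjective
      (g := (primLift K A).toLinearMap) (g' := (primLift K A).toLinearMap)
      (primLift_surjective hA hconn hq hcoc) (primLift_surjective hA hconn hq hcoc) y
    rw [LinearMap.comp_apply, LinearMap.comp_apply]
    refine Eq.trans (congrArg _ (hes₂ y)) ?_
    refine (descend_apply _ _ _ _ y).trans ?_
    rw [LinearMap.comp_apply, ← hes₂, primLift₂_tensorBraiding hA]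

end Kernel

end

end Braided

theorem mainTheorem1 {K : Type*} [Field K] (hK : ringChar K ≠ 2)
    {A : Type*} [Ring A] [Algebra K A] [Coalgebra K A]
    (c : A ⊗[K] A →ₗ[K] A ⊗[K] A) (hA : Braided.IsBraidedBialgebra K c)
    (hconn : Braided.IsConnectedCoalgebra K A)
    (q : K) (hq : Braided.IsRegularMark q)
    (hcoc : Braided.IsInfCocommutative hA hconn q) :
    ∃ hH : Braided.IsHecke (Braided.infBraiding hA) q,
      q ≠ 1 → Braided.IsoSymAlg c (Braided.infBraiding hA) q
        (Braided.infBraiding_isBraiding hA) hH :=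
  ⟨Braided.isHecke_of_isInfCocommutative hA hconn hcoc, fun hq1 =>
    Braided.isoSymAlg (Ring.two_ne_zero hK) hA hconn hq hq1 hcoc _⟩
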